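/- Let $N\ge 2$ be an integer, $\sigma_1,\sigma_2>-2$, $p>1$, $\varrho>-1$, $u_0\in L^1_{\mathrm{loc}}(\mathbb{R}^N)$ and $w\in L^1(\mathbb{R}^N)$ with $\int_{\mathbb{R}^N}w(x)\,dx>0$. Consider the problem $$|x|^{\sigma_1}u_t=\Delta u+|x|^{\sigma_2}|u|^p+t^{\varrho}w(x)\quad\text{in }(0,\infty)\times\mathbb{R}^N,\qquad u(0,x)=u_0(x).$$ A global weak solution of this problem is a function $u$ such that $u$, $|x|^{\sigma_1}u$ and $|x|^{\sigma_2}|u|^p$ belong to $L^1_{\mathrm{loc}}((0,\infty)\times\mathbb{R}^N)$ and such that, for every $\psi\in C_0^\infty([0,\infty)\times\mathbb{R}^N)$, the following integrals converge absolutely and $$\int_{(0,\infty)\times\mathbb{R}^N}\bigl(-|x|^{\sigma_1}\partial_t\psi-\Delta\psi\bigr)u\,dt\,dx=\int_{\mathbb{R}^N}|x|^{\sigma_1}u_0(x)\psi(0,x)\,dx+\int_{(0,\infty)\times\mathbb{R}^N}\bigl(|x|^{\sigma_2}|u|^p+t^{\varrho}w(x)\bigr)\psi\,dt\,dx.$$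 Then the problem has no global weak solution in each of the following cases: (i) $\varrho>0$ (for every $p>1$); (ii) $-1<\varrho<0$ and $p<p^*:=\dfrac{N+\sigma_2-\varrho(2+\sigma_1)}{N-2-\varrho(2+\sigma_1)}$; (iii) $\varrho=0$ and either $N=2$ (with $p>1$ arbitrary), or $N\ge3$ and $p\le\dfrac{N+\sigma_2}{N-2}$. -/

import Mathlib

open MeasureTheory Set
open scoped ContDiff

noncomputable section

/-- `u` is a global weak solution of
`|x|^σ₁ ∂ₜu = Δu + |x|^σ₂ |u|^p + t^ϱ w(x)` on `(0, ∞) × ℝ^N` with `u(0, ·) = u₀`.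
Only the values of `u` at positive times matter. The test functions `C₀^∞([0, ∞) × ℝ^N)` are the
restrictions to `[0, ∞) × ℝ^N` of smooth compactly supported functions on `ℝ × ℝ^N`. That the
integrals in the weak formulation converge is part of the definition. -/
structure IsGlobalWeakSolution {N : ℕ} (σ₁ σ₂ ϱ p : ℝ)
    (w u₀ : EuclideanSpace ℝ (Fin N) → ℝ) (u : ℝ × EuclideanSpace ℝ (Fin N) → ℝ) : Prop where
  locallyIntegrable_initial : LocallyIntegrable u₀ volume
  locallyIntegrableOn : LocallyIntegrableOn u (Ioi 0 ×ˢ univ) volume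
  locallyIntegrableOn_nonlinearity :
    LocallyIntegrableOn (fun z => ‖z.2‖ ^ σ₂ * |u z| ^ p) (Ioi 0 ×ˢ univ) volume
  locallyIntegrableOn_weighted :
    LocallyIntegrableOn (fun z => ‖z.2‖ ^ σ₁ * u z) (Ioi 0 ×ˢ univ) volume
  weak_formulation : ∀ ψ : ℝ × EuclideanSpace ℝ (Fin N) → ℝ,
    ContDiff ℝ ∞ ψ → HasCompactSupport ψ →
      IntegrableOn (fun z => (-(‖z.2‖ ^ σ₁ * deriv (fun t => ψ (t, z.2)) z.1)
        - Laplacian.laplacian (fun x => ψ (z.1, x)) z.2) * u z) (Ioi 0 ×ˢ univ) volume ∧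
      Integrable (fun x => ‖x‖ ^ σ₁ * u₀ x * ψ (0, x)) volume ∧
      IntegrableOn (fun z => (‖z.2‖ ^ σ₂ * |u z| ^ p + z.1 ^ ϱ * w z.2) * ψ z)
        (Ioi 0 ×ˢ univ) volume ∧
      ∫ z in Ioi 0 ×ˢ univ, (-(‖z.2‖ ^ σ₁ * deriv (fun t => ψ (t, z.2)) z.1)
          - Laplacian.laplacian (fun x => ψ (z.1, x)) z.2) * u z
        = (∫ x, ‖x‖ ^ σ₁ * u₀ x * ψ (0, x))
          + ∫ z in Ioi 0 ×ˢ univ, (‖z.2‖ ^ σ₂ * |u z| ^ p + z.1 ^ ϱ * w z.2) * ψ z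

end

/-
The argument is by test functions (Fujita, Mitidieri–Pohozaev). For a nonnegative test function `ψ`,
Young's inequality absorbs `|x|^σ₂ |u|^p ψ` and bounds `∫∫ t^ϱ w ψ` by
`∫∫ |x|^(σ₂ (1 - q)) |(|x|^σ₁ ∂ₜ + Δ) ψ|^q ψ^(1 - q)`, where `q` is the conjugate exponent of `p`.
For a cutoff at times `t ~ T` and radii `|x| ~ R` the left side behaves like `T^(1 + ϱ) ∫ w` and the
right side is of lower order for a suitable power `T = R^m`; at the critical exponent the cutoff in
space has to be logarithmic.

The time derivative contributes `|x|^(σ₁ q + σ₂ (1 - q))`, which is integrable at `x = 0` only if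
`d = σ₁ q + σ₂ (1 - q) + n` is positive. For `d ≤ 0` the cutoff in time is replaced by a truncated
formal solution `∑ h⁽ʲ⁾(t / T) Pⱼ(x)` of the adjoint equation `|x|^σ₁ ∂ₜψ + Δψ = 0`, whose error
vanishes to a high order at the origin.
-/
open Filter Topology InnerProductSpace
open Module (finrank)

/-- The domain `(0, ∞) × E` of the equation. -/
abbrev positiveTimes (E : Type*) : Set (ℝ × E) := Ioi 0 ×ˢ univ

section DistributionalSolution

variable {E : Type*} [NormedAddCommGroup E] [InnerProductSpace ℝ E] [FiniteDimensional ℝ E]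
  [MeasurableSpace E] [BorelSpace E] {σ₁ σ₂ ϱ p : ℝ} {w : E → ℝ} {u ψ Λ : ℝ × E → ℝ}

/-- `u` solves `|x|^σ₁ ∂ₜu = Δu + |x|^σ₂ |u|^p + t^ϱ w(x)` in the sense of distributions on
`(0, ∞) × E`: the test functions vanish near `t = 0`, so no initial value is prescribed. -/
structure IsDistributionalSolution (σ₁ σ₂ ϱ p : ℝ) (w : E → ℝ) (u : ℝ × E → ℝ) : Prop where
  locallyIntegrableOn : LocallyIntegrableOn u (positiveTimes E) volume
  locallyIntegrableOn_weighted :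
    LocallyIntegrableOn (fun z => ‖z.2‖ ^ σ₁ * u z) (positiveTimes E) volume
  locallyIntegrableOn_reaction :
    LocallyIntegrableOn (fun z => ‖z.2‖ ^ σ₂ * |u z| ^ p) (positiveTimes E) volume
  integral_eq : ∀ ψ : ℝ × E → ℝ,
    ContDiff ℝ ∞ ψ → HasCompactSupport ψ → tsupport ψ ⊆ positiveTimes E →
      ∫ z in positiveTimes E, (-(‖z.2‖ ^ σ₁ * deriv (fun t => ψ (t, z.2)) z.1)
          - Laplacian.laplacian (fun x => ψ (z.1, x)) z.2) * u z
        = ∫ z in positiveTimes E, (‖z.2‖ ^ σ₂ * |u z| ^ p + z.1 ^ ϱ * w z.2) * ψ z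

theorem IsGlobalWeakSolution.isDistributionalSolution {N : ℕ}
    {w u₀ : EuclideanSpace ℝ (Fin N) → ℝ} {u : ℝ × EuclideanSpace ℝ (Fin N) → ℝ}
    (hu : IsGlobalWeakSolution σ₁ σ₂ ϱ p w u₀ u) : IsDistributionalSolution σ₁ σ₂ ϱ p w u where
  locallyIntegrableOn := hu.locallyIntegrableOn
  locallyIntegrableOn_weighted := hu.locallyIntegrableOn_weighted
  locallyIntegrableOn_reaction := hu.locallyIntegrableOn_nonlinearity
  integral_eq ψ hψ hψc hψ0 := by
    have hinitial (x : EuclideanSpace ℝ (Fin N)) : ψ (0, x) = 0 :=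
      image_eq_zero_of_notMem_tsupport fun h => lt_irrefl (0 : ℝ) (hψ0 h).1
    simpa only [hinitial, mul_zero, integral_zero, zero_add]
      using (hu.weak_formulation ψ hψ hψc).2.2.2

/-- `(ψ, Λ)` is a test pair if the weak formulation holds for `ψ`, with `Λ` in the role of
`-|x|^σ₁ ∂ₜψ - Δψ`. Unlike a test function, `ψ` may be singular at `x = 0`. -/
structure IsTestPair (σ₂ ϱ p : ℝ) (w : E → ℝ) (u ψ Λ : ℝ × E → ℝ) : Prop where
  integrable_adjoint : IntegrableOn (fun z => Λ z * u z) (positiveTimes E) volume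
  integrable_reaction :
    IntegrableOn (fun z => ψ z * (‖z.2‖ ^ σ₂ * |u z| ^ p)) (positiveTimes E) volume
  integrable_source :
    IntegrableOn (fun z => ψ z * (z.1 ^ ϱ * w z.2)) (positiveTimes E) volume
  integral_eq : ∫ z in positiveTimes E, Λ z * u z
    = (∫ z in positiveTimes E, ψ z * (‖z.2‖ ^ σ₂ * |u z| ^ p))
      + ∫ z in positiveTimes E, ψ z * (z.1 ^ ϱ * w z.2)

theorem IsTestPair.linearCombination {ι : Type*} (s : Finset ι) (c : ι → ℝ)
    {ψ Λ : ι → ℝ × E → ℝ} (h : ∀ i ∈ s, IsTestPair σ₂ ϱ p w u (ψ i) (Λ i)) :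
    IsTestPair σ₂ ϱ p w u (fun z => ∑ i ∈ s, c i * ψ i z) (fun z => ∑ i ∈ s, c i * Λ i z) := by
  have hΛ i (hi : i ∈ s) := (h i hi).integrable_adjoint.const_mul (c i)
  have hr i (hi : i ∈ s) := (h i hi).integrable_reaction.const_mul (c i)
  have hw i (hi : i ∈ s) := (h i hi).integrable_source.const_mul (c i)
  refine ⟨?_, ?_, ?_, ?_⟩ <;> simp only [Finset.sum_mul, mul_assoc]
  · exact integrable_finsetSum s hΛ
  · exact integrable_finsetSum s hr
  · exact integrable_finsetSum s hw
  · rw [integral_finsetSum s hΛ, integral_finsetSum s hr, integral_finsetSum s hw,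
      ← Finset.sum_add_distrib]
    refine Finset.sum_congr rfl fun i hi => ?_
    rw [integral_const_mul, integral_const_mul, integral_const_mul, (h i hi).integral_eq, mul_add]

end DistributionalSolution

section SpaceProfile

theorem integrable_and_tendsto_integral_mul {α : Type*} [MeasurableSpace α] {μ : Measure α}
    {F : ℕ → α → ℝ} {f v W : α → ℝ} {K : Set α} (hK : MeasurableSet K)
    (hWv : IntegrableOn (fun z => W z * v z) K μ) (hv : AEStronglyMeasurable v μ)
    (hF : ∀ m, AEStronglyMeasurable (F m) μ) (hFK : ∀ m, ∀ z ∉ K, F m z = 0)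
    (hFW : ∀ m, ∀ᵐ z ∂μ, |F m z| ≤ W z)
    (hlim : ∀ᵐ z ∂μ, Tendsto (fun m => F m z) atTop (𝓝 (f z))) :
    (∀ m, Integrable (fun z => F m z * v z) μ) ∧ Integrable (fun z => f z * v z) μ ∧
      Tendsto (fun m => ∫ z, F m z * v z ∂μ) atTop (𝓝 (∫ z, f z * v z ∂μ)) := by
  have hbound : Integrable (K.indicator fun z => |W z * v z|) μ :=
    (integrable_indicator_iff hK).2 hWv.abs
  have hle (m : ℕ) : ∀ᵐ z ∂μ, ‖F m z * v z‖ ≤ K.indicator (fun z => |W z * v z|) z := by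
    filter_upwards [hFW m] with z hz
    by_cases hzK : z ∈ K
    · rw [indicator_of_mem hzK, norm_mul, abs_mul]
      exact mul_le_mul_of_nonneg_right (hz.trans (le_abs_self _)) (abs_nonneg _)
    · simp [indicator_of_notMem hzK, hFK m z hzK]
  have hmeas m := (hF m).mul hv
  have hlim' : ∀ᵐ z ∂μ, Tendsto (fun m => F m z * v z) atTop (𝓝 (f z * v z)) := by
    filter_upwards [hlim] with z hz using hz.mul_const _
  exact ⟨fun m => hbound.mono' (hmeas m) (hle m),
    ⟨aestronglyMeasurable_of_tendsto_ae _ hmeas hlim',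
      hasFiniteIntegral_of_dominated_convergence hbound.2 hle hlim'⟩,
    tendsto_integral_of_dominated_convergence _ hmeas hbound hle hlim'⟩

variable {E : Type*} [NormedAddCommGroup E] [InnerProductSpace ℝ E] [FiniteDimensional ℝ E]
  {σ₁ σ₂ ϱ p : ℝ}

theorem continuous_laplacian {f : E → ℝ} (hf : ContDiff ℝ ∞ f) :
    Continuous (Laplacian.laplacian f) := by
  rw [laplacian_eq_iteratedFDeriv_stdOrthonormalBasis]
  have h2 : Continuous fun x => iteratedFDeriv ℝ 2 f x :=
    (contDiff_infty.1 hf 2).continuous_iteratedFDeriv le_rfl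
  exact continuous_finsetSum _ fun i _ => h2.eval_const _

theorem laplacian_eq_zero_of_forall_notMem {f : E → ℝ} {s : Set E} (hs : IsClosed s)
    (hf : ∀ x ∉ s, f x = 0) {x : E} (hx : x ∉ s) : Laplacian.laplacian f x = 0 := by
  have hev : f =ᶠ[𝓝 x] fun _ => 0 := by
    filter_upwards [hs.isOpen_compl.mem_nhds hx] with y hy using hf y hy
  rw [laplacian_congr_nhds hev |>.eq_of_nhds, laplacian_const]
  rfl

/-- `ζ`, with `Z` in the role of `Δζ`, is the limit away from the origin of the smooth functions
`f m`, which are supported in a fixed ball and bounded along with `Δ (f m) / (1 + |x|^σ₁)`. Such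
limits are the space factors that the integrability of a solution allows in a test pair. -/
structure IsSmoothApproximation (σ₁ : ℝ) (f : ℕ → E → ℝ) (r C : ℝ) (ζ Z : E → ℝ) : Prop where
  contDiff : ∀ m, ContDiff ℝ ∞ (f m)
  eq_zero : ∀ m, ∀ x ∉ Metric.closedBall 0 r, f m x = 0
  abs_le : ∀ m, ∀ x ≠ 0, |f m x| ≤ C
  abs_laplacian_le : ∀ m, ∀ x ≠ 0, |Laplacian.laplacian (f m) x| ≤ C * (1 + ‖x‖ ^ σ₁)
  tendsto : ∀ x ≠ 0, Tendsto (fun m => f m x) atTop (𝓝 (ζ x))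
  tendsto_laplacian : ∀ x ≠ 0, Tendsto (fun m => Laplacian.laplacian (f m) x) atTop (𝓝 (Z x))

theorem IsSmoothApproximation.abs_adjoint_le {f : ℕ → E → ℝ}
    {r C D t : ℝ} {ζ Z : E → ℝ} {η : ℝ → ℝ} (hf : IsSmoothApproximation σ₁ f r C ζ Z)
    (hη : |η t| ≤ D) (hη' : |deriv η t| ≤ D) (m : ℕ) {x : E} (hx : x ≠ 0) :
    |-(‖x‖ ^ σ₁ * (deriv η t * f m x)) - η t * Laplacian.laplacian (f m) x|
      ≤ 2 * D * C * (1 + ‖x‖ ^ σ₁) := by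
  have hC : 0 ≤ C := (abs_nonneg _).trans (hf.abs_le m _ hx)
  have hD : 0 ≤ D := (abs_nonneg _).trans hη
  refine (abs_sub _ _).trans ?_
  rw [abs_neg, abs_mul, abs_mul, abs_mul, abs_of_nonneg (by positivity : 0 ≤ ‖x‖ ^ σ₁)]
  calc _ ≤ ‖x‖ ^ σ₁ * (D * C) + D * (C * (1 + ‖x‖ ^ σ₁)) := by
        gcongr
        exacts [hf.abs_le m _ hx, hf.abs_laplacian_le m _ hx]
    _ ≤ _ := by linarith [mul_nonneg hD hC]

/-- A smooth function of time with compact support in `(0, ∞)`, contained in `[a, b]`. -/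
structure IsTimeProfile (a b : ℝ) (η : ℝ → ℝ) : Prop where
  contDiff : ContDiff ℝ ∞ η
  pos : 0 < a
  eq_zero : ∀ t ∉ Icc a b, η t = 0

namespace IsTimeProfile

variable {a b : ℝ} {η : ℝ → ℝ}

theorem hasCompactSupport (hη : IsTimeProfile a b η) : HasCompactSupport η :=
  HasCompactSupport.intro isCompact_Icc hη.eq_zero

theorem tsupport_subset (hη : IsTimeProfile a b η) : tsupport η ⊆ Icc a b :=
  closure_minimal (Function.support_subset_iff'.2 hη.eq_zero) isClosed_Icc

theorem continuous_deriv (hη : IsTimeProfile a b η) : Continuous (deriv η) :=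
  hη.contDiff.continuous_deriv (by simp)

theorem deriv_eq_zero (hη : IsTimeProfile a b η) {t : ℝ} (ht : t ∉ Icc a b) : deriv η t = 0 :=
  image_eq_zero_of_notMem_tsupport fun h => ht (hη.tsupport_subset (tsupport_deriv_subset h))

theorem exists_bound (hη : IsTimeProfile a b η) : ∃ D, ∀ t, |η t| ≤ D ∧ |deriv η t| ≤ D := by
  obtain ⟨D, hD⟩ := hη.hasCompactSupport.exists_bound_of_continuous hη.contDiff.continuous
  obtain ⟨D', hD'⟩ := hη.hasCompactSupport.deriv.exists_bound_of_continuous hη.continuous_deriv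
  exact ⟨max D D', fun t => ⟨(hD t).trans (le_max_left _ _), (hD' t).trans (le_max_right _ _)⟩⟩

end IsTimeProfile

variable [MeasurableSpace E] [BorelSpace E]

theorem integrableOn_rpow_mul_prod {w : E → ℝ} (hw : Integrable w volume) {a b : ℝ} (ha : 0 < a)
    {s : Set E} : IntegrableOn (fun z : ℝ × E => z.1 ^ ϱ * w z.2) (Icc a b ×ˢ s) volume := by
  have hcont : ContinuousOn (fun t : ℝ => t ^ ϱ) (Icc a b) := fun t ht =>
    (Real.continuousAt_rpow_const _ _ (Or.inl (ha.trans_le ht.1).ne')).continuousWithinAt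
  rw [IntegrableOn, Measure.volume_eq_prod, ← Measure.prod_restrict]
  exact (hcont.integrableOn_compact isCompact_Icc).mul_prod hw.integrableOn

theorem IsDistributionalSolution.integral_separated {w : E → ℝ} {u : ℝ × E → ℝ}
    (hu : IsDistributionalSolution σ₁ σ₂ ϱ p w u) {η : ℝ → ℝ} {a b : ℝ}
    (hη : IsTimeProfile a b η) {f : E → ℝ} (hf : ContDiff ℝ ∞ f) (hfc : HasCompactSupport f) :
    ∫ z in positiveTimes E,
        (-(‖z.2‖ ^ σ₁ * (deriv η z.1 * f z.2)) - η z.1 * Laplacian.laplacian f z.2) * u z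
      = ∫ z in positiveTimes E,
        η z.1 * f z.2 * (‖z.2‖ ^ σ₂ * |u z| ^ p) + η z.1 * f z.2 * (z.1 ^ ϱ * w z.2) := by
  have hsub : tsupport (fun z : ℝ × E => η z.1 * f z.2) ⊆ tsupport η ×ˢ tsupport f :=
    closure_minimal (fun z hz => ⟨subset_tsupport _ (left_ne_zero_of_mul hz),
      subset_tsupport _ (right_ne_zero_of_mul hz)⟩)
      ((isClosed_tsupport η).prod (isClosed_tsupport f))
  have h := hu.integral_eq (fun z => η z.1 * f z.2)
    ((hη.contDiff.comp contDiff_fst).mul (hf.comp contDiff_snd))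
    ((hη.hasCompactSupport.isCompact.prod hfc.isCompact).of_isClosed_subset
      (isClosed_tsupport _) hsub)
    fun z hz => ⟨hη.pos.trans_le (hη.tsupport_subset (hsub hz).1).1, mem_univ _⟩
  have hlap (z : ℝ × E) : Laplacian.laplacian (fun x => η z.1 * f x) z.2
      = η z.1 * Laplacian.laplacian f z.2 :=
    laplacian_smul (η z.1) (contDiff_infty.1 hf 2).contDiffAt
  simp only [deriv_mul_const_field, hlap] at h
  rw [h]
  exact integral_congr_ae (Eventually.of_forall fun z => by ring)

variable [Nontrivial E]

theorem ae_positiveTimes :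
    ∀ᵐ z : ℝ × E ∂volume.restrict (positiveTimes E), 0 < z.1 ∧ z.2 ≠ 0 := by
  have hne : ∀ᵐ z : ℝ × E ∂volume, z.2 ≠ 0 :=
    Measure.quasiMeasurePreserving_snd.ae (Measure.ae_ne volume (0 : E))
  filter_upwards [ae_restrict_mem (measurableSet_Ioi.prod MeasurableSet.univ),
    ae_restrict_of_ae hne] with z hz hz' using ⟨hz.1, hz'⟩

section Approximation

variable {f : ℕ → E → ℝ} {r C a b : ℝ} {ζ Z : E → ℝ} {η : ℝ → ℝ}

theorem IsSmoothApproximation.tendsto_integral (hf : IsSmoothApproximation σ₁ f r C ζ Z)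
    (hη : IsTimeProfile a b η) {v : ℝ × E → ℝ}
    (hv : AEStronglyMeasurable v (volume.restrict (positiveTimes E)))
    (hvK : IntegrableOn v (Icc a b ×ˢ Metric.closedBall 0 r) volume) :
    (∀ m, IntegrableOn (fun z => η z.1 * f m z.2 * v z) (positiveTimes E) volume) ∧
      IntegrableOn (fun z => η z.1 * ζ z.2 * v z) (positiveTimes E) volume ∧
      Tendsto (fun m => ∫ z in positiveTimes E, η z.1 * f m z.2 * v z) atTop
        (𝓝 (∫ z in positiveTimes E, η z.1 * ζ z.2 * v z)) := by
  obtain ⟨D, hD⟩ := hη.exists_bound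
  refine integrable_and_tendsto_integral_mul (W := fun _ => D * C)
    (measurableSet_Icc.prod measurableSet_closedBall)
    ((hvK.mono_measure Measure.restrict_le_self).const_mul _) hv (fun m => ?_)
    (fun m z hz => ?_) (fun m => ?_) ?_
  · exact ((hη.contDiff.continuous.comp continuous_fst).mul
      ((hf.contDiff m).continuous.comp continuous_snd)).aestronglyMeasurable
  · rcases not_and_or.1 hz with h | h <;> simp [hη.eq_zero, hf.eq_zero, h]
  · filter_upwards [ae_positiveTimes] with z hz
    rw [abs_mul]
    exact mul_le_mul (hD _).1 (hf.abs_le m _ hz.2) (abs_nonneg _) ((abs_nonneg _).trans (hD 0).1)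
  · filter_upwards [ae_positiveTimes] with z hz using (hf.tendsto _ hz.2).const_mul _

theorem IsSmoothApproximation.tendsto_integral_adjoint (hf : IsSmoothApproximation σ₁ f r C ζ Z)
    (hη : IsTimeProfile a b η) {v : ℝ × E → ℝ}
    (hv : AEStronglyMeasurable v (volume.restrict (positiveTimes E)))
    (hvK : IntegrableOn v (Icc a b ×ˢ Metric.closedBall 0 r) volume)
    (hvσ : IntegrableOn (fun z => ‖z.2‖ ^ σ₁ * v z) (Icc a b ×ˢ Metric.closedBall 0 r) volume) :
    IntegrableOn (fun z => (-(‖z.2‖ ^ σ₁ * (deriv η z.1 * ζ z.2)) - η z.1 * Z z.2) * v z)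
        (positiveTimes E) volume ∧
      Tendsto (fun m => ∫ z in positiveTimes E, (-(‖z.2‖ ^ σ₁ * (deriv η z.1 * f m z.2))
          - η z.1 * Laplacian.laplacian (f m) z.2) * v z) atTop
        (𝓝 (∫ z in positiveTimes E,
          (-(‖z.2‖ ^ σ₁ * (deriv η z.1 * ζ z.2)) - η z.1 * Z z.2) * v z)) := by
  obtain ⟨D, hD⟩ := hη.exists_bound
  have hW : IntegrableOn (fun z => 2 * D * C * (1 + ‖z.2‖ ^ σ₁) * v z)
      (Icc a b ×ˢ Metric.closedBall 0 r) volume :=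
    ((hvK.add hvσ).const_mul (2 * D * C)).congr
      (Eventually.of_forall fun z => by simp only [Pi.add_apply]; ring)
  set F : ℕ → ℝ × E → ℝ := fun m z => -(‖z.2‖ ^ σ₁ * (deriv η z.1 * f m z.2))
    - η z.1 * Laplacian.laplacian (f m) z.2
  have hF (m : ℕ) : AEStronglyMeasurable (F m) (volume.restrict (positiveTimes E)) := by
    have htime : Continuous fun z : ℝ × E => deriv η z.1 * f m z.2 :=
      (hη.continuous_deriv.comp continuous_fst).mul ((hf.contDiff m).continuous.comp continuous_snd)
    have hspace : Continuous fun z : ℝ × E => η z.1 * Laplacian.laplacian (f m) z.2 :=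
      (hη.contDiff.continuous.comp continuous_fst).mul
        ((continuous_laplacian (hf.contDiff m)).comp continuous_snd)
    have hnorm : Measurable fun z : ℝ × E => ‖z.2‖ ^ σ₁ := by fun_prop
    exact ((hnorm.mul htime.measurable).neg.sub hspace.measurable).aestronglyMeasurable
  have hFK (m : ℕ) : ∀ z ∉ Icc a b ×ˢ Metric.closedBall (0 : E) r, F m z = 0 := fun z hz => by
    rcases not_and_or.1 hz with h | h
    · simp [F, hη.eq_zero, hη.deriv_eq_zero, h]
    · simp [F, hf.eq_zero, laplacian_eq_zero_of_forall_notMem Metric.isClosed_closedBall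
        (hf.eq_zero m), h]
  have hFW (m : ℕ) : ∀ᵐ z ∂volume.restrict (positiveTimes E),
      |F m z| ≤ 2 * D * C * (1 + ‖z.2‖ ^ σ₁) := by
    filter_upwards [ae_positiveTimes] with z hz
      using hf.abs_adjoint_le (hD z.1).1 (hD z.1).2 m hz.2
  have hFlim : ∀ᵐ z ∂volume.restrict (positiveTimes E), Tendsto (fun m => F m z) atTop
      (𝓝 (-(‖z.2‖ ^ σ₁ * (deriv η z.1 * ζ z.2)) - η z.1 * Z z.2)) := by
    filter_upwards [ae_positiveTimes] with z hz
    exact (((hf.tendsto _ hz.2).const_mul _).const_mul _).neg.sub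
      ((hf.tendsto_laplacian _ hz.2).const_mul _)
  exact (integrable_and_tendsto_integral_mul (measurableSet_Icc.prod measurableSet_closedBall)
    (hW.mono_measure Measure.restrict_le_self) hv hF hFK hFW hFlim).2

theorem IsDistributionalSolution.isTestPair {w : E → ℝ} {u : ℝ × E → ℝ}
    (hu : IsDistributionalSolution σ₁ σ₂ ϱ p w u) (hw : Integrable w volume)
    (hη : IsTimeProfile a b η) (hf : IsSmoothApproximation σ₁ f r C ζ Z) :
    IsTestPair σ₂ ϱ p w u (fun z => η z.1 * ζ z.2)
      (fun z => -(‖z.2‖ ^ σ₁ * (deriv η z.1 * ζ z.2)) - η z.1 * Z z.2) := by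
  have hK : IsCompact (Icc a b ×ˢ Metric.closedBall (0 : E) r) :=
    isCompact_Icc.prod (isCompact_closedBall 0 r)
  have hKpos : Icc a b ×ˢ Metric.closedBall (0 : E) r ⊆ positiveTimes E :=
    fun z hz => ⟨hη.pos.trans_le hz.1.1, mem_univ _⟩
  have hwmeas : Measurable fun z : ℝ × E => z.1 ^ ϱ := by fun_prop
  obtain ⟨hr, hr', hrlim⟩ := hf.tendsto_integral hη
    hu.locallyIntegrableOn_reaction.aestronglyMeasurable
    (hu.locallyIntegrableOn_reaction.integrableOn_compact_subset hKpos hK)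
  obtain ⟨hs, hs', hslim⟩ := hf.tendsto_integral hη (v := fun z => z.1 ^ ϱ * w z.2)
    (hwmeas.aestronglyMeasurable.mul hw.1.comp_snd).restrict (integrableOn_rpow_mul_prod hw hη.pos)
  obtain ⟨hΛ', hΛlim⟩ := hf.tendsto_integral_adjoint hη
    hu.locallyIntegrableOn.aestronglyMeasurable
    (hu.locallyIntegrableOn.integrableOn_compact_subset hKpos hK)
    (hu.locallyIntegrableOn_weighted.integrableOn_compact_subset hKpos hK)
  have heq (m : ℕ) := hu.integral_separated hη (hf.contDiff m)
    (HasCompactSupport.intro (isCompact_closedBall 0 r) (hf.eq_zero m))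
  simp only [heq, integral_add (hr _) (hs _)] at hΛlim
  exact ⟨hΛ', hr', hs', tendsto_nhds_unique hΛlim (hrlim.add hslim)⟩

end Approximation

end SpaceProfile

section RadialLaplacian

/-- The Laplacian of `x ↦ φ (|x|²)` in dimension `n`, as a function of `q = |x|²`. Multiplication by
a power of `q` shifts the dimension, so `n` may be any real number. -/
noncomputable def radialLaplacian (n : ℝ) (φ : ℝ → ℝ) (q : ℝ) : ℝ :=
  4 * q * deriv (deriv φ) q + 2 * n * deriv φ q

theorem mul_abs_radialLaplacian_le {n q : ℝ} (hn : 0 ≤ n) (hq : 0 < q) (φ : ℝ → ℝ) :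
    q * |radialLaplacian n φ q|
      ≤ 4 * (q ^ 2 * |deriv (deriv φ) q|) + 2 * n * (q * |deriv φ q|) := by
  calc q * |radialLaplacian n φ q|
      = |4 * (q ^ 2 * deriv (deriv φ) q) + 2 * n * (q * deriv φ q)| := by
        rw [← abs_of_pos hq, ← abs_mul, abs_of_pos hq, radialLaplacian]
        ring_nf
    _ ≤ _ := by
        refine (abs_add_le _ _).trans_eq ?_
        simp only [abs_mul, abs_of_pos hq, abs_pow, Nat.abs_ofNat, abs_of_nonneg hn]

variable {E : Type*} [NormedAddCommGroup E] [InnerProductSpace ℝ E] {φ : ℝ → ℝ}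

theorem laplacian_comp_norm_sq [FiniteDimensional ℝ E] {x : E} (hφ : ContDiffAt ℝ 2 φ (‖x‖ ^ 2)) :
    Laplacian.laplacian (fun y : E => φ (‖y‖ ^ 2)) x
      = radialLaplacian (finrank ℝ E) φ (‖x‖ ^ 2) := by
  have hq (y : E) : HasFDerivAt (fun y : E => ‖y‖ ^ 2) (2 • (innerSL ℝ y)) y :=
    (hasStrictFDerivAt_norm_sq y).hasFDerivAt
  have hcont : ContinuousAt (fun y : E => ‖y‖ ^ 2) x := by fun_prop
  have h1 : fderiv ℝ (fun y : E => φ (‖y‖ ^ 2))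
      =ᶠ[𝓝 x] fun y => deriv φ (‖y‖ ^ 2) • (2 • (innerSL ℝ y)) := by
    filter_upwards [hcont.eventually (hφ.eventually (by simp))] with y hy
    exact ((hy.differentiableAt (by simp)).hasDerivAt.comp_hasFDerivAt y (hq y)).fderiv
  have h2 : HasFDerivAt (fun y : E => deriv φ (‖y‖ ^ 2) • (2 • (innerSL ℝ y)))
      (deriv φ (‖x‖ ^ 2) • (2 • (innerSL ℝ : E →L[ℝ] _)) +
        (deriv (deriv φ) (‖x‖ ^ 2) • (2 • (innerSL ℝ x))).smulRight (2 • (innerSL ℝ x))) x :=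
    ((((hφ.derivWithin (m := 1) (by norm_num)).differentiableAt
      (by simp)).hasDerivAt).comp_hasFDerivAt x (hq x)).smul
      ((2 • (innerSL ℝ : E →L[ℝ] _)).hasFDerivAt)
  rw [laplacian_eq_iteratedFDeriv_stdOrthonormalBasis]
  simp only [iteratedFDeriv_two_apply]
  rw [h1.fderiv_eq, h2.fderiv]
  have hv (v w : E) : (innerSL ℝ v) w = inner ℝ v w := rfl
  simp only [Matrix.cons_val_zero, Matrix.cons_val_one, add_apply, smul_apply,
    ContinuousLinearMap.smulRight_apply, smul_eq_mul, nsmul_eq_mul, hv, Finset.sum_add_distrib,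
    real_inner_self_eq_norm_sq, OrthonormalBasis.norm_eq_one]
  rw [radialLaplacian, ← (stdOrthonormalBasis ℝ E).sum_sq_inner_left x, Finset.mul_sum,
    Finset.sum_mul, add_comm]
  congr 1
  · exact Finset.sum_congr rfl fun i _ => by push_cast; ring
  · simp; ring

theorem contDiff_comp_norm_sq (hφ : ∀ q > 0, ContDiffAt ℝ ∞ φ q) {c δ : ℝ} (hδ : 0 < δ)
    (hc : ∀ q, 0 ≤ q → q < δ → φ q = c) : ContDiff ℝ ∞ fun x : E => φ (‖x‖ ^ 2) := by
  refine contDiff_iff_contDiffAt.2 fun x => ?_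
  rcases eq_or_ne x 0 with rfl | hx
  · have hnear : ∀ᶠ y : E in 𝓝 0, ‖y‖ ^ 2 < δ :=
      ContinuousAt.eventually_lt (by fun_prop) continuousAt_const (by simpa using hδ)
    refine (contDiffAt_const (c := c)).congr_of_eventuallyEq ?_
    filter_upwards [hnear] with y hy using hc _ (by positivity) hy
  · exact (hφ _ (by positivity)).comp x (contDiff_norm_sq ℝ).contDiffAt

end RadialLaplacian

section Symbol

/-- `φ` is smooth on `(0, ∞)` and, up to two derivatives, of size `C q ^ κ` in the sense of symbol
estimates: each derivative gains a factor `q⁻¹`. -/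
structure IsSymbol (κ C : ℝ) (φ : ℝ → ℝ) : Prop where
  contDiffAt : ∀ q > 0, ContDiffAt ℝ ∞ φ q
  abs_le : ∀ q > 0, |φ q| ≤ C * q ^ κ
  abs_deriv_le : ∀ q > 0, q * |deriv φ q| ≤ C * q ^ κ
  abs_deriv_deriv_le : ∀ q > 0, q ^ 2 * |deriv (deriv φ) q| ≤ C * q ^ κ

namespace IsSymbol

variable {κ μ C D : ℝ} {φ χ : ℝ → ℝ}

theorem rpow (κ : ℝ) : IsSymbol κ (1 + |κ| + |κ * (κ - 1)|) fun q => q ^ κ := by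
  have hd : deriv (fun q : ℝ => q ^ κ) = fun q => κ * q ^ (κ - 1) :=
    funext fun q => Real.deriv_rpow_const q κ
  have hdd : deriv (deriv fun q : ℝ => q ^ κ) = fun q => κ * ((κ - 1) * q ^ (κ - 2)) := by
    funext q
    rw [hd, deriv_const_mul_field, Real.deriv_rpow_const, sub_sub, one_add_one_eq_two]
  refine ⟨fun q hq => Real.contDiffAt_rpow_const_of_ne hq.ne', fun q hq => ?_, fun q hq => ?_,
    fun q hq => ?_⟩
  · rw [abs_of_pos (by positivity)]
    exact le_mul_of_one_le_left (by positivity)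
      (by linarith [abs_nonneg κ, abs_nonneg (κ * (κ - 1))])
  · rw [hd, abs_mul, abs_of_pos (by positivity : 0 < q ^ (κ - 1)), mul_left_comm,
      Real.rpow_sub_one hq.ne', mul_div_cancel₀ _ hq.ne']
    gcongr
    linarith [abs_nonneg (κ * (κ - 1))]
  · simp only [hdd]
    rw [← mul_assoc, abs_mul, abs_of_pos (by positivity : 0 < q ^ (κ - 2)), mul_left_comm,
      Real.rpow_sub hq, Real.rpow_two, mul_div_cancel₀ _ (by positivity)]
    gcongr
    linarith [abs_nonneg κ]

theorem const_nonneg (hφ : IsSymbol κ C φ) : 0 ≤ C := by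
  simpa using (abs_nonneg _).trans (hφ.abs_le 1 one_pos)

theorem hasDerivAt (hφ : IsSymbol κ C φ) {q : ℝ} (hq : 0 < q) : HasDerivAt φ (deriv φ q) q :=
  ((hφ.contDiffAt q hq).differentiableAt (by simp)).hasDerivAt

theorem hasDerivAt_deriv (hφ : IsSymbol κ C φ) {q : ℝ} (hq : 0 < q) :
    HasDerivAt (deriv φ) (deriv (deriv φ) q) q :=
  (((hφ.contDiffAt q hq).derivWithin (m := ∞) (by simp)).differentiableAt
    (by simp)).hasDerivAt

theorem deriv_mul (hφ : IsSymbol κ C φ) (hχ : IsSymbol μ D χ) {q : ℝ} (hq : 0 < q) :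
    deriv (fun q => φ q * χ q) q = deriv φ q * χ q + φ q * deriv χ q :=
  ((hφ.hasDerivAt hq).mul (hχ.hasDerivAt hq)).deriv

theorem deriv_deriv_mul (hφ : IsSymbol κ C φ) (hχ : IsSymbol μ D χ) {q : ℝ} (hq : 0 < q) :
    deriv (deriv fun q => φ q * χ q) q
      = deriv (deriv φ) q * χ q + 2 * (deriv φ q * deriv χ q) + φ q * deriv (deriv χ) q := by
  have hev : deriv (fun q => φ q * χ q) =ᶠ[𝓝 q] fun q => deriv φ q * χ q + φ q * deriv χ q := by
    filter_upwards [lt_mem_nhds hq] with y hy using hφ.deriv_mul hχ hy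
  rw [hev.deriv_eq]
  refine ((((hφ.hasDerivAt_deriv hq).mul (hχ.hasDerivAt hq)).add
    ((hφ.hasDerivAt hq).mul (hχ.hasDerivAt_deriv hq))).deriv).trans ?_
  ring

theorem mul (hφ : IsSymbol κ C φ) (hχ : IsSymbol μ D χ) :
    IsSymbol (κ + μ) (4 * (C * D)) fun q => φ q * χ q := by
  have hprod {q x y : ℝ} (hq : 0 < q) (hx : |x| ≤ C * q ^ κ) (hy : |y| ≤ D * q ^ μ) :
      |x * y| ≤ C * D * q ^ (κ + μ) := by
    rw [abs_mul, Real.rpow_add hq]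
    calc |x| * |y| ≤ C * q ^ κ * (D * q ^ μ) :=
          mul_le_mul hx hy (abs_nonneg _) ((abs_nonneg _).trans hx)
      _ = _ := by ring
  have h1 {q : ℝ} (hq : 0 < q) : |q * deriv φ q| ≤ C * q ^ κ ∧ |q * deriv χ q| ≤ D * q ^ μ := by
    simpa only [abs_mul, abs_of_pos hq] using ⟨hφ.abs_deriv_le q hq, hχ.abs_deriv_le q hq⟩
  have h2 {q : ℝ} (hq : 0 < q) :
      |q ^ 2 * deriv (deriv φ) q| ≤ C * q ^ κ ∧ |q ^ 2 * deriv (deriv χ) q| ≤ D * q ^ μ := by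
    simpa only [abs_mul, abs_of_pos (pow_pos hq 2)]
      using ⟨hφ.abs_deriv_deriv_le q hq, hχ.abs_deriv_deriv_le q hq⟩
  refine ⟨fun q hq => (hφ.contDiffAt q hq).mul (hχ.contDiffAt q hq), fun q hq => ?_,
    fun q hq => ?_, fun q hq => ?_⟩
  · have h00 := hprod hq (hφ.abs_le q hq) (hχ.abs_le q hq)
    linarith [abs_nonneg (φ q * χ q)]
  · have h10 := _root_.abs_le.1 (hprod hq (h1 hq).1 (hχ.abs_le q hq))
    have h01 := _root_.abs_le.1 (hprod hq (hφ.abs_le q hq) (h1 hq).2)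
    rw [hφ.deriv_mul hχ hq, ← abs_of_pos hq, ← abs_mul, abs_of_pos hq, _root_.abs_le]
    constructor <;> linarith
  · have h20 := _root_.abs_le.1 (hprod hq (h2 hq).1 (hχ.abs_le q hq))
    have h11 := _root_.abs_le.1 (hprod hq (h1 hq).1 (h1 hq).2)
    have h02 := _root_.abs_le.1 (hprod hq (hφ.abs_le q hq) (h2 hq).2)
    rw [hφ.deriv_deriv_mul hχ hq, ← abs_of_pos (pow_pos hq 2), ← abs_mul,
      _root_.abs_le]
    constructor <;> linarith

theorem abs_radialLaplacian_le (hφ : IsSymbol κ C φ) {n : ℝ} (hn : 0 ≤ n) {q : ℝ} (hq : 0 < q) :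
    |radialLaplacian n φ q| ≤ (4 + 2 * n) * C * q ^ (κ - 1) := by
  have h1 := hφ.abs_deriv_le q hq
  have h2 := hφ.abs_deriv_deriv_le q hq
  rw [Real.rpow_sub_one hq.ne', mul_div_assoc', le_div_iff₀ hq, mul_comm _ q]
  calc _ ≤ 4 * (q ^ 2 * |deriv (deriv φ) q|) + 2 * n * (q * |deriv φ q|) :=
        mul_abs_radialLaplacian_le hn hq φ
    _ ≤ 4 * (C * q ^ κ) + 2 * n * (C * q ^ κ) := by gcongr
    _ = _ := by ring

theorem radialLaplacian_rpow_mul (hχ : IsSymbol μ D χ) (n κ : ℝ) {q : ℝ} (hq : 0 < q) :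
    radialLaplacian n (fun q => q ^ κ * χ q) q
      = 2 * κ * (2 * κ + n - 2) * q ^ (κ - 1) * χ q
        + q ^ κ * radialLaplacian (n + 4 * κ) χ q := by
  have hd : deriv (fun q : ℝ => q ^ κ) = fun q => κ * q ^ (κ - 1) :=
    funext fun q => Real.deriv_rpow_const q κ
  rw [radialLaplacian, (rpow κ).deriv_mul hχ hq, (rpow κ).deriv_deriv_mul hχ hq, hd,
    deriv_const_mul_field, Real.deriv_rpow_const, radialLaplacian]
  simp only [Real.rpow_sub_one hq.ne']
  field_simp
  ring

end IsSymbol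

end Symbol

section SmoothStep

/-- A smooth step from `0` on `(-∞, 0]` to `1` on `[1, ∞)` whose first two derivatives are bounded
by `C θ^(1/p)`; this is the property of a cutoff that Young's inequality requires. -/
structure IsSmoothStep (p C : ℝ) (θ : ℝ → ℝ) : Prop where
  contDiff : ContDiff ℝ ∞ θ
  nonneg : ∀ t, 0 ≤ θ t
  le_one : ∀ t, θ t ≤ 1
  eq_zero : ∀ t ≤ 0, θ t = 0
  eq_one : ∀ t, 1 ≤ t → θ t = 1
  abs_deriv_le : ∀ t, |deriv θ t| ≤ C * θ t ^ p⁻¹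
  abs_deriv_deriv_le : ∀ t, |deriv (deriv θ) t| ≤ C * θ t ^ p⁻¹

theorem exists_bound_deriv_smoothTransition :
    ∃ A, ∀ t, |deriv Real.smoothTransition t| ≤ A ∧
      |deriv (deriv Real.smoothTransition) t| ≤ A := by
  have hf : ContDiff ℝ ∞ (deriv Real.smoothTransition) :=
    (contDiff_infty_iff_deriv.1 Real.smoothTransition.contDiff).2
  have hsupp : HasCompactSupport (deriv Real.smoothTransition) := by
    refine HasCompactSupport.intro isCompact_Icc fun t (ht : t ∉ Icc 0 1) => ?_
    have hconst : ∃ c : ℝ, Real.smoothTransition =ᶠ[𝓝 t] fun _ => c := by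
      rcases lt_or_ge t 0 with h | h
      · exact ⟨0, by filter_upwards [gt_mem_nhds h] with s hs
          using Real.smoothTransition.zero_of_nonpos hs.le⟩
      · exact ⟨1, by filter_upwards [lt_mem_nhds (not_le.1 fun h1 => ht ⟨h, h1⟩)] with s hs
          using Real.smoothTransition.one_of_one_le hs.le⟩
    obtain ⟨c, hc⟩ := hconst
    rw [hc.deriv_eq, deriv_const]
  obtain ⟨A, hA⟩ := hsupp.exists_bound_of_continuous hf.continuous
  obtain ⟨B, hB⟩ := hsupp.deriv.exists_bound_of_continuous (hf.continuous_deriv (by simp))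
  exact ⟨max A B, fun t => ⟨(hA t).trans (le_max_left _ _), (hB t).trans (le_max_right _ _)⟩⟩

theorem exists_bound_deriv_pow {f : ℝ → ℝ} (hf : ContDiff ℝ ∞ f) (hf0 : ∀ t, 0 ≤ f t)
    (hf1 : ∀ t, f t ≤ 1) {A : ℝ} (hA : ∀ t, |deriv f t| ≤ A ∧ |deriv (deriv f) t| ≤ A) (n : ℕ) :
    ∃ C, ∀ t, |deriv (fun t => f t ^ (n + 2)) t| ≤ C * f t ^ n ∧
      |deriv (deriv fun t => f t ^ (n + 2)) t| ≤ C * f t ^ n := by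
  have hA0 : 0 ≤ A := (abs_nonneg _).trans (hA 0).1
  have hD (t : ℝ) : HasDerivAt f (deriv f t) t := (hf.differentiable (by simp) t).hasDerivAt
  have hDD (t : ℝ) : HasDerivAt (deriv f) (deriv (deriv f) t) t :=
    ((contDiff_infty_iff_deriv.1 hf).2.differentiable (by simp) t).hasDerivAt
  have hd : deriv (fun t => f t ^ (n + 2)) = fun t => (n + 2) * f t ^ (n + 1) * deriv f t := by
    funext t
    rw [((hD t).fun_pow (n + 2)).deriv]
    push_cast
    rfl
  have hdd (t : ℝ) : deriv (deriv fun t => f t ^ (n + 2)) t = f t ^ n *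
      ((n + 2) * (n + 1) * (deriv f t * deriv f t) + (n + 2) * (f t * deriv (deriv f) t)) := by
    rw [hd, ((((hD t).fun_pow (n + 1)).const_mul ((n : ℝ) + 2)).fun_mul (hDD t)).deriv,
      Nat.add_sub_cancel]
    push_cast
    ring
  have hmul {x y a b : ℝ} (hx : |x| ≤ a) (hy : |y| ≤ b) : |x * y| ≤ a * b := by
    rw [abs_mul]
    exact mul_le_mul hx hy (abs_nonneg _) ((abs_nonneg _).trans hx)
  have hfa (t : ℝ) : |f t| ≤ 1 := by simpa only [abs_of_nonneg (hf0 t)] using hf1 t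
  have hpow (t : ℝ) : |f t ^ n| ≤ f t ^ n := (abs_of_nonneg (pow_nonneg (hf0 t) n)).le
  refine ⟨(n + 2) * (n + 1) * (A * A) + (n + 2) * A, fun t => ⟨?_, ?_⟩⟩
  · calc |deriv (fun t => f t ^ (n + 2)) t| = |f t ^ n * ((n + 2) * (f t * deriv f t))| := by
          rw [hd]; ring_nf
      _ ≤ f t ^ n * ((n + 2) * (1 * A)) :=
          hmul (hpow t) (hmul (abs_of_nonneg (by positivity)).le (hmul (hfa t) (hA t).1))
      _ = ((n + 2) * A) * f t ^ n := by ring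
      _ ≤ _ := by
          have := pow_nonneg (hf0 t) n
          gcongr
          exact le_add_of_nonneg_left (by positivity)
  · rw [hdd, mul_comm _ (f t ^ n)]
    refine hmul (hpow t) ((abs_add_le _ _).trans (add_le_add ?_ ?_))
    · exact hmul (abs_of_nonneg (by positivity)).le (hmul (hA t).1 (hA t).1)
    · exact hmul (abs_of_nonneg (by positivity)).le (by simpa using hmul (hfa t) (hA t).2)

theorem exists_isSmoothStep {p : ℝ} (hp : 1 < p) : ∃ θ C, IsSmoothStep p C θ := by
  obtain ⟨A, hA⟩ := exists_bound_deriv_smoothTransition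
  obtain ⟨n, hn⟩ := exists_nat_ge (2 / (p - 1))
  set f := Real.smoothTransition
  have hf : ContDiff ℝ ∞ f := Real.smoothTransition.contDiff
  have hf0 (t : ℝ) : 0 ≤ f t := Real.smoothTransition.nonneg t
  have hf1 (t : ℝ) : f t ≤ 1 := Real.smoothTransition.le_one t
  obtain ⟨C, hC⟩ := exists_bound_deriv_pow hf hf0 hf1 hA n
  have hpow (t : ℝ) : f t ^ n ≤ (f t ^ (n + 2)) ^ p⁻¹ := by
    have hp1 : 0 < p - 1 := sub_pos.2 hp
    have hn' : ((n + 2 : ℕ) : ℝ) * p⁻¹ ≤ n := by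
      rw [div_le_iff₀ hp1] at hn
      rw [← div_eq_mul_inv, div_le_iff₀ (by linarith)]
      push_cast
      linarith
    rw [← Real.rpow_natCast, ← Real.rpow_natCast, ← Real.rpow_mul (hf0 t)]
    exact Real.rpow_le_rpow_of_exponent_ge' (hf0 t) (hf1 t) (by positivity) hn'
  have hle (t : ℝ) : C * f t ^ n ≤ |C| * (f t ^ (n + 2)) ^ p⁻¹ :=
    mul_le_mul (le_abs_self C) (hpow t) (pow_nonneg (hf0 t) n) (abs_nonneg C)
  refine ⟨fun t => f t ^ (n + 2), |C|, hf.pow _, fun t => pow_nonneg (hf0 t) _,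
    fun t => pow_le_one₀ (hf0 t) (hf1 t), fun t ht => ?_, fun t ht => ?_,
    fun t => (hC t).1.trans (hle t), fun t => (hC t).2.trans (hle t)⟩
  · simp [f, Real.smoothTransition.zero_of_nonpos ht]
  · simp [f, Real.smoothTransition.one_of_one_le ht]

end SmoothStep

section LogStep

/-- A smooth step in `log q`; as `q = |x|²`, its width is measured on the logarithmic scale of
`|x|`. -/
noncomputable def logStep (θ : ℝ → ℝ) (a c q : ℝ) : ℝ :=
  θ (a + c * Real.log q)

namespace IsSmoothStep

variable {p C a c q : ℝ} {θ : ℝ → ℝ}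

theorem hasDerivAt_logStep (hθ : IsSmoothStep p C θ) (a c : ℝ) (hq : 0 < q) :
    HasDerivAt (logStep θ a c) (c * q⁻¹ * deriv θ (a + c * Real.log q)) q := by
  have hin : HasDerivAt (fun q => a + c * Real.log q) (c * q⁻¹) q :=
    ((Real.hasDerivAt_log hq.ne').const_mul c).const_add a
  have hout := (hθ.contDiff.differentiable (by simp) (a + c * Real.log q)).hasDerivAt
  exact (hout.comp q hin).congr_deriv (mul_comm _ _)

theorem deriv_deriv_logStep (hθ : IsSmoothStep p C θ) (a c : ℝ) (hq : 0 < q) :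
    deriv (deriv (logStep θ a c)) q
      = (q ^ 2)⁻¹ * (c * (c * deriv (deriv θ) (a + c * Real.log q)
        - deriv θ (a + c * Real.log q))) := by
  have hev : deriv (logStep θ a c) =ᶠ[𝓝 q] fun q => c * q⁻¹ * logStep (deriv θ) a c q := by
    filter_upwards [lt_mem_nhds hq] with y hy using (hθ.hasDerivAt_logStep a c hy).deriv
  have hin : HasDerivAt (fun q => a + c * Real.log q) (c * q⁻¹) q :=
    ((Real.hasDerivAt_log hq.ne').const_mul c).const_add a
  have hout := ((contDiff_infty_iff_deriv.1 hθ.contDiff).2.differentiable (by simp)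
    (a + c * Real.log q)).hasDerivAt
  have hstep : HasDerivAt (logStep (deriv θ) a c) _ q := hout.comp q hin
  rw [hev.deriv_eq, (((hasDerivAt_inv hq.ne').const_mul c).fun_mul hstep).deriv, logStep]
  field_simp
  ring

theorem const_nonneg (hθ : IsSmoothStep p C θ) : 0 ≤ C := by
  simpa [hθ.eq_one 1 le_rfl] using (abs_nonneg _).trans (hθ.abs_deriv_le 1)

theorem abs_deriv_logStep_le (hθ : IsSmoothStep p C θ) (a c : ℝ) (hq : 0 < q) :
    q * |deriv (logStep θ a c) q| ≤ |c| * (C * logStep θ a c q ^ p⁻¹) := by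
  rw [(hθ.hasDerivAt_logStep a c hq).deriv, ← abs_of_pos hq, ← abs_mul, abs_of_pos hq,
    mul_comm c, mul_assoc, mul_inv_cancel_left₀ hq.ne', abs_mul]
  exact mul_le_mul_of_nonneg_left (hθ.abs_deriv_le _) (abs_nonneg c)

theorem abs_deriv_deriv_logStep_le (hθ : IsSmoothStep p C θ) (a : ℝ) (hc : |c| ≤ 1) (hq : 0 < q) :
    q ^ 2 * |deriv (deriv (logStep θ a c)) q| ≤ |c| * (2 * C * logStep θ a c q ^ p⁻¹) := by
  have hq2 : 0 < q ^ 2 := by positivity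
  rw [hθ.deriv_deriv_logStep a c hq, ← abs_of_pos hq2, ← abs_mul, abs_of_pos hq2,
    mul_inv_cancel_left₀ hq2.ne', abs_mul]
  refine mul_le_mul_of_nonneg_left ((abs_sub _ _).trans ?_) (abs_nonneg c)
  rw [abs_mul]
  have h1 := hθ.abs_deriv_le (a + c * Real.log q)
  have h2 := mul_le_mul hc (hθ.abs_deriv_deriv_le (a + c * Real.log q)) (abs_nonneg _) zero_le_one
  rw [logStep]
  linarith

theorem isSymbol_logStep (hθ : IsSmoothStep p C θ) (hp : 0 ≤ p) (a : ℝ) (hc : |c| ≤ 1) :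
    IsSymbol 0 (1 + 2 * C) (logStep θ a c) := by
  have hC := hθ.const_nonneg
  have hle (q : ℝ) {D : ℝ} (hD : 0 ≤ D) : |c| * (D * logStep θ a c q ^ p⁻¹) ≤ D := by
    have := Real.rpow_le_one (hθ.nonneg _) (hθ.le_one (a + c * Real.log q)) (inv_nonneg.2 hp)
    exact mul_le_of_le_one_left hD hc |>.trans' <|
      mul_le_mul_of_nonneg_left (mul_le_of_le_one_right hD this) (abs_nonneg c)
  refine ⟨fun q hq => ?_, fun q _ => ?_, fun q hq => ?_, fun q hq => ?_⟩
  · exact hθ.contDiff.contDiffAt.comp q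
      (contDiffAt_const.add (contDiffAt_const.mul (Real.contDiffAt_log.2 hq.ne')))
  · rw [Real.rpow_zero, logStep, abs_of_nonneg (hθ.nonneg _)]
    linarith [hθ.le_one (a + c * Real.log q)]
  · rw [Real.rpow_zero]
    linarith [(hθ.abs_deriv_logStep_le a c hq).trans (hle q hC)]
  · rw [Real.rpow_zero]
    linarith [(hθ.abs_deriv_deriv_logStep_le a hc hq).trans (hle q (by positivity))]

theorem abs_radialLaplacian_logStep_le (hθ : IsSmoothStep p C θ) (a : ℝ) (hc : |c| ≤ 1) {n : ℝ}
    (hn : 0 ≤ n) (hq : 0 < q) : |radialLaplacian n (logStep θ a c) q|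
      ≤ |c| * ((8 + 2 * n) * C) * q⁻¹ * logStep θ a c q ^ p⁻¹ := by
  have h1 := mul_le_mul_of_nonneg_left (hθ.abs_deriv_logStep_le a c hq)
    (by positivity : 0 ≤ 2 * n)
  have h2 := hθ.abs_deriv_deriv_logStep_le a hc hq
  have h := mul_abs_radialLaplacian_le hn hq (logStep θ a c)
  rw [mul_right_comm, ← div_eq_mul_inv, le_div_iff₀ hq, mul_comm _ q]
  linarith

end IsSmoothStep

end LogStep

section LogCutoff

theorem radialLaplacian_eq_zero {φ : ℝ → ℝ} {b q : ℝ} (h : φ =ᶠ[𝓝 q] fun _ => b) (n : ℝ) :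
    radialLaplacian n φ q = 0 := by
  have hd : deriv φ =ᶠ[𝓝 q] fun _ => 0 := h.deriv.trans (by simp)
  rw [radialLaplacian, hd.deriv_eq, hd.eq_of_nhds]
  simp

/-- The logarithmic cutoff: as a function of `q = |x|²` it equals `1` for `|x| ≤ R`, vanishes for
`|x| ≥ R e^L`, and its Laplacian is of size `|x|⁻² / L`. -/
noncomputable def logCutoff (θ : ℝ → ℝ) (R L : ℝ) : ℝ → ℝ :=
  logStep θ (1 + Real.log R / L) (-(2 * L)⁻¹)

namespace IsSmoothStep

variable {p C R L q : ℝ} {θ : ℝ → ℝ}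

theorem logCutoff_eq_one (hθ : IsSmoothStep p C θ) (hR : 1 ≤ R) (hL : 1 ≤ L) (hq : 0 ≤ q)
    (hqR : q ≤ R ^ 2) : logCutoff θ R L q = 1 := by
  have hlog : Real.log q ≤ 2 * Real.log R := by
    rcases hq.eq_or_lt with rfl | hq
    · simpa using Real.log_nonneg hR
    · simpa using Real.log_le_log hq hqR
  refine hθ.eq_one _ ?_
  have : 1 + Real.log R / L + -(2 * L)⁻¹ * Real.log q
      = 1 + (2 * Real.log R - Real.log q) / (2 * L) := by
    field_simp
    ring
  rw [this]
  exact le_add_of_nonneg_right (div_nonneg (sub_nonneg.2 hlog) (by linarith))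

theorem logCutoff_eq_zero (hθ : IsSmoothStep p C θ) (hR : 1 ≤ R) (hL : 1 ≤ L)
    (hq : (Real.exp L * R) ^ 2 ≤ q) : logCutoff θ R L q = 0 := by
  have hlog : 2 * (L + Real.log R) ≤ Real.log q := by
    have := Real.log_le_log (by positivity) hq
    rwa [Real.log_pow, Real.log_mul (by positivity) (by positivity), Real.log_exp,
      Nat.cast_ofNat] at this
  refine hθ.eq_zero _ ?_
  have : 1 + Real.log R / L + -(2 * L)⁻¹ * Real.log q
      = -((Real.log q - 2 * (L + Real.log R)) / (2 * L)) := by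
    field_simp
    ring
  rw [this]
  exact neg_nonpos.2 (div_nonneg (sub_nonneg.2 hlog) (by linarith))

theorem isSymbol_logCutoff (hθ : IsSmoothStep p C θ) (hp : 0 ≤ p) (hL : 1 ≤ L) :
    IsSymbol 0 (1 + 2 * C) (logCutoff θ R L) := by
  refine hθ.isSymbol_logStep hp _ ?_
  rw [abs_neg, abs_of_pos (by positivity)]
  exact inv_le_one_of_one_le₀ (by linarith)

theorem abs_radialLaplacian_logCutoff_le {E : Type*} [NormedAddCommGroup E]
    (hθ : IsSmoothStep p C θ) (hR : 1 ≤ R) (hL : 1 ≤ L) {n : ℝ} (hn : 0 ≤ n) {x : E} (hx : x ≠ 0) :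
    |radialLaplacian n (logCutoff θ R L) (‖x‖ ^ 2)|
      ≤ (norm ⁻¹' Icc R (Real.exp L * R)).indicator (fun x => (4 + n) * C / L * ‖x‖ ^ (-2 : ℝ)) x
        * logCutoff θ R L (‖x‖ ^ 2) ^ p⁻¹ := by
  have hx0 : 0 < ‖x‖ := norm_pos_iff.2 hx
  by_cases hshell : ‖x‖ ∈ Icc R (Real.exp L * R)
  · have hc : |(-(2 * L)⁻¹)| = (2 * L)⁻¹ := by rw [abs_neg, abs_of_pos (by positivity)]
    rw [indicator_of_mem (mem_preimage.2 hshell), Real.rpow_neg hx0.le, Real.rpow_two]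
    refine (hθ.abs_radialLaplacian_logStep_le _ ?_ hn (by positivity)).trans_eq ?_
    · rw [hc]
      exact inv_le_one_of_one_le₀ (by linarith)
    · rw [hc, logCutoff]
      field_simp
      ring
  · have hconst : ∃ b, logCutoff θ R L =ᶠ[𝓝 (‖x‖ ^ 2)] fun _ => b := by
      rcases lt_or_ge ‖x‖ R with h | h
      · have hlt : ‖x‖ ^ 2 < R ^ 2 := by gcongr
        exact ⟨1, by filter_upwards [gt_mem_nhds hlt, lt_mem_nhds (pow_pos hx0 2)] with q hq hq0
          using hθ.logCutoff_eq_one hR hL hq0.le hq.le⟩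
      · have hlt : (Real.exp L * R) ^ 2 < ‖x‖ ^ 2 := by
          gcongr
          exact not_le.1 fun h' => hshell ⟨h, h'⟩
        exact ⟨0, by filter_upwards [lt_mem_nhds hlt] with q hq
          using hθ.logCutoff_eq_zero hR hL hq.le⟩
    obtain ⟨b, hb⟩ := hconst
    rw [radialLaplacian_eq_zero hb, abs_zero, indicator_of_notMem (mt mem_preimage.1 hshell),
      zero_mul]

end IsSmoothStep

end LogCutoff

section RadialApproximation

variable {E : Type*} [NormedAddCommGroup E] [InnerProductSpace ℝ E] [FiniteDimensional ℝ E]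
  {σ₁ κ C D r : ℝ} {φ : ℝ → ℝ}

theorem IsSymbol.laplacian_comp_norm_sq (hφ : IsSymbol κ C φ) {x : E} (hx : x ≠ 0) :
    Laplacian.laplacian (fun y : E => φ (‖y‖ ^ 2)) x
      = radialLaplacian (finrank ℝ E) φ (‖x‖ ^ 2) :=
  _root_.laplacian_comp_norm_sq
    ((contDiffAt_infty.1 (hφ.contDiffAt _ (by positivity))) 2)

theorem IsSymbol.isSmoothApproximation_const (hφ : IsSymbol 0 C φ) {δ : ℝ} (hδ : 0 < δ)
    {b : ℝ} (hb : ∀ q, 0 ≤ q → q < δ → φ q = b) (hr : 0 ≤ r) (hφr : ∀ q, r ^ 2 < q → φ q = 0) :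
    ∃ C', IsSmoothApproximation σ₁ (fun _ x => φ (‖x‖ ^ 2)) r C' (fun x : E => φ (‖x‖ ^ 2))
      (fun x => radialLaplacian (finrank ℝ E) φ (‖x‖ ^ 2)) := by
  have hC : 0 ≤ C := hφ.const_nonneg
  set A : ℝ := (4 + 2 * finrank ℝ E) * C / δ
  have hA : 0 ≤ A := by positivity
  refine ⟨C + A, fun _ => contDiff_comp_norm_sq hφ.contDiffAt hδ hb, fun _ x hx => hφr _ ?_,
    fun _ x hx => ?_, fun _ x hx => ?_, fun x _ => tendsto_const_nhds, fun x hx => ?_⟩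
  · exact pow_lt_pow_left₀ (by simpa using hx) hr two_ne_zero
  · have := hφ.abs_le (‖x‖ ^ 2) (by positivity)
    rw [Real.rpow_zero] at this
    linarith
  · have hq : 0 < ‖x‖ ^ 2 := by positivity
    have hle : |radialLaplacian (finrank ℝ E) φ (‖x‖ ^ 2)| ≤ A := by
      rcases lt_or_ge (‖x‖ ^ 2) δ with h | h
      · rwa [radialLaplacian_eq_zero (b := b), abs_zero]
        filter_upwards [gt_mem_nhds h, lt_mem_nhds hq] with y hy hy0 using hb y hy0.le hy
      · refine (hφ.abs_radialLaplacian_le (Nat.cast_nonneg _) hq).trans ?_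
        rw [zero_sub, Real.rpow_neg_one, ← div_eq_mul_inv]
        exact div_le_div_of_nonneg_left (by positivity) hδ h
    rw [hφ.laplacian_comp_norm_sq hx]
    nlinarith [Real.rpow_nonneg (norm_nonneg x) σ₁]
  · simp only [hφ.laplacian_comp_norm_sq hx]
    exact tendsto_const_nhds

theorem IsSymbol.exists_bound_laplacian {κ D r σ₁ : ℝ} (hσ₁ : -2 < σ₁)
    (hκ : 2 + σ₁ ≤ 2 * κ) (hr : 0 < r) (hD : 0 ≤ D) : ∃ C', ∀ φ : ℝ → ℝ, IsSymbol κ D φ →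
      (∀ q, r ^ 2 < q → φ q = 0) → ∀ x : E, x ≠ 0 → |φ (‖x‖ ^ 2)| ≤ C' ∧
        |Laplacian.laplacian (fun y : E => φ (‖y‖ ^ 2)) x| ≤ C' * (1 + ‖x‖ ^ σ₁) := by
  set A : ℝ := D * (r ^ 2) ^ κ
  set B : ℝ := (4 + 2 * finrank ℝ E) * D * r ^ (2 * (κ - 1) - σ₁)
  refine ⟨A + B, fun φ hφ hφr x hx => ?_⟩
  have hx0 : 0 < ‖x‖ := norm_pos_iff.2 hx
  have hA : 0 ≤ A := by positivity
  have hB : 0 ≤ B := by positivity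
  rw [hφ.laplacian_comp_norm_sq hx]
  rcases le_or_gt ‖x‖ r with hxr | hxr
  · constructor
    · calc |φ (‖x‖ ^ 2)| ≤ D * (‖x‖ ^ 2) ^ κ := hφ.abs_le _ (by positivity)
        _ ≤ D * (r ^ 2) ^ κ := by
            gcongr
            linarith
        _ ≤ A + B := le_add_of_nonneg_right hB
    · calc |radialLaplacian (finrank ℝ E) φ (‖x‖ ^ 2)|
          ≤ (4 + 2 * finrank ℝ E) * D * (‖x‖ ^ 2) ^ (κ - 1) :=
            hφ.abs_radialLaplacian_le (Nat.cast_nonneg _) (by positivity)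
        _ = (4 + 2 * finrank ℝ E) * D * ‖x‖ ^ (2 * (κ - 1) - σ₁) * ‖x‖ ^ σ₁ := by
            rw [mul_assoc _ (‖x‖ ^ _), ← Real.rpow_add hx0, sub_add_cancel,
              ← Real.rpow_natCast_mul hx0.le, Nat.cast_ofNat]
        _ ≤ (4 + 2 * finrank ℝ E) * D * r ^ (2 * (κ - 1) - σ₁) * ‖x‖ ^ σ₁ := by
            gcongr
            linarith
        _ ≤ (A + B) * (1 + ‖x‖ ^ σ₁) := by
            gcongr
            · exact le_add_of_nonneg_left hA
            · exact le_add_of_nonneg_left zero_le_one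
  · have hlt : r ^ 2 < ‖x‖ ^ 2 := by gcongr
    have hev : φ =ᶠ[𝓝 (‖x‖ ^ 2)] fun _ => 0 := by
      filter_upwards [lt_mem_nhds hlt] with q hq using hφr q hq
    rw [hφr _ hlt, radialLaplacian_eq_zero hev, abs_zero]
    exact ⟨by positivity, by positivity⟩

/-- Near the origin `|x|^(2κ)` is approximated by cutting it off; the symbol estimates bound the
Laplacians of the cutoffs by `|x|^(2κ-2)`, hence by `|x|^σ₁`, uniformly. -/
theorem IsSymbol.exists_isSmoothApproximation {p : ℝ} {θ : ℝ → ℝ} (hθ : IsSmoothStep p C θ)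
    (hp : 0 ≤ p) (hφ : IsSymbol κ D φ) (hφ0 : φ 0 = 0) (hσ₁ : -2 < σ₁) (hκ : 2 + σ₁ ≤ 2 * κ)
    (hr : 0 < r) (hφr : ∀ q, r ^ 2 < q → φ q = 0) :
    ∃ f C', IsSmoothApproximation σ₁ f r C' (fun x : E => φ (‖x‖ ^ 2))
      (fun x => radialLaplacian (finrank ℝ E) φ (‖x‖ ^ 2)) := by
  set Ω : ℕ → ℝ → ℝ := fun m => logStep θ m 1
  have hΩ (m : ℕ) : IsSymbol κ (4 * ((1 + 2 * C) * D)) fun q => Ω m q * φ q := by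
    simpa only [zero_add] using (hθ.isSymbol_logStep hp (m : ℝ) (by simp)).mul hφ
  have hΩr (m : ℕ) (q : ℝ) (hq : r ^ 2 < q) : Ω m q * φ q = 0 := by rw [hφr q hq, mul_zero]
  have hΩ0 (m : ℕ) (q : ℝ) (hq : 0 ≤ q) (hqm : q < Real.exp (-m)) : Ω m q * φ q = 0 := by
    rcases hq.eq_or_lt with rfl | hq
    · rw [hφ0, mul_zero]
    · have := (Real.log_lt_iff_lt_exp hq).2 hqm
      rw [show Ω m q = 0 from hθ.eq_zero _ (by linarith), zero_mul]
  have hΩ1 {x : E} (hx : x ≠ 0) : ∀ᶠ m in atTop,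
      (fun y : E => Ω m (‖y‖ ^ 2) * φ (‖y‖ ^ 2)) =ᶠ[𝓝 x] fun y => φ (‖y‖ ^ 2) := by
    have hcont : ContinuousAt (fun y : E => Real.log (‖y‖ ^ 2)) x :=
      ContinuousAt.log (by fun_prop) (by positivity)
    obtain ⟨m₀, hm₀⟩ := exists_nat_gt (1 - Real.log (‖x‖ ^ 2))
    filter_upwards [eventually_ge_atTop m₀] with m hm
    filter_upwards [hcont.eventually (lt_mem_nhds (sub_lt_comm.1 hm₀))] with y hy
    have : (m₀ : ℝ) ≤ m := by exact_mod_cast hm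
    rw [show Ω m (‖y‖ ^ 2) = 1 from hθ.eq_one _ (by linarith), one_mul]
  obtain ⟨C', hC'⟩ := IsSymbol.exists_bound_laplacian (E := E) hσ₁ hκ hr
    (hΩ 0).const_nonneg
  refine ⟨fun m x => Ω m (‖x‖ ^ 2) * φ (‖x‖ ^ 2), C', fun m =>
    contDiff_comp_norm_sq (hΩ m).contDiffAt (Real.exp_pos _) (hΩ0 m), fun m x hx =>
    hΩr m _ (pow_lt_pow_left₀ (by simpa using hx) hr.le two_ne_zero),
    fun m x hx => (hC' _ (hΩ m) (hΩr m) x hx).1, fun m x hx => (hC' _ (hΩ m) (hΩr m) x hx).2,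
    fun x hx => ?_, fun x hx => ?_⟩
  · refine tendsto_const_nhds.congr' ?_
    filter_upwards [hΩ1 hx] with m hm using hm.eq_of_nhds.symm
  · refine tendsto_const_nhds.congr' ?_
    filter_upwards [hΩ1 hx] with m hm
    rw [(laplacian_congr_nhds hm).eq_of_nhds, hφ.laplacian_comp_norm_sq hx]

end RadialApproximation

section SourceEstimate

variable {E : Type*} [NormedAddCommGroup E] [InnerProductSpace ℝ E] [FiniteDimensional ℝ E]
  [MeasurableSpace E] [BorelSpace E] {σ₂ ϱ p q : ℝ}

theorem mul_abs_le_young (hpq : p.HolderConjugate q) {F ψ r v : ℝ} (hF : 0 ≤ F) (hψ : 0 ≤ ψ)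
    (hr : 0 < r) :
    F * ψ ^ p⁻¹ * |v| ≤ ψ * (r ^ σ₂ * |v| ^ p) + F ^ q * r ^ (σ₂ * (1 - q)) := by
  have hp := hpq.pos
  set X := ψ ^ p⁻¹ * (r ^ (σ₂ / p) * |v|)
  set Y := F * r ^ (-(σ₂ / p))
  have hX : 0 ≤ X := by positivity
  have hY : 0 ≤ Y := by positivity
  have hXp : X ^ p = ψ * (r ^ σ₂ * |v| ^ p) := by
    rw [Real.mul_rpow (by positivity) (by positivity), Real.mul_rpow (by positivity)
      (abs_nonneg v), Real.rpow_inv_rpow hψ hp.ne', ← Real.rpow_mul hr.le,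
      div_mul_cancel₀ _ hp.ne']
  have hYq : Y ^ q = F ^ q * r ^ (σ₂ * (1 - q)) := by
    have hexp : -(σ₂ / p) * q = σ₂ * (1 - q) := by
      rw [neg_mul, div_mul_comm, hpq.symm.div_conj_eq_sub_one]
      ring
    rw [Real.mul_rpow hF (by positivity), ← Real.rpow_mul hr.le, hexp]
  calc F * ψ ^ p⁻¹ * |v| = X * Y := by
        simp only [X, Y]
        rw [Real.rpow_neg hr.le]
        field_simp
    _ ≤ X ^ p / p + Y ^ q / q := Real.young_inequality_of_nonneg hX hY hpq
    _ ≤ X ^ p + Y ^ q := add_le_add (div_le_self (by positivity) hpq.lt.le)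
        (div_le_self (by positivity) hpq.symm.lt.le)
    _ = _ := by rw [hXp, hYq]

theorem add_rpow_le_two_rpow_mul {x y : ℝ} (hx : 0 ≤ x) (hy : 0 ≤ y) (hq : 0 ≤ q) :
    (x + y) ^ q ≤ 2 ^ q * (x ^ q + y ^ q) := by
  have hmax : (max x y) ^ q ≤ x ^ q + y ^ q := by
    rcases max_choice x y with h | h <;> rw [h]
    · exact le_add_of_nonneg_right (by positivity)
    · exact le_add_of_nonneg_left (by positivity)
  calc (x + y) ^ q ≤ (2 * max x y) ^ q := by
        gcongr
        linarith [le_max_left x y, le_max_right x y]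
    _ = 2 ^ q * (max x y) ^ q := Real.mul_rpow zero_le_two (hx.trans (le_max_left x y))
    _ ≤ _ := by gcongr

theorem IsTestPair.integral_source_le [Nontrivial E] {w : E → ℝ} {u ψ Λ F₁ F₂ G : ℝ × E → ℝ}
    (h : IsTestPair σ₂ ϱ p w u ψ Λ) (hpq : p.HolderConjugate q)
    (hψ : ∀ z, 0 < z.1 → 0 ≤ ψ z) (hF₁ : ∀ z, 0 ≤ F₁ z) (hF₂ : ∀ z, 0 ≤ F₂ z)
    (hΛ : ∀ z, 0 < z.1 → z.2 ≠ 0 → |Λ z| ≤ (F₁ z + F₂ z) * ψ z ^ p⁻¹ + G z)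
    (hF₁i : IntegrableOn (fun z => F₁ z ^ q * ‖z.2‖ ^ (σ₂ * (1 - q))) (positiveTimes E) volume)
    (hF₂i : IntegrableOn (fun z => F₂ z ^ q * ‖z.2‖ ^ (σ₂ * (1 - q))) (positiveTimes E) volume)
    (hGi : IntegrableOn (fun z => G z * |u z|) (positiveTimes E) volume) :
    ∫ z in positiveTimes E, ψ z * (z.1 ^ ϱ * w z.2)
      ≤ 2 ^ q * ((∫ z in positiveTimes E, F₁ z ^ q * ‖z.2‖ ^ (σ₂ * (1 - q)))
          + ∫ z in positiveTimes E, F₂ z ^ q * ‖z.2‖ ^ (σ₂ * (1 - q)))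
        + ∫ z in positiveTimes E, G z * |u z| := by
  have hFi : IntegrableOn (fun z => 2 ^ q * (F₁ z ^ q * ‖z.2‖ ^ (σ₂ * (1 - q))
      + F₂ z ^ q * ‖z.2‖ ^ (σ₂ * (1 - q)))) (positiveTimes E) volume :=
    (hF₁i.add hF₂i).const_mul (2 ^ q)
  have key : ∫ z in positiveTimes E, Λ z * u z
      ≤ ∫ z in positiveTimes E, (ψ z * (‖z.2‖ ^ σ₂ * |u z| ^ p)
          + (2 ^ q * (F₁ z ^ q * ‖z.2‖ ^ (σ₂ * (1 - q)) + F₂ z ^ q * ‖z.2‖ ^ (σ₂ * (1 - q)))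
            + G z * |u z|)) := by
    refine integral_mono_ae h.integrable_adjoint (h.integrable_reaction.add (hFi.add hGi)) ?_
    filter_upwards [ae_positiveTimes] with z hz
    have hyoung := mul_abs_le_young (v := u z) (σ₂ := σ₂) hpq (add_nonneg (hF₁ z) (hF₂ z))
      (hψ z hz.1) (norm_pos_iff.2 hz.2)
    have hsum := mul_le_mul_of_nonneg_right
      (add_rpow_le_two_rpow_mul (hF₁ z) (hF₂ z) hpq.symm.nonneg)
      (Real.rpow_nonneg (norm_nonneg z.2) (σ₂ * (1 - q)))
    calc Λ z * u z ≤ |Λ z| * |u z| := (le_abs_self _).trans_eq (abs_mul _ _)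
      _ ≤ ((F₁ z + F₂ z) * ψ z ^ p⁻¹ + G z) * |u z| :=
          mul_le_mul_of_nonneg_right (hΛ z hz.1 hz.2) (abs_nonneg _)
      _ ≤ _ := by linarith
  rw [h.integral_eq, integral_add h.integrable_reaction, integral_add hFi hGi,
    integral_const_mul, integral_add hF₁i hF₂i] at key
  · linarith
  · exact hFi.add hGi

end SourceEstimate

section PowerBlock

variable {E : Type*} [NormedAddCommGroup E]

/-- The model majorant `A |x|^a` on `[t₀, t₁] × {|x| ∈ D}`. -/
noncomputable def powerBlock (E : Type*) [NormedAddCommGroup E] (t₀ t₁ : ℝ) (D : Set ℝ)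
    (A a : ℝ) : ℝ × E → ℝ :=
  (Icc t₀ t₁ ×ˢ (norm ⁻¹' D)).indicator fun z => A * ‖z.2‖ ^ a

variable {t₀ t₁ A a : ℝ} {D : Set ℝ}

theorem powerBlock_nonneg (hA : 0 ≤ A) (z : ℝ × E) : 0 ≤ powerBlock E t₀ t₁ D A a z :=
  indicator_nonneg (fun _ _ => by positivity) z

theorem powerBlock_rpow_mul {q : ℝ} (hA : 0 ≤ A) (hq : 0 < q) (b : ℝ) {z : ℝ × E} (hz : z.2 ≠ 0) :
    powerBlock E t₀ t₁ D A a z ^ q * ‖z.2‖ ^ b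
      = powerBlock E t₀ t₁ D (A ^ q) (a * q + b) z := by
  by_cases hzD : z ∈ Icc t₀ t₁ ×ˢ (norm ⁻¹' D)
  · rw [powerBlock, powerBlock, indicator_of_mem hzD, indicator_of_mem hzD,
      Real.mul_rpow hA (by positivity), ← Real.rpow_mul (norm_nonneg _),
      Real.rpow_add (norm_pos_iff.2 hz), mul_assoc]
  · rw [powerBlock, powerBlock, indicator_of_notMem hzD, indicator_of_notMem hzD,
      Real.zero_rpow hq.ne', zero_mul]

variable [MeasurableSpace E] [BorelSpace E]

theorem measurableSet_block (hD : MeasurableSet D) :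
    MeasurableSet (Icc t₀ t₁ ×ˢ ((norm : E → ℝ) ⁻¹' D)) :=
  measurableSet_Icc.prod (measurable_norm hD)

variable [InnerProductSpace ℝ E] [FiniteDimensional ℝ E]

theorem integrableOn_powerBlock (A : ℝ) (hD : MeasurableSet D)
    (hDa : IntegrableOn (fun x : E => ‖x‖ ^ a) (norm ⁻¹' D) volume) (s : Set (ℝ × E)) :
    IntegrableOn (powerBlock E t₀ t₁ D A a) s volume := by
  refine Integrable.integrableOn ?_
  rw [powerBlock, integrable_indicator_iff (measurableSet_block hD),
    IntegrableOn, Measure.volume_eq_prod, ← Measure.prod_restrict]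
  exact (integrable_const A).mul_prod hDa

theorem integral_powerBlock (ht₀ : 0 < t₀) (ht : t₀ ≤ t₁) (A : ℝ) (hD : MeasurableSet D) :
    ∫ z in positiveTimes E, powerBlock E t₀ t₁ D A a z
      = A * (t₁ - t₀) * ∫ x in (norm : E → ℝ) ⁻¹' D, ‖x‖ ^ a := by
  have hsub : Icc t₀ t₁ ×ˢ ((norm : E → ℝ) ⁻¹' D) ⊆ positiveTimes E :=
    fun z hz => ⟨ht₀.trans_le hz.1.1, mem_univ _⟩
  rw [powerBlock, setIntegral_indicator (measurableSet_block (E := E) hD),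
    inter_eq_right.2 hsub, Measure.volume_eq_prod,
    setIntegral_prod_mul (fun _ : ℝ => A) fun x : E => ‖x‖ ^ a]
  simp [ht, mul_comm]

end PowerBlock

section RadialIntegral

theorem pow_mul_indicator_rpow {n : ℕ} (hn : 0 < n) (D : Set ℝ) (c : ℝ) :
    EqOn (fun y : ℝ => y ^ (n - 1) • D.indicator (fun y => y ^ c) y)
      (D.indicator fun y => y ^ (c + n - 1)) (Ioi 0) := by
  intro y (hy : 0 < y)
  by_cases hyD : y ∈ D
  · simp only [indicator_of_mem hyD, smul_eq_mul]
    rw [← Real.rpow_natCast, ← Real.rpow_add hy, Nat.cast_sub hn, Nat.cast_one]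
    ring_nf
  · simp [hyD]

variable (E : Type*) [NormedAddCommGroup E] [InnerProductSpace ℝ E] [FiniteDimensional ℝ E]
  [MeasurableSpace E] [BorelSpace E]

/-- The surface area of the unit sphere of `E`. -/
noncomputable def sphereArea : ℝ :=
  finrank ℝ E * volume.real (Metric.ball (0 : E) 1)

theorem sphereArea_nonneg : 0 ≤ sphereArea E := by
  unfold sphereArea
  positivity

variable {E} [Nontrivial E]

theorem integrableOn_norm_rpow_iff {D : Set ℝ} (hD : MeasurableSet D) (c : ℝ) :
    IntegrableOn (fun x : E => ‖x‖ ^ c) (norm ⁻¹' D) volume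
      ↔ IntegrableOn (fun y : ℝ => y ^ (c + finrank ℝ E - 1)) (D ∩ Ioi 0) volume := by
  have hcomp : (norm ⁻¹' D).indicator (fun x : E => ‖x‖ ^ c)
      = fun x => D.indicator (fun y => y ^ c) ‖x‖ :=
    funext fun _ => indicator_comp_right (g := fun y => y ^ c) norm
  rw [← integrable_indicator_iff (measurable_norm hD), hcomp, integrable_fun_norm_addHaar,
    integrableOn_congr_fun (pow_mul_indicator_rpow Module.finrank_pos D c) measurableSet_Ioi,
    IntegrableOn, integrable_indicator_iff hD, IntegrableOn, Measure.restrict_restrict hD]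
  rfl

theorem setIntegral_norm_rpow {D : Set ℝ} (hD : MeasurableSet D) (c : ℝ) :
    ∫ x in (norm : E → ℝ) ⁻¹' D, ‖x‖ ^ c
      = sphereArea E * ∫ y in D ∩ Ioi 0, y ^ (c + finrank ℝ E - 1) := by
  have hcomp : (norm ⁻¹' D).indicator (fun x : E => ‖x‖ ^ c)
      = fun x => D.indicator (fun y => y ^ c) ‖x‖ :=
    funext fun _ => indicator_comp_right (g := fun y => y ^ c) norm
  rw [← integral_indicator (measurable_norm hD), hcomp, integral_fun_norm_addHaar,
    setIntegral_congr_fun measurableSet_Ioi (pow_mul_indicator_rpow Module.finrank_pos D c),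
    integral_indicator hD, Measure.restrict_restrict hD, sphereArea]
  simp [mul_assoc]

variable {c R L : ℝ}

theorem integrableOn_norm_rpow_Iic (hc : 0 < c + finrank ℝ E) (R : ℝ) :
    IntegrableOn (fun x : E => ‖x‖ ^ c) (norm ⁻¹' Iic R) volume := by
  rw [integrableOn_norm_rpow_iff measurableSet_Iic, Iic_inter_Ioi]
  exact (intervalIntegral.intervalIntegrable_rpow' (by linarith)).1

theorem setIntegral_norm_rpow_Iic (hc : 0 < c + finrank ℝ E) (hR : 0 ≤ R) :
    ∫ x in (norm : E → ℝ) ⁻¹' Iic R, ‖x‖ ^ c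
      = sphereArea E / (c + finrank ℝ E) * R ^ (c + finrank ℝ E) := by
  rw [setIntegral_norm_rpow measurableSet_Iic, Iic_inter_Ioi,
    ← intervalIntegral.integral_of_le hR, integral_rpow (Or.inl (by linarith)), sub_add_cancel,
    Real.zero_rpow hc.ne', sub_zero]
  ring

theorem integrableOn_norm_rpow_Icc (hR : 0 < R) (S : ℝ) :
    IntegrableOn (fun x : E => ‖x‖ ^ c) (norm ⁻¹' Icc R S) volume := by
  have hsub : Icc R S ⊆ Ioi 0 := fun y hy => hR.trans_le hy.1
  rw [integrableOn_norm_rpow_iff measurableSet_Icc, inter_eq_left.2 hsub]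
  exact ContinuousOn.integrableOn_Icc fun y hy =>
    (Real.continuousAt_rpow_const y _ (Or.inl (hsub hy).ne')).continuousWithinAt

theorem setIntegral_norm_rpow_Icc_le (hR : 0 < R) (hL : 0 ≤ L) :
    ∫ x in (norm : E → ℝ) ⁻¹' Icc R (Real.exp L * R), ‖x‖ ^ c
      ≤ sphereArea E * (max 1 (Real.exp (L * (c + finrank ℝ E))) * R ^ (c + finrank ℝ E) * L) := by
  set d := c + finrank ℝ E
  have hle : R ≤ Real.exp L * R := le_mul_of_one_le_left hR.le (Real.one_le_exp hL)
  have hsub : Icc R (Real.exp L * R) ⊆ Ioi 0 := fun y hy => hR.trans_le hy.1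
  have hpow : ∀ y ∈ Icc R (Real.exp L * R),
      y ^ (d - 1) ≤ max 1 (Real.exp (L * d)) * R ^ d * y⁻¹ := by
    intro y hy
    have hy0 : 0 < y := hsub hy
    rw [Real.rpow_sub_one hy0.ne', div_eq_mul_inv]
    gcongr
    rcases le_total 0 d with hd | hd
    · calc y ^ d ≤ (Real.exp L * R) ^ d := by gcongr; exact hy.2
        _ = Real.exp (L * d) * R ^ d := by rw [Real.mul_rpow (by positivity) hR.le, Real.exp_mul]
        _ ≤ _ := by gcongr; exact le_max_right _ _
    · calc y ^ d ≤ 1 * R ^ d := by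
            rw [one_mul]; exact Real.rpow_le_rpow_of_nonpos hR hy.1 hd
        _ ≤ _ := by gcongr; exact le_max_left _ _
  have hcont (g : ℝ → ℝ) (hg : ContinuousOn g (Ioi 0)) :
      IntegrableOn g (Icc R (Real.exp L * R)) volume := (hg.mono hsub).integrableOn_Icc
  rw [setIntegral_norm_rpow measurableSet_Icc, inter_eq_left.2 hsub]
  refine mul_le_mul_of_nonneg_left ?_ (sphereArea_nonneg E)
  calc ∫ y in Icc R (Real.exp L * R), y ^ (d - 1)
      ≤ ∫ y in Icc R (Real.exp L * R), max 1 (Real.exp (L * d)) * R ^ d * y⁻¹ :=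
        setIntegral_mono_on
          (hcont _ fun y hy => (Real.continuousAt_rpow_const y _
            (Or.inl (ne_of_gt hy))).continuousWithinAt)
          (hcont _ (continuousOn_const.mul (continuousOn_inv₀.mono fun y hy => ne_of_gt hy)))
          measurableSet_Icc hpow
    _ = max 1 (Real.exp (L * d)) * R ^ d * L := by
        rw [integral_const_mul, integral_Icc_eq_integral_Ioc, ← intervalIntegral.integral_of_le hle,
          integral_inv_of_pos hR (hR.trans_le hle), mul_div_cancel_right₀ _ hR.ne', Real.log_exp]

end RadialIntegral

section SourceLimit

variable {E : Type*} [NormedAddCommGroup E] [MeasurableSpace E] {ϱ b C : ℝ} {w : E → ℝ} {η : ℝ → ℝ}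

/-- At time scale `T R` the functions `ψ R` are bounded by `C`, vanish after time `b`, and converge
to the function `η` of time alone. -/
structure HasTimeLimit (T : ℝ → ℝ) (ψ : ℝ → ℝ × E → ℝ) (η : ℝ → ℝ) (b C : ℝ) : Prop where
  scale_pos : ∀ᶠ R in atTop, 0 < T R
  measurable : ∀ R, Measurable (ψ R)
  abs_le : ∀ᶠ R in atTop, ∀ t > 0, ∀ x, |ψ R (T R * t, x)| ≤ (Iic b).indicator (fun _ => C) t
  tendsto : ∀ t > 0, ∀ x ≠ 0, Tendsto (fun R => ψ R (T R * t, x)) atTop (𝓝 (η t))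

theorem HasTimeLimit.abs_limit_le [Nontrivial E] {T : ℝ → ℝ} {ψ : ℝ → ℝ × E → ℝ}
    (h : HasTimeLimit T ψ η b C) {t : ℝ} (ht : 0 < t) :
    |η t| ≤ (Iic b).indicator (fun _ => C) t := by
  obtain ⟨x, hx⟩ := exists_ne (0 : E)
  refine le_of_tendsto (h.tendsto t ht x hx).abs ?_
  filter_upwards [h.abs_le] with R hR using hR t ht x

theorem integrableOn_indicator_rpow (hϱ : -1 < ϱ) (b D : ℝ) :
    IntegrableOn (fun t : ℝ => t ^ ϱ * (Iic b).indicator (fun _ => D) t) (Ioi 0) volume := by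
  have hint : IntegrableOn (fun t : ℝ => t ^ ϱ * D) (Ioc 0 b) volume :=
    (intervalIntegral.intervalIntegrable_rpow' hϱ).1.mul_const D
  have hind : (fun t : ℝ => t ^ ϱ * (Iic b).indicator (fun _ => D) t)
      = (Iic b).indicator fun t => t ^ ϱ * D := by
    funext t
    by_cases ht : t ∈ Iic b <;> simp [ht]
  rwa [hind, IntegrableOn, integrable_indicator_iff measurableSet_Iic, IntegrableOn,
    Measure.restrict_restrict measurableSet_Iic, Iic_inter_Ioi]

theorem HasTimeLimit.integral_rpow_mul_limit_pos [Nontrivial E] {T : ℝ → ℝ} {ψ : ℝ → ℝ × E → ℝ}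
    (h : HasTimeLimit T ψ η b C) (hϱ : -1 < ϱ) (hη : Continuous η) (hη0 : ∀ t > 0, 0 ≤ η t)
    {t₀ : ℝ} (ht₀ : 0 < t₀) (hpos : 0 < η t₀) :
    0 < ∫ t in Ioi (0 : ℝ), t ^ ϱ * η t := by
  have hnonneg : 0 ≤ᵐ[volume.restrict (Ioi 0)] fun t => t ^ ϱ * η t := by
    filter_upwards [ae_restrict_mem measurableSet_Ioi] with t (ht : 0 < t)
    exact mul_nonneg (by positivity) (hη0 t ht)
  have hint : IntegrableOn (fun t => t ^ ϱ * η t) (Ioi 0) volume := by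
    have hpow : Measurable fun t : ℝ => t ^ ϱ := by fun_prop
    refine (integrableOn_indicator_rpow hϱ b C).mono'
      (hpow.mul hη.measurable).aestronglyMeasurable ?_
    filter_upwards [ae_restrict_mem measurableSet_Ioi] with t (ht : 0 < t)
    rw [norm_mul, Real.norm_of_nonneg (by positivity)]
    exact mul_le_mul_of_nonneg_left (h.abs_limit_le ht) (by positivity)
  rw [setIntegral_pos_iff_support_of_nonneg_ae hnonneg hint]
  have hopen : IsOpen (η ⁻¹' Ioi 0 ∩ Ioi 0) := (isOpen_Ioi.preimage hη).inter isOpen_Ioi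
  refine (hopen.measure_pos volume ⟨t₀, hpos, ht₀⟩).trans_le (measure_mono ?_)
  rintro t ⟨ht, ht0⟩
  exact ⟨(mul_pos (Real.rpow_pos_of_pos ht0 ϱ) ht).ne', ht0⟩

variable [InnerProductSpace ℝ E] [FiniteDimensional ℝ E] [BorelSpace E]

theorem rescaled_integral_source {T : ℝ} (hT : 0 < T) {ψ : ℝ × E → ℝ}
    (hψ : IntegrableOn (fun z => ψ z * (z.1 ^ ϱ * w z.2)) (positiveTimes E) volume) :
    T ^ (-(1 + ϱ)) * ∫ z in positiveTimes E, ψ z * (z.1 ^ ϱ * w z.2)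
      = ∫ t in Ioi (0 : ℝ), t ^ ϱ * ∫ x, ψ (T * t, x) * w x := by
  have hscale := integral_comp_mul_left_Ioi
    (fun t : ℝ => t ^ ϱ * ∫ x, ψ (t, x) * w x) 0 hT
  rw [mul_zero, smul_eq_mul] at hscale
  have hfubini : ∫ z in positiveTimes E, ψ z * (z.1 ^ ϱ * w z.2)
      = ∫ t in Ioi (0 : ℝ), t ^ ϱ * ∫ x, ψ (t, x) * w x := by
    rw [Measure.volume_eq_prod, setIntegral_prod _ hψ]
    simp only [Measure.restrict_univ, mul_left_comm (ψ _), integral_const_mul]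
  rw [hfubini, neg_add, Real.rpow_add hT, Real.rpow_neg_one, mul_comm T⁻¹, mul_assoc, ← hscale,
    ← integral_const_mul]
  refine setIntegral_congr_fun measurableSet_Ioi fun t (ht : 0 < t) => ?_
  rw [Real.mul_rpow hT.le ht.le, Real.rpow_neg hT.le, mul_assoc,
    inv_mul_cancel_left₀ (Real.rpow_pos_of_pos hT ϱ).ne']

namespace HasTimeLimit

variable {T : ℝ → ℝ} {ψ : ℝ → ℝ × E → ℝ} [Nontrivial E]

theorem tendsto_integral_mul (h : HasTimeLimit T ψ η b C) (hw : Integrable w volume) {t : ℝ}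
    (ht : 0 < t) : Tendsto (fun R => ∫ x, ψ R (T R * t, x) * w x) atTop (𝓝 (∫ x, η t * w x)) := by
  refine tendsto_integral_filter_of_dominated_convergence
    (fun x => (Iic b).indicator (fun _ => C) t * |w x|) ?_ ?_ (hw.abs.const_mul _) ?_
  · exact Eventually.of_forall fun R =>
      ((h.measurable R).comp measurable_prodMk_left).aestronglyMeasurable.mul hw.1
  · filter_upwards [h.abs_le] with R hR
    refine Eventually.of_forall fun x => ?_
    rw [norm_mul]
    exact mul_le_mul_of_nonneg_right (hR t ht x) (norm_nonneg _)
  · filter_upwards [Measure.ae_ne volume (0 : E)] with x hx using (h.tendsto t ht x hx).mul_const _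

theorem tendsto_integral_source (h : HasTimeLimit T ψ η b C) (hϱ : -1 < ϱ)
    (hw : Integrable w volume) (hψw : ∀ᶠ R in atTop,
      IntegrableOn (fun z => ψ R z * (z.1 ^ ϱ * w z.2)) (positiveTimes E) volume) :
    Tendsto (fun R => T R ^ (-(1 + ϱ)) * ∫ z in positiveTimes E, ψ R z * (z.1 ^ ϱ * w z.2)) atTop
      (𝓝 ((∫ t in Ioi (0 : ℝ), t ^ ϱ * η t) * ∫ x, w x)) := by
  have hlim : Tendsto (fun R => ∫ t in Ioi (0 : ℝ), t ^ ϱ * ∫ x, ψ R (T R * t, x) * w x) atTop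
      (𝓝 (∫ t in Ioi (0 : ℝ), t ^ ϱ * ∫ x, η t * w x)) := by
    refine tendsto_integral_filter_of_dominated_convergence
      (fun t => t ^ ϱ * (Iic b).indicator (fun _ => C * ∫ x, |w x|) t) ?_ ?_
      (integrableOn_indicator_rpow hϱ b _) ?_
    · refine Eventually.of_forall fun R => ?_
      have hpow : Measurable fun t : ℝ => t ^ ϱ := by fun_prop
      have hprod : AEStronglyMeasurable (fun z : ℝ × E => ψ R (T R * z.1, z.2) * w z.2)
          ((volume.restrict (Ioi 0)).prod volume) :=
        ((h.measurable R).comp ((measurable_fst.const_mul _).prodMk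
          measurable_snd)).aestronglyMeasurable.mul hw.1.comp_snd
      exact hpow.aestronglyMeasurable.mul hprod.integral_prod_right'
    · filter_upwards [h.abs_le] with R hR
      filter_upwards [ae_restrict_mem measurableSet_Ioi] with t (ht : 0 < t)
      have hle : ‖∫ x, ψ R (T R * t, x) * w x‖ ≤ (Iic b).indicator (fun _ => C) t * ∫ x, |w x| := by
        rw [← integral_const_mul]
        refine norm_integral_le_of_norm_le (hw.abs.const_mul _) (Eventually.of_forall fun x => ?_)
        rw [norm_mul]
        exact mul_le_mul_of_nonneg_right (hR t ht x) (norm_nonneg _)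
      rw [norm_mul, Real.norm_of_nonneg (by positivity)]
      refine mul_le_mul_of_nonneg_left (hle.trans_eq ?_) (by positivity)
      by_cases htb : t ∈ Iic b <;> simp [htb]
    · filter_upwards [ae_restrict_mem measurableSet_Ioi] with t ht
      exact (h.tendsto_integral_mul hw ht).const_mul _
  simp only [integral_const_mul, ← mul_assoc, integral_mul_const] at hlim
  refine hlim.congr' ?_
  filter_upwards [h.scale_pos, hψw] with R hTR hψR
  rw [rescaled_integral_source hTR hψR]

theorem integral_le_zero (h : HasTimeLimit T ψ η b C) (hϱ : -1 < ϱ) (hw : Integrable w volume)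
    (hψw : ∀ᶠ R in atTop,
      IntegrableOn (fun z => ψ R z * (z.1 ^ ϱ * w z.2)) (positiveTimes E) volume)
    (hη : Continuous η) (hη0 : ∀ t > 0, 0 ≤ η t) {t₀ : ℝ} (ht₀ : 0 < t₀) (hpos : 0 < η t₀)
    {B : ℝ → ℝ} (hB : ∀ᶠ R in atTop, ∫ z in positiveTimes E, ψ R z * (z.1 ^ ϱ * w z.2) ≤ B R)
    (hB0 : Tendsto (fun R => T R ^ (-(1 + ϱ)) * B R) atTop (𝓝 0)) : ∫ x, w x ≤ 0 := by
  refine nonpos_of_mul_nonpos_right ?_ (h.integral_rpow_mul_limit_pos hϱ hη hη0 ht₀ hpos)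
  refine le_of_tendsto_of_tendsto (h.tendsto_integral_source hϱ hw hψw) hB0 ?_
  filter_upwards [h.scale_pos, hB] with R hT hR
  exact mul_le_mul_of_nonneg_left hR (by positivity)

end HasTimeLimit

end SourceLimit

section PowerBlockEstimate

variable {E : Type*} [NormedAddCommGroup E] [InnerProductSpace ℝ E] [FiniteDimensional ℝ E]
  [MeasurableSpace E] [BorelSpace E] [Nontrivial E] {t₀ t₁ A a q : ℝ} {D : Set ℝ}

theorem integrableOn_powerBlock_rpow_mul (hA : 0 ≤ A) (hq : 0 < q) (b : ℝ) (hD : MeasurableSet D)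
    (hDa : IntegrableOn (fun x : E => ‖x‖ ^ (a * q + b)) (norm ⁻¹' D) volume) :
    IntegrableOn (fun z => powerBlock E t₀ t₁ D A a z ^ q * ‖z.2‖ ^ b) (positiveTimes E)
      volume := by
  refine (integrableOn_powerBlock (t₀ := t₀) (t₁ := t₁) (A ^ q) hD hDa _).congr ?_
  filter_upwards [ae_positiveTimes] with z hz using (powerBlock_rpow_mul hA hq b hz.2).symm

theorem integral_powerBlock_rpow_mul (hA : 0 ≤ A) (hq : 0 < q) (b : ℝ) (hD : MeasurableSet D)
    (ht₀ : 0 < t₀) (ht : t₀ ≤ t₁) :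
    ∫ z in positiveTimes E, powerBlock E t₀ t₁ D A a z ^ q * ‖z.2‖ ^ b
      = A ^ q * (t₁ - t₀) * ∫ x in (norm : E → ℝ) ⁻¹' D, ‖x‖ ^ (a * q + b) := by
  rw [← integral_powerBlock ht₀ ht (A ^ q) hD]
  refine integral_congr_ae ?_
  filter_upwards [ae_positiveTimes] with z hz using powerBlock_rpow_mul hA hq b hz.2

end PowerBlockEstimate

section SpaceTimeCutoff

/-- A bump in time, supported in `[1, 4]`. -/
noncomputable def timeBump (θ : ℝ → ℝ) (t : ℝ) : ℝ := θ (t - 1) * θ (4 - t)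

theorem deriv_comp_div_const (η : ℝ → ℝ) (T t : ℝ) :
    deriv (fun s => η (s / T)) t = deriv η (t / T) / T := by
  simpa only [div_eq_inv_mul, smul_eq_mul] using deriv_comp_mul_left T⁻¹ η t

theorem IsTimeProfile.comp_div {a b T : ℝ} {η : ℝ → ℝ} (hη : IsTimeProfile a b η) (hT : 0 < T) :
    IsTimeProfile (a * T) (b * T) fun t => η (t / T) where
  contDiff := hη.contDiff.comp (contDiff_id.div_const T)
  pos := mul_pos hη.pos hT
  eq_zero _ ht := hη.eq_zero _ fun h => ht ⟨(le_div_iff₀ hT).1 h.1, (div_le_iff₀ hT).1 h.2⟩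

namespace IsSmoothStep

variable {p C R L : ℝ} {θ : ℝ → ℝ}

theorem self_le_rpow_inv (hθ : IsSmoothStep p C θ) (hp : 1 ≤ p) (t : ℝ) : θ t ≤ θ t ^ p⁻¹ :=
  Real.self_le_rpow_of_le_one (hθ.nonneg t) (hθ.le_one t) (inv_le_one_of_one_le₀ hp)

theorem timeBump_nonneg (hθ : IsSmoothStep p C θ) (t : ℝ) : 0 ≤ timeBump θ t :=
  mul_nonneg (hθ.nonneg _) (hθ.nonneg _)

theorem timeBump_le_one (hθ : IsSmoothStep p C θ) (t : ℝ) : timeBump θ t ≤ 1 :=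
  mul_le_one₀ (hθ.le_one _) (hθ.nonneg _) (hθ.le_one _)

theorem isTimeProfile_timeBump (hθ : IsSmoothStep p C θ) : IsTimeProfile 1 4 (timeBump θ) where
  contDiff := (hθ.contDiff.comp (contDiff_id.sub contDiff_const)).mul
    (hθ.contDiff.comp (contDiff_const.sub contDiff_id))
  pos := one_pos
  eq_zero t ht := by
    rcases not_and_or.1 ht with h | h
    · rw [timeBump, hθ.eq_zero _ (by linarith), zero_mul]
    · rw [timeBump, hθ.eq_zero (4 - t) (by linarith), mul_zero]

theorem abs_deriv_timeBump_le (hθ : IsSmoothStep p C θ) (hp : 1 ≤ p) (t : ℝ) :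
    |deriv (timeBump θ) t| ≤ 2 * C * timeBump θ t ^ p⁻¹ := by
  have hdiff : Differentiable ℝ θ := hθ.contDiff.differentiable (by simp)
  have hd : deriv (timeBump θ) t = deriv θ (t - 1) * θ (4 - t) - θ (t - 1) * deriv θ (4 - t) := by
    have h₁ := (hdiff (t - 1)).hasDerivAt.comp_sub_const t 1
    have h₂ := (hdiff (4 - t)).hasDerivAt.comp_const_sub 4 t
    exact ((h₁.mul h₂).congr_deriv (by ring)).deriv
  have hmul := Real.mul_rpow (z := p⁻¹) (hθ.nonneg (t - 1)) (hθ.nonneg (4 - t))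
  rw [hd, timeBump, hmul]
  refine (abs_sub _ _).trans ?_
  rw [abs_mul, abs_mul, abs_of_nonneg (hθ.nonneg (t - 1)), abs_of_nonneg (hθ.nonneg (4 - t))]
  calc _ ≤ C * θ (t - 1) ^ p⁻¹ * θ (4 - t) ^ p⁻¹ + θ (t - 1) ^ p⁻¹ * (C * θ (4 - t) ^ p⁻¹) :=
        add_le_add
          (mul_le_mul (hθ.abs_deriv_le _) (hθ.self_le_rpow_inv hp _) (hθ.nonneg _)
            ((abs_nonneg _).trans (hθ.abs_deriv_le _)))
          (mul_le_mul (hθ.self_le_rpow_inv hp _) (hθ.abs_deriv_le _) (abs_nonneg _)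
            (Real.rpow_nonneg (hθ.nonneg _) _))
    _ = _ := by ring

theorem logCutoff_nonneg (hθ : IsSmoothStep p C θ) (q : ℝ) : 0 ≤ logCutoff θ R L q := hθ.nonneg _

theorem logCutoff_le_one (hθ : IsSmoothStep p C θ) (q : ℝ) : logCutoff θ R L q ≤ 1 := hθ.le_one _

theorem measurable_logCutoff (hθ : IsSmoothStep p C θ) : Measurable (logCutoff θ R L) :=
  hθ.contDiff.continuous.measurable.comp (by fun_prop)

theorem logCutoff_norm_sq_eq_zero {E : Type*} [NormedAddCommGroup E] (hθ : IsSmoothStep p C θ)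
    (hR : 1 ≤ R) (hL : 1 ≤ L) {x : E} (hx : Real.exp L * R < ‖x‖) :
    logCutoff θ R L (‖x‖ ^ 2) = 0 :=
  hθ.logCutoff_eq_zero hR hL (by gcongr)

end IsSmoothStep

variable {E : Type*} [NormedAddCommGroup E]

/-- The separated test function `η(t/T) χ(x)` with a time bump `η` and a logarithmic cutoff `χ`. -/
noncomputable def spaceTimeCutoff (θ : ℝ → ℝ) (T R L : ℝ) (z : ℝ × E) : ℝ :=
  timeBump θ (z.1 / T) * logCutoff θ R L (‖z.2‖ ^ 2)

theorem powerBlock_of_mem {t₀ t₁ A a : ℝ} {D : Set ℝ} {z : ℝ × E} (ht : z.1 ∈ Icc t₀ t₁) :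
    powerBlock E t₀ t₁ D A a z = (norm ⁻¹' D).indicator (fun x => A * ‖x‖ ^ a) z.2 := by
  by_cases hz : z.2 ∈ norm ⁻¹' D
  · rw [powerBlock, indicator_of_mem (mk_mem_prod ht hz), indicator_of_mem hz]
  · rw [powerBlock, indicator_of_notMem fun h => hz h.2, indicator_of_notMem hz]

namespace IsSmoothStep

variable {p C T R L n σ₁ : ℝ} {θ : ℝ → ℝ} {z : ℝ × E}

theorem spaceTimeCutoff_rpow (hθ : IsSmoothStep p C θ) (T R L : ℝ) (z : ℝ × E) :
    spaceTimeCutoff θ T R L z ^ p⁻¹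
      = timeBump θ (z.1 / T) ^ p⁻¹ * logCutoff θ R L (‖z.2‖ ^ 2) ^ p⁻¹ :=
  Real.mul_rpow (hθ.timeBump_nonneg _) (hθ.logCutoff_nonneg _)

theorem isTimeProfile_timeBump_div (hθ : IsSmoothStep p C θ) (hT : 0 < T) :
    IsTimeProfile T (4 * T) fun t => timeBump θ (t / T) := by
  simpa only [one_mul] using hθ.isTimeProfile_timeBump.comp_div hT

theorem abs_norm_rpow_mul_deriv_spaceTimeCutoff_le (hθ : IsSmoothStep p C θ) (hp : 1 ≤ p)
    (hT : 0 < T) (hR : 1 ≤ R) (hL : 1 ≤ L) :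
    |‖z.2‖ ^ σ₁ * (deriv (fun t => timeBump θ (t / T)) z.1 * logCutoff θ R L (‖z.2‖ ^ 2))|
      ≤ powerBlock E T (4 * T) (Iic (Real.exp L * R)) (2 * C / T) σ₁ z
        * spaceTimeCutoff θ T R L z ^ p⁻¹ := by
  by_cases hD : z ∈ Icc T (4 * T) ×ˢ (norm ⁻¹' Iic (Real.exp L * R))
  · have hχ0 : 0 ≤ logCutoff θ R L (‖z.2‖ ^ 2) := hθ.logCutoff_nonneg _
    have hχ : logCutoff θ R L (‖z.2‖ ^ 2) ≤ logCutoff θ R L (‖z.2‖ ^ 2) ^ p⁻¹ :=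
      hθ.self_le_rpow_inv hp _
    have hderiv : |deriv (fun t => timeBump θ (t / T)) z.1|
        ≤ 2 * C * timeBump θ (z.1 / T) ^ p⁻¹ / T := by
      rw [deriv_comp_div_const, abs_div, abs_of_pos hT]
      gcongr
      exact hθ.abs_deriv_timeBump_le hp _
    rw [powerBlock, indicator_of_mem hD, hθ.spaceTimeCutoff_rpow, abs_mul, abs_mul,
      abs_of_nonneg hχ0, abs_of_nonneg (by positivity)]
    calc _ ≤ ‖z.2‖ ^ σ₁ * (2 * C * timeBump θ (z.1 / T) ^ p⁻¹ / T
          * logCutoff θ R L (‖z.2‖ ^ 2) ^ p⁻¹) :=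
          mul_le_mul_of_nonneg_left (mul_le_mul hderiv hχ hχ0 ((abs_nonneg _).trans hderiv))
            (by positivity)
      _ = _ := by ring
  · rw [powerBlock, indicator_of_notMem hD]
    rcases not_and_or.1 hD with h | h
    · simp [(hθ.isTimeProfile_timeBump_div hT).deriv_eq_zero h]
    · simp [hθ.logCutoff_norm_sq_eq_zero hR hL (not_le.1 h)]

theorem abs_timeBump_mul_radialLaplacian_le (hθ : IsSmoothStep p C θ) (hp : 1 ≤ p)
    (hT : 0 < T) (hR : 1 ≤ R) (hL : 1 ≤ L) (hn : 0 ≤ n) (hz : z.2 ≠ 0) :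
    |timeBump θ (z.1 / T) * radialLaplacian n (logCutoff θ R L) (‖z.2‖ ^ 2)|
      ≤ powerBlock E T (4 * T) (Icc R (Real.exp L * R)) ((4 + n) * C / L) (-2) z
        * spaceTimeCutoff θ T R L z ^ p⁻¹ := by
  by_cases ht : z.1 ∈ Icc T (4 * T)
  · have hη0 := hθ.timeBump_nonneg (z.1 / T)
    rw [powerBlock_of_mem ht, hθ.spaceTimeCutoff_rpow, abs_mul, abs_of_nonneg hη0, mul_left_comm]
    exact mul_le_mul (Real.self_le_rpow_of_le_one hη0 (hθ.timeBump_le_one _)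
      (inv_le_one_of_one_le₀ hp)) (hθ.abs_radialLaplacian_logCutoff_le hR hL hn hz)
      (abs_nonneg _) (by positivity)
  · have hη : timeBump θ (z.1 / T) = 0 := (hθ.isTimeProfile_timeBump_div hT).eq_zero _ ht
    simp [hη, powerBlock, indicator, ht]

theorem abs_adjoint_spaceTimeCutoff_le (hθ : IsSmoothStep p C θ) (hp : 1 ≤ p)
    (hT : 0 < T) (hR : 1 ≤ R) (hL : 1 ≤ L) (hn : 0 ≤ n) (hz : z.2 ≠ 0) :
    |-(‖z.2‖ ^ σ₁ * (deriv (fun t => timeBump θ (t / T)) z.1 * logCutoff θ R L (‖z.2‖ ^ 2)))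
        - timeBump θ (z.1 / T) * radialLaplacian n (logCutoff θ R L) (‖z.2‖ ^ 2)|
      ≤ (powerBlock E T (4 * T) (Iic (Real.exp L * R)) (2 * C / T) σ₁ z
          + powerBlock E T (4 * T) (Icc R (Real.exp L * R)) ((4 + n) * C / L) (-2) z)
        * spaceTimeCutoff θ T R L z ^ p⁻¹ := by
  refine (abs_sub _ _).trans ?_
  rw [abs_neg, add_mul]
  exact add_le_add (hθ.abs_norm_rpow_mul_deriv_spaceTimeCutoff_le hp hT hR hL)
    (hθ.abs_timeBump_mul_radialLaplacian_le hp hT hR hL hn hz)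

end IsSmoothStep

end SpaceTimeCutoff

section CutoffEstimate

theorem IsSmoothStep.hasTimeLimit_spaceTimeCutoff {E : Type*} [NormedAddCommGroup E]
    [MeasurableSpace E] [BorelSpace E] {p C : ℝ} {θ : ℝ → ℝ} (hθ : IsSmoothStep p C θ) {T L : ℝ → ℝ}
    (hT : ∀ᶠ R in atTop, 0 < T R) (hL : ∀ᶠ R in atTop, 1 ≤ L R) :
    HasTimeLimit T (fun R => spaceTimeCutoff (E := E) θ (T R) R (L R)) (timeBump θ) 4 1 where
  scale_pos := hT
  measurable R := (hθ.isTimeProfile_timeBump.contDiff.continuous.measurable.comp (by fun_prop)).mul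
    (hθ.measurable_logCutoff.comp (by fun_prop))
  abs_le := by
    filter_upwards [hT] with R hTR t _ x
    rw [spaceTimeCutoff, mul_div_cancel_left₀ _ hTR.ne', abs_of_nonneg
      (mul_nonneg (hθ.timeBump_nonneg _) (hθ.logCutoff_nonneg _))]
    rcases le_or_gt t 4 with h | h
    · rw [indicator_of_mem (mem_Iic.2 h)]
      exact mul_le_one₀ (hθ.timeBump_le_one _) (hθ.logCutoff_nonneg _) (hθ.logCutoff_le_one _)
    · rw [indicator_of_notMem (notMem_Iic.2 h),
        hθ.isTimeProfile_timeBump.eq_zero t fun ht => ht.2.not_gt h, zero_mul]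
  tendsto t _ x hx := by
    refine tendsto_nhds_of_eventually_eq ?_
    filter_upwards [hT, hL, eventually_ge_atTop 1, eventually_ge_atTop ‖x‖] with R hTR hLR hR hxR
    rw [spaceTimeCutoff, mul_div_cancel_left₀ _ hTR.ne',
      hθ.logCutoff_eq_one hR hLR (by positivity) (by gcongr), mul_one]

/-- The order of magnitude, in Young's inequality, of the error produced by
`spaceTimeCutoff θ T R L`: the first term comes from `∂ₜ`, the second from `Δ`. -/
noncomputable def cutoffCost (q d e T R L : ℝ) : ℝ :=
  T ^ (1 - q) * (Real.exp L * R) ^ d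
    + T * (L ^ (1 - q) * (max 1 (Real.exp (L * e)) * R ^ e))

variable {E : Type*} [NormedAddCommGroup E] [InnerProductSpace ℝ E] [FiniteDimensional ℝ E]
  [MeasurableSpace E] [BorelSpace E] [Nontrivial E] {σ₁ σ₂ ϱ p q d e C : ℝ} {w : E → ℝ}
  {u : ℝ × E → ℝ} {θ : ℝ → ℝ}

theorem IsDistributionalSolution.isTestPair_spaceTimeCutoff
    (hu : IsDistributionalSolution σ₁ σ₂ ϱ p w u) (hw : Integrable w volume)
    (hθ : IsSmoothStep p C θ) (hp : 0 ≤ p) {T R L : ℝ} (hT : 0 < T) (hR : 1 ≤ R) (hL : 1 ≤ L) :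
    IsTestPair σ₂ ϱ p w u (spaceTimeCutoff θ T R L) fun z =>
      -(‖z.2‖ ^ σ₁ * (deriv (fun t => timeBump θ (t / T)) z.1 * logCutoff θ R L (‖z.2‖ ^ 2)))
        - timeBump θ (z.1 / T) * radialLaplacian (finrank ℝ E) (logCutoff θ R L) (‖z.2‖ ^ 2) := by
  obtain ⟨C', hf⟩ := (hθ.isSymbol_logCutoff (R := R) hp hL).isSmoothApproximation_const (E := E)
    (σ₁ := σ₁) one_pos (b := 1) (r := Real.exp L * R)
    (fun s hs hs1 => hθ.logCutoff_eq_one hR hL hs (hs1.le.trans (one_le_pow₀ hR)))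
    (by positivity) fun s hs => hθ.logCutoff_eq_zero hR hL hs.le
  exact hu.isTestPair hw (hθ.isTimeProfile_timeBump_div hT) hf

theorem integral_powerBlock_time {T r A a b : ℝ} (hT : 0 < T) (hr : 0 ≤ r) (hA : 0 ≤ A)
    (hq : 0 < q) (hd : a * q + b + finrank ℝ E = d) (hd0 : 0 < d) :
    ∫ z in positiveTimes E, powerBlock E T (4 * T) (Iic r) (A / T) a z ^ q * ‖z.2‖ ^ b
      = 3 * A ^ q * (sphereArea E / d) * (T ^ (1 - q) * r ^ d) := by
  rw [integral_powerBlock_rpow_mul (by positivity) hq b measurableSet_Iic hT (by linarith),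
    setIntegral_norm_rpow_Iic (hd.symm ▸ hd0) hr, hd, Real.div_rpow hA hT.le, Real.rpow_sub hT,
    Real.rpow_one]
  ring

theorem integral_powerBlock_shell_le {T R L A a b : ℝ} (hT : 0 < T) (hR : 0 < R) (hL : 0 < L)
    (hA : 0 ≤ A) (hq : 0 < q) (he : a * q + b + finrank ℝ E = e) :
    ∫ z in positiveTimes E,
        powerBlock E T (4 * T) (Icc R (Real.exp L * R)) (A / L) a z ^ q * ‖z.2‖ ^ b
      ≤ 3 * A ^ q * sphereArea E * (T * (L ^ (1 - q) * (max 1 (Real.exp (L * e)) * R ^ e))) := by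
  rw [integral_powerBlock_rpow_mul (by positivity) hq b measurableSet_Icc hT (by linarith)]
  calc _ ≤ (A / L) ^ q * (4 * T - T)
        * (sphereArea E * (max 1 (Real.exp (L * e)) * R ^ e * L)) :=
      mul_le_mul_of_nonneg_left (he ▸ setIntegral_norm_rpow_Icc_le hR hL.le)
        (mul_nonneg (by positivity) (by linarith))
    _ = _ := by
      rw [Real.div_rpow hA hL.le, Real.rpow_sub hL, Real.rpow_one]
      ring

theorem IsDistributionalSolution.exists_integral_source_spaceTimeCutoff_le
    (hu : IsDistributionalSolution σ₁ σ₂ ϱ p w u) (hw : Integrable w volume)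
    (hθ : IsSmoothStep p C θ) (hpq : p.HolderConjugate q)
    (hd : σ₁ * q + σ₂ * (1 - q) + finrank ℝ E = d) (hd0 : 0 < d)
    (he : -2 * q + σ₂ * (1 - q) + finrank ℝ E = e) :
    ∃ M, ∀ T > 0, ∀ R ≥ 1, ∀ L ≥ 1,
      ∫ z in positiveTimes E, spaceTimeCutoff θ T R L z * (z.1 ^ ϱ * w z.2)
        ≤ M * cutoffCost q d e T R L := by
  have hq := hpq.symm.pos
  have hC := hθ.const_nonneg
  have hE := sphereArea_nonneg E
  set M₁ : ℝ := 3 * (2 * C) ^ q * (sphereArea E / d)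
  set M₂ : ℝ := 3 * ((4 + finrank ℝ E) * C) ^ q * sphereArea E
  have hM₁ : 0 ≤ M₁ := by positivity
  have hM₂ : 0 ≤ M₂ := by positivity
  refine ⟨2 ^ q * (M₁ + M₂), fun T hT R hR L hL => ?_⟩
  have hR0 : 0 < R := one_pos.trans_le hR
  have hL0 : 0 < L := one_pos.trans_le hL
  have hA₁ : 0 ≤ 2 * C / T := by positivity
  have hA₂ : 0 ≤ (4 + finrank ℝ E) * C / L := by positivity
  have hsource := (hu.isTestPair_spaceTimeCutoff hw hθ hpq.nonneg hT hR hL).integral_source_le hpq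
    (F₁ := powerBlock E T (4 * T) (Iic (Real.exp L * R)) (2 * C / T) σ₁)
    (F₂ := powerBlock E T (4 * T) (Icc R (Real.exp L * R)) ((4 + finrank ℝ E) * C / L) (-2))
    (G := fun _ => 0) (fun z _ => mul_nonneg (hθ.timeBump_nonneg _) (hθ.logCutoff_nonneg _))
    (powerBlock_nonneg hA₁) (powerBlock_nonneg hA₂)
    (fun z _ hz => by
      simpa only [add_zero]
        using hθ.abs_adjoint_spaceTimeCutoff_le hpq.lt.le hT hR hL (Nat.cast_nonneg _) hz)
    (integrableOn_powerBlock_rpow_mul hA₁ hq _ measurableSet_Iic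
      (integrableOn_norm_rpow_Iic (hd.symm ▸ hd0) _))
    (integrableOn_powerBlock_rpow_mul hA₂ hq _ measurableSet_Icc
      (integrableOn_norm_rpow_Icc hR0 _)) (by simp)
  rw [integral_powerBlock_time hT (by positivity) (by positivity) hq hd hd0] at hsource
  simp only [zero_mul, integral_zero, add_zero] at hsource
  have hspace := integral_powerBlock_shell_le (E := E) hT hR0 hL0
    (by positivity : 0 ≤ (4 + finrank ℝ E) * C) hq he
  calc _ ≤ _ := hsource
    _ ≤ 2 ^ q * (M₁ * (T ^ (1 - q) * (Real.exp L * R) ^ d)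
        + M₂ * (T * (L ^ (1 - q) * (max 1 (Real.exp (L * e)) * R ^ e)))) := by gcongr
    _ ≤ 2 ^ q * ((M₁ + M₂) * (T ^ (1 - q) * (Real.exp L * R) ^ d)
        + (M₁ + M₂) * (T * (L ^ (1 - q) * (max 1 (Real.exp (L * e)) * R ^ e)))) := by
      gcongr <;> linarith
    _ = _ := by rw [← mul_add, ← mul_assoc, cutoffCost]

theorem IsDistributionalSolution.integral_le_zero_of_tendsto
    (hu : IsDistributionalSolution σ₁ σ₂ ϱ p w u) (hw : Integrable w volume) (hϱ : -1 < ϱ)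
    (hpq : p.HolderConjugate q) (hd : σ₁ * q + σ₂ * (1 - q) + finrank ℝ E = d) (hd0 : 0 < d)
    (he : -2 * q + σ₂ * (1 - q) + finrank ℝ E = e) {T L : ℝ → ℝ}
    (hT : ∀ᶠ R in atTop, 0 < T R) (hL : ∀ᶠ R in atTop, 1 ≤ L R)
    (hlim : Tendsto (fun R => T R ^ (-(1 + ϱ)) * cutoffCost q d e (T R) R (L R)) atTop (𝓝 0)) :
    ∫ x, w x ≤ 0 := by
  obtain ⟨θ, C, hθ⟩ := exists_isSmoothStep hpq.lt
  obtain ⟨M, hM⟩ := hu.exists_integral_source_spaceTimeCutoff_le hw hθ hpq hd hd0 he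
  refine (hθ.hasTimeLimit_spaceTimeCutoff hT hL).integral_le_zero hϱ hw ?_
    hθ.isTimeProfile_timeBump.contDiff.continuous (fun t _ => hθ.timeBump_nonneg t)
    (t₀ := 2) two_pos ?_ (B := fun R => M * cutoffCost q d e (T R) R (L R)) ?_ ?_
  · filter_upwards [hT, hL, eventually_ge_atTop 1] with R hTR hLR hR
    exact (hu.isTestPair_spaceTimeCutoff hw hθ hpq.nonneg hTR hR hLR).integrable_source
  · norm_num [timeBump, hθ.eq_one]
  · filter_upwards [hT, hL, eventually_ge_atTop 1] with R hTR hLR hR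
    exact hM (T R) hTR R hR (L R) hLR
  · simpa only [mul_left_comm _ M, mul_zero] using hlim.const_mul M

end CutoffEstimate

section Scaling

variable {q d e ϱ m : ℝ}

theorem tendsto_cutoffCost_rpow (hd : d < m * (ϱ + q)) (he : e < m * ϱ) :
    Tendsto (fun R : ℝ => (R ^ m) ^ (-(1 + ϱ)) * cutoffCost q d e (R ^ m) R 1) atTop (𝓝 0) := by
  have hpow : ∀ c : ℝ, c < 0 → Tendsto (fun R : ℝ => R ^ c) atTop (𝓝 0) := fun c hc => by
    simpa using tendsto_rpow_neg_atTop (neg_pos.2 hc)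
  have hlim := ((hpow (d - m * (ϱ + q)) (by linarith)).const_mul (Real.exp 1 ^ d)).add
    ((hpow (e - m * ϱ) (by linarith)).const_mul (max 1 (Real.exp (1 * e))))
  rw [mul_zero, mul_zero, add_zero] at hlim
  refine hlim.congr' ?_
  filter_upwards [eventually_gt_atTop 0] with R hR
  have htime : R ^ (d - m * (ϱ + q)) = (R ^ m) ^ (-(1 + ϱ)) * ((R ^ m) ^ (1 - q) * R ^ d) := by
    rw [← Real.rpow_mul hR.le, ← Real.rpow_mul hR.le, ← Real.rpow_add hR, ← Real.rpow_add hR]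
    ring_nf
  have hspace : R ^ (e - m * ϱ) = (R ^ m) ^ (-(1 + ϱ)) * (R ^ m * R ^ e) := by
    rw [← Real.rpow_mul hR.le, ← Real.rpow_add hR, ← Real.rpow_add hR]
    ring_nf
  rw [cutoffCost, htime, hspace, Real.one_rpow, Real.mul_rpow (Real.exp_pos 1).le hR.le]
  ring

theorem tendsto_cutoffCost_log (hq : 1 < q) (he : e ≤ 0) (hd : 2 * d < m * q) :
    Tendsto (fun R : ℝ => (R ^ m) ^ (-(1 + 0 : ℝ)) * cutoffCost q d e (R ^ m) R (Real.log R))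
      atTop (𝓝 0) := by
  have htime : Tendsto (fun R : ℝ => R ^ (-(m * q - 2 * d))) atTop (𝓝 0) :=
    tendsto_rpow_neg_atTop (by linarith)
  have hlog : Tendsto (fun R : ℝ => Real.log R ^ (-(q - 1))) atTop (𝓝 0) :=
    (tendsto_rpow_neg_atTop (by linarith)).comp Real.tendsto_log_atTop
  have hlim := htime.add hlog
  rw [add_zero] at hlim
  refine squeeze_zero' ?_ ?_ hlim
  · filter_upwards [eventually_ge_atTop 1] with R hR
    have := Real.log_nonneg hR
    unfold cutoffCost
    positivity
  · filter_upwards [eventually_ge_atTop 1] with R hR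
    have hR0 : 0 < R := one_pos.trans_le hR
    have hlog0 := Real.log_nonneg hR
    have hmax : max 1 (Real.exp (Real.log R * e)) = 1 :=
      max_eq_left (Real.exp_le_one_iff.2 (mul_nonpos_of_nonneg_of_nonpos hlog0 he))
    have hpow : (R ^ m) ^ (-(1 + 0 : ℝ)) * ((R ^ m) ^ (1 - q) * (R * R) ^ d)
        = R ^ (-(m * q - 2 * d)) := by
      rw [Real.mul_rpow hR0.le hR0.le, ← Real.rpow_mul hR0.le, ← Real.rpow_mul hR0.le,
        ← Real.rpow_add hR0, ← Real.rpow_add hR0, ← Real.rpow_add hR0]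
      ring_nf
    rw [cutoffCost, Real.exp_log hR0, hmax, mul_add, hpow, add_zero, Real.rpow_neg_one,
      inv_mul_cancel_left₀ (by positivity), one_mul, ← neg_sub q]
    gcongr
    exact mul_le_of_le_one_right (by positivity) (Real.rpow_le_one_of_one_le_of_nonpos hR he)

end Scaling

section DecayFamily

open Polynomial in
/-- The polynomials `Pₖ` for which `Pₖ(1/s) exp(-1/s)` is the `k`-th derivative of `exp(-1/s)`. -/
noncomputable def gluePolynomial : ℕ → ℝ[X]
  | 0 => 1
  | k + 1 => X ^ 2 * (gluePolynomial k - derivative (R := ℝ) (gluePolynomial k))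

/-- The `k`-th derivative of the smooth function equal to `exp(-1/s)` for `s > 0` and to `0` for
`s ≤ 0`. -/
noncomputable def glueDeriv (k : ℕ) (s : ℝ) : ℝ :=
  (gluePolynomial k).eval s⁻¹ * expNegInvGlue s

theorem glueDeriv_zero (s : ℝ) : glueDeriv 0 s = expNegInvGlue s := by
  simp [glueDeriv, gluePolynomial]

theorem hasDerivAt_glueDeriv (k : ℕ) (s : ℝ) : HasDerivAt (glueDeriv k) (glueDeriv (k + 1) s) s :=
  expNegInvGlue.hasDerivAt_polynomial_eval_inv_mul (gluePolynomial k) s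

theorem contDiff_glueDeriv (k : ℕ) : ContDiff ℝ ∞ (glueDeriv k) :=
  expNegInvGlue.contDiff_polynomial_eval_inv_mul (gluePolynomial k)

theorem glueDeriv_of_nonpos (k : ℕ) {s : ℝ} (hs : s ≤ 0) : glueDeriv k s = 0 := by
  rw [glueDeriv, expNegInvGlue.zero_of_nonpos hs, mul_zero]

theorem monic_gluePolynomial (k : ℕ) : (gluePolynomial k).Monic := by
  induction k with
  | zero => exact Polynomial.monic_one
  | succ k ih =>
    exact (Polynomial.monic_X_pow 2).mul
      (ih.sub_of_left (Polynomial.degree_derivative_lt ih.ne_zero))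

theorem eventually_eval_pos_of_monic {P : Polynomial ℝ} (hP : P.Monic) :
    ∀ᶠ x in atTop, 0 < P.eval x := by
  rcases Nat.eq_zero_or_pos P.natDegree with h | h
  · rw [hP.natDegree_eq_zero.1 h]
    simp
  · refine (P.tendsto_atTop_of_leadingCoeff_nonneg
      (Polynomial.natDegree_pos_iff_degree_pos.1 h) ?_).eventually_gt_atTop 0
    rw [hP.leadingCoeff]
    exact zero_le_one

theorem exists_glueDeriv_nonneg (K : ℕ) :
    ∃ c, 0 < c ∧ c ≤ 1 ∧ ∀ k ≤ K, ∀ s ≤ c, 0 ≤ glueDeriv k s := by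
  have hev : ∀ᶠ x : ℝ in atTop, ∀ k ∈ Finset.range (K + 1), 0 < (gluePolynomial k).eval x :=
    (Filter.eventually_all_finset _).2 fun k _ =>
      eventually_eval_pos_of_monic (monic_gluePolynomial k)
  obtain ⟨X, hX⟩ := eventually_atTop.1 hev
  have hX0 : 0 < max X 1 := by positivity
  refine ⟨(max X 1)⁻¹, inv_pos.2 hX0, inv_le_one_of_one_le₀ (le_max_right _ _), fun k hk s hs => ?_⟩
  rcases le_or_gt s 0 with h | h
  · rw [glueDeriv_of_nonpos k h]
  · exact mul_nonneg (hX s⁻¹ ((le_max_left _ _).trans ((le_inv_comm₀ h hX0).1 hs)) k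
      (Finset.mem_range_succ_iff.2 hk)).le (expNegInvGlue.nonneg s)

theorem expNegInvGlue_mul_rpow {p q s : ℝ} (hpq : p.HolderConjugate q) (hs : 0 < s) :
    expNegInvGlue (q * s) * expNegInvGlue s ^ p⁻¹ = expNegInvGlue s := by
  have hval : ∀ y : ℝ, 0 < y → expNegInvGlue y = Real.exp (-y⁻¹) := fun y hy => by
    simp [expNegInvGlue, hy.not_ge]
  rw [hval s hs, hval _ (mul_pos hpq.symm.pos hs), ← Real.exp_mul, ← Real.exp_add, mul_inv,
    ← hpq.one_sub_inv]
  ring_nf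

theorem exists_abs_glueDeriv_le {p : ℝ} (hp : 1 < p) (k : ℕ) :
    ∃ C, 0 ≤ C ∧ ∀ s ≤ 1, |glueDeriv k s| ≤ C * expNegInvGlue s ^ p⁻¹ := by
  obtain ⟨q, hpq⟩ : ∃ q, p.HolderConjugate q := ⟨_, Real.HolderConjugate.conjExponent hp⟩
  have hq := hpq.symm.pos
  set P := (gluePolynomial k).comp (Polynomial.C q * Polynomial.X) with hP
  obtain ⟨M, hM⟩ := (isCompact_Icc (a := (0 : ℝ)) (b := q)).exists_bound_of_continuousOn
    (expNegInvGlue.continuous_polynomial_eval_inv_mul P).continuousOn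
  refine ⟨max M 0, le_max_right _ _, fun s hs => ?_⟩
  have hroot := Real.rpow_nonneg (expNegInvGlue.nonneg s) p⁻¹
  rcases le_or_gt s 0 with h | h
  · rw [glueDeriv_of_nonpos k h, abs_zero]
    positivity
  · have hbound := hM (q * s) ⟨by positivity, mul_le_of_le_one_right hq.le hs⟩
    rw [hP, Polynomial.eval_comp, Polynomial.eval_mul, Polynomial.eval_C, Polynomial.eval_X,
      mul_inv, mul_inv_cancel_left₀ hq.ne', Real.norm_eq_abs] at hbound
    calc |glueDeriv k s|
        = |(gluePolynomial k).eval s⁻¹ * expNegInvGlue (q * s)| * expNegInvGlue s ^ p⁻¹ := by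
          rw [glueDeriv, abs_mul _ (expNegInvGlue (q * s)), mul_assoc,
            abs_of_nonneg (expNegInvGlue.nonneg _), expNegInvGlue_mul_rpow hpq h, abs_mul,
            abs_of_nonneg (expNegInvGlue.nonneg s)]
      _ ≤ max M 0 * expNegInvGlue s ^ p⁻¹ :=
          mul_le_mul_of_nonneg_right (hbound.trans (le_max_left _ _)) hroot

/-- Functions on the half line with `hₖ' = -hₖ₊₁` which are nonnegative, vanish for `t ≥ 1` and are
controlled by the `p`-th root of `h₀`; they are the time factors of `caloricCutoff`. -/
structure IsDecayFamily (p : ℝ) (K : ℕ) (C : ℝ) (h : ℕ → ℝ → ℝ) : Prop where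
  contDiff : ∀ k, ContDiff ℝ ∞ (h k)
  hasDerivAt : ∀ k t, HasDerivAt (h k) (-h (k + 1) t) t
  eq_zero : ∀ k, ∀ t ≥ 1, h k t = 0
  nonneg : ∀ k ≤ K, ∀ t ≥ 0, 0 ≤ h k t
  pos : ∀ t < 1, 0 < h 0 t
  const_nonneg : 0 ≤ C
  abs_le : ∀ k ≤ K + 1, ∀ t ≥ 0, |h k t| ≤ C * h 0 t ^ p⁻¹
  le_one : ∀ t, h 0 t ≤ 1

theorem exists_isDecayFamily {p : ℝ} (hp : 1 < p) (K : ℕ) : ∃ h C, IsDecayFamily p K C h := by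
  obtain ⟨c, hc, hc1, hnonneg⟩ := exists_glueDeriv_nonneg K
  choose C hC hbound using fun k => exists_abs_glueDeriv_le hp k
  have hle : ∀ t : ℝ, t ≥ 0 → c * (1 - t) ≤ c := fun t ht =>
    mul_le_of_le_one_right hc.le (by linarith)
  have hzero : ∀ t, c ^ 0 * glueDeriv 0 (c * (1 - t)) = expNegInvGlue (c * (1 - t)) := fun t => by
    rw [pow_zero, one_mul, glueDeriv_zero]
  refine ⟨fun k t => c ^ k * glueDeriv k (c * (1 - t)), ∑ k ∈ Finset.range (K + 2), C k,
    fun k => contDiff_const.mul ((contDiff_glueDeriv k).comp (by fun_prop)), fun k t => ?_,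
    fun k t ht => ?_, fun k hk t ht => mul_nonneg (by positivity) (hnonneg k hk _ (hle t ht)),
    fun t ht => ?_, Finset.sum_nonneg fun k _ => hC k, fun k hk t ht => ?_, fun t => ?_⟩
  · have hlin : HasDerivAt (fun t : ℝ => c * (1 - t)) (-c) t := by
      simpa using ((hasDerivAt_id t).const_sub 1).const_mul c
    exact (((hasDerivAt_glueDeriv k _).comp t hlin).const_mul (c ^ k)).congr_deriv (by ring)
  · rw [glueDeriv_of_nonpos k (mul_nonpos_of_nonneg_of_nonpos hc.le (by linarith)), mul_zero]
  · rw [hzero]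
    exact expNegInvGlue.pos_of_pos (mul_pos hc (by linarith))
  · rw [hzero, abs_mul, abs_of_nonneg (by positivity : 0 ≤ c ^ k)]
    have hroot := Real.rpow_nonneg (expNegInvGlue.nonneg (c * (1 - t))) p⁻¹
    calc c ^ k * |glueDeriv k (c * (1 - t))| ≤ |glueDeriv k (c * (1 - t))| :=
          mul_le_of_le_one_left (abs_nonneg _) (pow_le_one₀ hc.le hc1)
      _ ≤ C k * expNegInvGlue (c * (1 - t)) ^ p⁻¹ := hbound k _ ((hle t ht).trans hc1)
      _ ≤ _ := by
        gcongr
        exact Finset.single_le_sum (f := C) (fun k _ => hC k)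
          (Finset.mem_range.2 (Nat.lt_succ_of_le hk))
  · rw [hzero]
    unfold expNegInvGlue
    split_ifs with h
    · exact zero_le_one
    · exact Real.exp_le_one_iff.2 (neg_nonpos.2 (inv_nonneg.2 (not_le.1 h).le))

end DecayFamily

section CaloricSum

/-- The coefficients for which `Δ (cₖ₊₁ |x|^((k+1)s)) = cₖ |x|^(s-2) |x|^(ks)` in dimension `n`. -/
noncomputable def caloricCoeff (n s : ℝ) : ℕ → ℝ
  | 0 => 1
  | k + 1 => caloricCoeff n s k / ((k + 1) * s * ((k + 1) * s + n - 2))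

/-- The truncated series whose value at `τ = t`, `y = |x|^s` solves `|x|^(s-2) ∂ₜv + Δv = 0` up to
one term when `hₖ' = -hₖ₊₁`. -/
noncomputable def caloricSum (n s : ℝ) (h : ℕ → ℝ → ℝ) (K : ℕ) (τ y : ℝ) : ℝ :=
  ∑ k ∈ Finset.range (K + 1), caloricCoeff n s k * (h k τ * y ^ k)

variable {n s p C τ y : ℝ} {h : ℕ → ℝ → ℝ} {K : ℕ}

theorem caloricCoeff_pos (hn : 2 ≤ n) (hs : 0 < s) (k : ℕ) : 0 < caloricCoeff n s k := by
  induction k with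
  | zero => exact one_pos
  | succ k ih =>
    have hks : 0 < ((k : ℝ) + 1) * s := by positivity
    exact div_pos ih (mul_pos hks (by linarith))

theorem sum_caloricCoeff_telescope (hn : 2 ≤ n) (hs : 0 < s) {r T : ℝ} (hr : 0 < r) (a : ℕ → ℝ)
    (K : ℕ) :
    ∑ k ∈ Finset.range (K + 1), caloricCoeff n s k *
      (r ^ (s - 2) * (a (k + 1) / T ^ (k + 1) * r ^ (k * s))
        - a k / T ^ k * (k * s * (k * s + n - 2) * r ^ (k * s - 2)))
      = caloricCoeff n s K * (r ^ (s - 2) * (a (K + 1) / T ^ (K + 1) * r ^ (K * s))) := by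
  induction K with
  | zero => simp
  | succ K ih =>
    have hKs : 0 < ((K : ℝ) + 1) * s := by positivity
    have hne : ((K : ℝ) + 1) * s * ((K + 1) * s + n - 2) ≠ 0 :=
      (mul_pos hKs (by linarith)).ne'
    have hcoeff : caloricCoeff n s K
        = caloricCoeff n s (K + 1) * ((K + 1) * s * ((K + 1) * s + n - 2)) :=
      (div_mul_cancel₀ _ hne).symm
    have hpow : r ^ (((K : ℝ) + 1) * s - 2) = r ^ (s - 2) * r ^ (K * s) := by
      rw [← Real.rpow_add hr]
      ring_nf
    rw [Finset.sum_range_succ, ih, hcoeff]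
    push_cast
    rw [hpow]
    ring

theorem IsDecayFamily.term_nonneg (hh : IsDecayFamily p K C h) (hn : 2 ≤ n) (hs : 0 < s)
    (hτ : 0 ≤ τ) (hy : 0 ≤ y) {k : ℕ} (hk : k ∈ Finset.range (K + 1)) :
    0 ≤ caloricCoeff n s k * (h k τ * y ^ k) :=
  mul_nonneg (caloricCoeff_pos hn hs k).le
    (mul_nonneg (hh.nonneg k (Finset.mem_range_succ_iff.1 hk) τ hτ) (pow_nonneg hy k))

theorem IsDecayFamily.le_caloricSum (hh : IsDecayFamily p K C h) (hn : 2 ≤ n) (hs : 0 < s)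
    (hτ : 0 ≤ τ) (hy : 0 ≤ y) : h 0 τ ≤ caloricSum n s h K τ y := by
  have hle := Finset.single_le_sum (fun k hk => hh.term_nonneg hn hs hτ hy hk)
    (Finset.mem_range.2 K.succ_pos)
  simpa only [caloricSum, caloricCoeff, pow_zero, mul_one, one_mul] using hle

/-- `M` bounds, relative to `h₀^(1/p)`, the truncated series for `y ≤ Y` and the term left over when
it is inserted into the adjoint equation. -/
structure IsCaloricBound (n s p Y : ℝ) (h : ℕ → ℝ → ℝ) (K : ℕ) (M : ℝ) : Prop where
  nonneg : 0 ≤ M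
  remainder_le : ∀ τ ≥ 0, caloricCoeff n s K * |h (K + 1) τ| ≤ M * h 0 τ ^ p⁻¹
  caloricSum_le : ∀ τ ≥ 0, ∀ y ∈ Icc 0 Y, caloricSum n s h K τ y ≤ M * h 0 τ ^ p⁻¹

theorem IsDecayFamily.exists_isCaloricBound (hh : IsDecayFamily p K C h) (hn : 2 ≤ n) (hs : 0 < s)
    (Y : ℝ) : ∃ M, IsCaloricBound n s p Y h K M := by
  have hc := fun k => (caloricCoeff_pos hn hs k).le
  have hcK := hc K
  have hC := hh.const_nonneg
  set S : ℝ := ∑ k ∈ Finset.range (K + 1), caloricCoeff n s k * |Y| ^ k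
  have hS : 0 ≤ S := Finset.sum_nonneg fun k _ => mul_nonneg (hc k) (by positivity)
  have hpos (τ : ℝ) (hτ : τ ≥ 0) : 0 ≤ h 0 τ ^ p⁻¹ :=
    Real.rpow_nonneg (hh.nonneg 0 K.zero_le τ hτ) _
  refine ⟨caloricCoeff n s K * C + C * S, by positivity, fun τ hτ => ?_, fun τ hτ y hy => ?_⟩
  · have hpos := hpos τ hτ
    calc caloricCoeff n s K * |h (K + 1) τ| ≤ caloricCoeff n s K * (C * h 0 τ ^ p⁻¹) :=
          mul_le_mul_of_nonneg_left (hh.abs_le _ le_rfl τ hτ) hcK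
      _ ≤ _ := by
        rw [← mul_assoc]
        gcongr
        exact le_add_of_nonneg_right (by positivity)
  · have hpos := hpos τ hτ
    calc caloricSum n s h K τ y
        ≤ ∑ k ∈ Finset.range (K + 1), caloricCoeff n s k * (C * h 0 τ ^ p⁻¹ * |Y| ^ k) := by
          refine Finset.sum_le_sum fun k hk => mul_le_mul_of_nonneg_left ?_ (hc k)
          have hk' := hh.abs_le k (Finset.mem_range.1 hk).le τ hτ
          exact mul_le_mul ((le_abs_self _).trans hk')
            (pow_le_pow_left₀ hy.1 (hy.2.trans (le_abs_self Y)) k) (pow_nonneg hy.1 k)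
            (by positivity)
      _ = C * S * h 0 τ ^ p⁻¹ := by
        simp only [S, Finset.mul_sum, Finset.sum_mul]
        exact Finset.sum_congr rfl fun k _ => by ring
      _ ≤ _ := by
        gcongr
        exact le_add_of_nonneg_left (by positivity)

end CaloricSum

section CaloricCutoff

/-- The `k`-th time factor of `caloricCutoff`. -/
noncomputable def caloricTime (θ : ℝ → ℝ) (h : ℕ → ℝ → ℝ) (T : ℝ) (k : ℕ) (t : ℝ) : ℝ :=
  θ (t - 1) * h k (t / T) / T ^ k

variable {n p s T R C D : ℝ} {θ : ℝ → ℝ} {h : ℕ → ℝ → ℝ} {K : ℕ}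

theorem IsSmoothStep.mul_decay_eq_zero (hθ : IsSmoothStep p C θ) (hh : IsDecayFamily p K D h)
    (hT : 0 < T) (k : ℕ) {t : ℝ} (ht : t ∉ Icc 1 T) : θ (t - 1) * h k (t / T) = 0 := by
  rcases not_and_or.1 ht with h1 | h1
  · rw [hθ.eq_zero _ (by linarith), zero_mul]
  · rw [hh.eq_zero k _ ((one_le_div hT).2 (not_le.1 h1).le), mul_zero]

theorem IsSmoothStep.isTimeProfile_caloricTime (hθ : IsSmoothStep p C θ)
    (hh : IsDecayFamily p K D h) (hT : 0 < T) (k : ℕ) :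
    IsTimeProfile 1 T (caloricTime θ h T k) where
  contDiff := ((hθ.contDiff.comp (contDiff_id.sub contDiff_const)).mul
    ((hh.contDiff k).comp (contDiff_id.div_const T))).div_const _
  pos := one_pos
  eq_zero t ht := by rw [caloricTime, hθ.mul_decay_eq_zero hh hT k ht, zero_div]

theorem IsSmoothStep.deriv_caloricTime (hθ : IsSmoothStep p C θ) (hh : IsDecayFamily p K D h)
    (T : ℝ) (k : ℕ) (t : ℝ) :
    deriv (caloricTime θ h T k) t
      = deriv θ (t - 1) * h k (t / T) / T ^ k - caloricTime θ h T (k + 1) t := by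
  have h₁ := ((hθ.contDiff.differentiable (by simp)) (t - 1)).hasDerivAt.comp_sub_const t 1
  have h₂ := (hh.hasDerivAt k (t / T)).comp t ((hasDerivAt_id t).div_const T)
  have hderiv := ((h₁.mul h₂).div_const (T ^ k)).deriv
  refine Eq.trans hderiv ?_
  simp only [caloricTime, pow_succ, Function.comp_apply, id_eq]
  ring

variable {E : Type*} [NormedAddCommGroup E]

/-- The truncated caloric series at time scale `T`, cut off near `t = 0` and beyond `|x| = R`. It
reduces to `h₀(t/T)` at `x = 0`, and its adjoint equation error is small near the origin. -/
noncomputable def caloricCutoff (E : Type*) [NormedAddCommGroup E] (θ : ℝ → ℝ) (h : ℕ → ℝ → ℝ)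
    (n s : ℝ) (K : ℕ) (T R : ℝ) (z : ℝ × E) : ℝ :=
  θ (z.1 - 1) * caloricSum n s h K (z.1 / T) (‖z.2‖ ^ s / T) * logCutoff θ R 1 (‖z.2‖ ^ 2)

/-- What `-|x|^(s-2) ∂ₜ - Δ` makes of `caloricCutoff`: the remainder of the series, the effect of
the cutoff in time, and the effect of the cutoff in space. -/
noncomputable def caloricAdjoint (E : Type*) [NormedAddCommGroup E] (θ : ℝ → ℝ) (h : ℕ → ℝ → ℝ)
    (n s : ℝ) (K : ℕ) (T R : ℝ) (z : ℝ × E) : ℝ :=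
  caloricCoeff n s K * (‖z.2‖ ^ (s - 2) * (caloricTime θ h T (K + 1) z.1 * ‖z.2‖ ^ (K * s)))
      * logCutoff θ R 1 (‖z.2‖ ^ 2)
    - ‖z.2‖ ^ (s - 2) * (deriv θ (z.1 - 1) * caloricSum n s h K (z.1 / T) (‖z.2‖ ^ s / T))
      * logCutoff θ R 1 (‖z.2‖ ^ 2)
    - θ (z.1 - 1) * ∑ k ∈ Finset.range (K + 1), caloricCoeff n s k *
      (h k (z.1 / T) * (‖z.2‖ ^ s / T) ^ k)
        * radialLaplacian (n + 2 * (k * s)) (logCutoff θ R 1) (‖z.2‖ ^ 2)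

theorem norm_sq_rpow_half (x : E) (a : ℝ) : (‖x‖ ^ 2) ^ (a / 2) = ‖x‖ ^ a := by
  rw [← Real.rpow_natCast, ← Real.rpow_mul (norm_nonneg x)]
  congr 1
  push_cast
  ring

theorem norm_rpow_div_pow (x : E) (s T : ℝ) (k : ℕ) :
    (‖x‖ ^ s / T) ^ k = ‖x‖ ^ (k * s) / T ^ k := by
  rw [div_pow, mul_comm, Real.rpow_mul_natCast (norm_nonneg x)]

theorem caloricCutoff_eq_sum (z : ℝ × E) :
    caloricCutoff E θ h n s K T R z
      = ∑ k ∈ Finset.range (K + 1), caloricCoeff n s k * (caloricTime θ h T k z.1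
        * ((‖z.2‖ ^ 2) ^ (k * s / 2) * logCutoff θ R 1 (‖z.2‖ ^ 2))) := by
  simp only [caloricCutoff, caloricSum, caloricTime, Finset.mul_sum, Finset.sum_mul,
    norm_sq_rpow_half, norm_rpow_div_pow]
  exact Finset.sum_congr rfl fun k _ => by ring

theorem IsSmoothStep.sum_adjoint_eq_caloricAdjoint (hθ : IsSmoothStep p C θ) (hp : 0 ≤ p)
    (hh : IsDecayFamily p K D h) (hn : 2 ≤ n) (hs : 0 < s) {z : ℝ × E} (hz : z.2 ≠ 0) :
    ∑ k ∈ Finset.range (K + 1), caloricCoeff n s k *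
      (-(‖z.2‖ ^ (s - 2) * (deriv (caloricTime θ h T k) z.1
          * ((‖z.2‖ ^ 2) ^ (k * s / 2) * logCutoff θ R 1 (‖z.2‖ ^ 2))))
        - caloricTime θ h T k z.1
          * radialLaplacian n (fun q => q ^ (k * s / 2) * logCutoff θ R 1 q) (‖z.2‖ ^ 2))
      = caloricAdjoint E θ h n s K T R z := by
  have hr : 0 < ‖z.2‖ := norm_pos_iff.2 hz
  have hpow (k : ℕ) : (‖z.2‖ ^ 2) ^ (k * s / 2 - 1) = ‖z.2‖ ^ (k * s - 2) := by
    rw [← norm_sq_rpow_half]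
    ring_nf
  have htelescope := sum_caloricCoeff_telescope hn hs hr (T := T)
    (fun k => θ (z.1 - 1) * h k (z.1 / T)) K
  rw [caloricAdjoint, caloricTime, ← htelescope, caloricSum]
  simp only [Finset.mul_sum, Finset.sum_mul, ← Finset.sum_sub_distrib]
  refine Finset.sum_congr rfl fun k _ => ?_
  rw [(hθ.isSymbol_logCutoff hp le_rfl).radialLaplacian_rpow_mul n _ (by positivity),
    hθ.deriv_caloricTime hh, hpow, norm_sq_rpow_half, norm_rpow_div_pow, caloricTime, caloricTime]
  ring_nf

variable [InnerProductSpace ℝ E] [FiniteDimensional ℝ E]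

theorem IsSmoothStep.exists_isSmoothApproximation_rpow_mul_logCutoff (hθ : IsSmoothStep p C θ)
    (hp : 0 ≤ p) (hs : 0 < s) (hR : 1 ≤ R) (k : ℕ) :
    ∃ f r C', IsSmoothApproximation (s - 2) f r C'
      (fun x : E => (‖x‖ ^ 2) ^ (k * s / 2) * logCutoff θ R 1 (‖x‖ ^ 2))
      (fun x => radialLaplacian (finrank ℝ E) (fun q => q ^ (k * s / 2) * logCutoff θ R 1 q)
        (‖x‖ ^ 2)) := by
  have hχ := hθ.isSymbol_logCutoff (R := R) hp le_rfl
  have hzero (q : ℝ) (hq : (Real.exp 1 * R) ^ 2 < q) : logCutoff θ R 1 q = 0 :=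
    hθ.logCutoff_eq_zero hR le_rfl hq.le
  rcases Nat.eq_zero_or_pos k with rfl | hk
  · obtain ⟨C', hf⟩ := hχ.isSmoothApproximation_const (E := E) (σ₁ := s - 2) one_pos (b := 1)
      (r := Real.exp 1 * R)
      (fun q hq hq1 => hθ.logCutoff_eq_one hR le_rfl hq (hq1.le.trans (one_le_pow₀ hR)))
      (by positivity) hzero
    refine ⟨fun _ x => logCutoff θ R 1 (‖x‖ ^ 2), Real.exp 1 * R, C', ?_⟩
    simpa only [Nat.cast_zero, zero_mul, zero_div, Real.rpow_zero, one_mul] using hf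
  · have hk1 : (1 : ℝ) ≤ k := by exact_mod_cast hk
    have hks : 0 < k * s := by positivity
    obtain ⟨f, C', hf⟩ := ((IsSymbol.rpow (k * s / 2)).mul hχ).exists_isSmoothApproximation (E := E)
      hθ hp (by rw [Real.zero_rpow (half_pos hks).ne', zero_mul]) (σ₁ := s - 2) (by linarith)
      (by nlinarith) (r := Real.exp 1 * R) (by positivity)
      fun q hq => by rw [hzero q hq, mul_zero]
    exact ⟨f, _, C', hf⟩

variable [MeasurableSpace E] [BorelSpace E] [Nontrivial E] {σ₁ σ₂ ϱ : ℝ} {w : E → ℝ}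
  {u : ℝ × E → ℝ}

theorem IsDistributionalSolution.exists_isTestPair_caloricCutoff
    (hu : IsDistributionalSolution σ₁ σ₂ ϱ p w u) (hw : Integrable w volume)
    (hθ : IsSmoothStep p C θ) (hp : 0 ≤ p) (hh : IsDecayFamily p K D h)
    (hE : 2 ≤ (finrank ℝ E : ℝ)) (hs : 0 < s) (hσ₁ : s - 2 = σ₁) (hT : 0 < T) (hR : 1 ≤ R) :
    ∃ Λ, IsTestPair σ₂ ϱ p w u (caloricCutoff E θ h (finrank ℝ E) s K T R) Λ ∧
      ∀ z, z.2 ≠ 0 → Λ z = caloricAdjoint E θ h (finrank ℝ E) s K T R z := by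
  subst hσ₁
  refine ⟨_, ?_, fun z hz => hθ.sum_adjoint_eq_caloricAdjoint hp hh hE hs hz⟩
  rw [funext caloricCutoff_eq_sum]
  refine IsTestPair.linearCombination _ _ fun k _ => ?_
  obtain ⟨f, r, C', hf⟩ :=
    hθ.exists_isSmoothApproximation_rpow_mul_logCutoff (E := E) hp hs hR k
  exact hu.isTestPair hw (hθ.isTimeProfile_caloricTime hh hT k) hf

end CaloricCutoff

section CaloricEstimate

variable {E : Type*} [NormedAddCommGroup E] {n s p R C D M : ℝ} {θ : ℝ → ℝ} {h : ℕ → ℝ → ℝ} {K : ℕ}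
  {z : ℝ × E}

theorem norm_rpow_div_rpow_mem_Icc (hs : 0 ≤ s) (hR : 0 < R) {x : E} (hx : ‖x‖ ≤ Real.exp 1 * R) :
    ‖x‖ ^ s / R ^ s ∈ Icc 0 (Real.exp s) := by
  refine ⟨by positivity, (div_le_iff₀ (by positivity)).2 ?_⟩
  calc ‖x‖ ^ s ≤ (Real.exp 1 * R) ^ s := by gcongr
    _ = Real.exp s * R ^ s := by
      rw [Real.mul_rpow (Real.exp_pos 1).le hR.le, Real.exp_one_rpow]

theorem powerBlock_add (t₀ t₁ : ℝ) (D : Set ℝ) (A B a : ℝ) (z : ℝ × E) :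
    powerBlock E t₀ t₁ D A a z + powerBlock E t₀ t₁ D B a z
      = powerBlock E t₀ t₁ D (A + B) a z := by
  by_cases hz : z ∈ Icc t₀ t₁ ×ˢ (norm ⁻¹' D) <;> simp [powerBlock, hz, add_mul]

theorem norm_rpow_neg_two_le (hR : 0 < R) {a : ℝ} (ha : 0 ≤ a) {x : E} (hx : R ≤ ‖x‖) :
    ‖x‖ ^ (-2 : ℝ) ≤ R ^ (-a) * ‖x‖ ^ (a - 2) := by
  have hle : 1 ≤ R ^ (-a) * ‖x‖ ^ a := by
    rw [Real.rpow_neg hR.le, ← div_eq_inv_mul, one_le_div (by positivity)]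
    exact Real.rpow_le_rpow hR.le hx ha
  rw [sub_eq_add_neg, Real.rpow_add (hR.trans_le hx), ← mul_assoc]
  exact le_mul_of_one_le_left (by positivity) hle

namespace IsSmoothStep

theorem deriv_sub_one_eq_zero (hθ : IsSmoothStep p C θ) {t : ℝ} (ht : t ∉ Icc 1 2) :
    deriv θ (t - 1) = 0 := by
  rcases not_and_or.1 ht with h1 | h1
  · have hev : θ =ᶠ[𝓝 (t - 1)] fun _ => 0 := by
      filter_upwards [Iio_mem_nhds (by linarith : t - 1 < 0)] with r hr
      exact hθ.eq_zero r (le_of_lt hr)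
    simpa using hev.deriv_eq
  · have hev : θ =ᶠ[𝓝 (t - 1)] fun _ => 1 := by
      filter_upwards [Ioi_mem_nhds (by linarith : 1 < t - 1)] with r hr
      exact hθ.eq_one r (le_of_lt hr)
    simpa using hev.deriv_eq

theorem caloricCutoff_nonneg (hθ : IsSmoothStep p C θ) (hh : IsDecayFamily p K D h) (hn : 2 ≤ n)
    (hs : 0 < s) (hR : 0 < R) (hz : 0 < z.1) :
    0 ≤ caloricCutoff E θ h n s K (R ^ s) R z :=
  mul_nonneg (mul_nonneg (hθ.nonneg _)
    ((hh.nonneg 0 K.zero_le _ (by positivity)).trans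
      (hh.le_caloricSum hn hs (by positivity) (by positivity)))) (hθ.logCutoff_nonneg _)

theorem mul_rpow_le_caloricCutoff_rpow (hθ : IsSmoothStep p C θ) (hh : IsDecayFamily p K D h)
    (hn : 2 ≤ n) (hs : 0 < s) (hp : 0 ≤ p) (hR : 0 < R) (hz : 0 < z.1) :
    θ (z.1 - 1) ^ p⁻¹ * h 0 (z.1 / R ^ s) ^ p⁻¹ * logCutoff θ R 1 (‖z.2‖ ^ 2) ^ p⁻¹
      ≤ caloricCutoff E θ h n s K (R ^ s) R z ^ p⁻¹ := by
  have hτ : 0 ≤ z.1 / R ^ s := by positivity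
  have hh0 := hh.nonneg 0 K.zero_le _ hτ
  have hθ0 := hθ.nonneg (z.1 - 1)
  have hχ0 := hθ.logCutoff_nonneg (R := R) (L := 1) (‖z.2‖ ^ 2)
  rw [← Real.mul_rpow hθ0 hh0, ← Real.mul_rpow (mul_nonneg hθ0 hh0) hχ0, caloricCutoff]
  have := hh.le_caloricSum hn hs hτ (by positivity : 0 ≤ ‖z.2‖ ^ s / R ^ s)
  gcongr

theorem abs_caloric_remainder_le_of_ne_zero (hθ : IsSmoothStep p C θ) (hn : 2 ≤ n) (hs : 0 < s)
    (hM : IsCaloricBound n s p (Real.exp s) h K M) (hp : 1 ≤ p) (hR : 0 < R) (hz : 0 < z.1)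
    (hx : z.2 ≠ 0) :
    |caloricCoeff n s K * (‖z.2‖ ^ (s - 2) * (caloricTime θ h (R ^ s) (K + 1) z.1
        * ‖z.2‖ ^ (K * s))) * logCutoff θ R 1 (‖z.2‖ ^ 2)|
      ≤ M * R ^ (-((K + 1) * s)) * ‖z.2‖ ^ ((K + 1) * s - 2)
        * (θ (z.1 - 1) ^ p⁻¹ * h 0 (z.1 / R ^ s) ^ p⁻¹ * logCutoff θ R 1 (‖z.2‖ ^ 2) ^ p⁻¹) := by
  have hr : 0 < ‖z.2‖ := norm_pos_iff.2 hx
  have hc := (caloricCoeff_pos hn hs K).le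
  have hθ0 := hθ.nonneg (z.1 - 1)
  have hχ0 := hθ.logCutoff_nonneg (R := R) (L := 1) (‖z.2‖ ^ 2)
  have hpow : ‖z.2‖ ^ (s - 2) * ‖z.2‖ ^ (K * s) = ‖z.2‖ ^ (((K : ℝ) + 1) * s - 2) := by
    rw [← Real.rpow_add hr]
    ring_nf
  have hT : R ^ (-(((K : ℝ) + 1) * s)) = ((R ^ s) ^ (K + 1))⁻¹ := by
    rw [Real.rpow_neg hR.le, mul_comm, Real.rpow_mul hR.le]
    norm_cast
  rw [caloricTime, hT, ← hpow]
  calc _ = ‖z.2‖ ^ (s - 2) * ‖z.2‖ ^ (K * s) * ((R ^ s) ^ (K + 1))⁻¹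
        * (θ (z.1 - 1) * (caloricCoeff n s K * |h (K + 1) (z.1 / R ^ s)|)
          * logCutoff θ R 1 (‖z.2‖ ^ 2)) := by
        simp only [abs_mul, abs_div, abs_of_nonneg hc, abs_of_nonneg hθ0, abs_of_nonneg hχ0,
          abs_of_nonneg (Real.rpow_nonneg hr.le _),
          abs_of_nonneg (pow_nonneg (Real.rpow_nonneg hR.le s) (K + 1))]
        ring
    _ ≤ ‖z.2‖ ^ (s - 2) * ‖z.2‖ ^ (K * s) * ((R ^ s) ^ (K + 1))⁻¹
        * (θ (z.1 - 1) ^ p⁻¹ * (M * h 0 (z.1 / R ^ s) ^ p⁻¹)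
          * logCutoff θ R 1 (‖z.2‖ ^ 2) ^ p⁻¹) := by
        have hrem := hM.remainder_le (z.1 / R ^ s) (by positivity)
        have hbound0 := (mul_nonneg hc (abs_nonneg _)).trans hrem
        gcongr
        exacts [hθ.self_le_rpow_inv hp _, hθ.self_le_rpow_inv hp _]
    _ = _ := by ring

theorem abs_caloric_remainder_le (hθ : IsSmoothStep p C θ) (hh : IsDecayFamily p K D h)
    (hn : 2 ≤ n) (hs : 0 < s) (hM : IsCaloricBound n s p (Real.exp s) h K M) (hp : 1 ≤ p)
    (hR : 1 ≤ R) (hz : 0 < z.1) (hx : z.2 ≠ 0) :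
    |caloricCoeff n s K * (‖z.2‖ ^ (s - 2) * (caloricTime θ h (R ^ s) (K + 1) z.1
        * ‖z.2‖ ^ (K * s))) * logCutoff θ R 1 (‖z.2‖ ^ 2)|
      ≤ powerBlock E 1 (R ^ s) (Iic (Real.exp 1 * R)) (M * R ^ (-((K + 1) * s)))
          ((K + 1) * s - 2) z * caloricCutoff E θ h n s K (R ^ s) R z ^ p⁻¹ := by
  have hR0 : 0 < R := one_pos.trans_le hR
  by_cases hD : z ∈ Icc 1 (R ^ s) ×ˢ (norm ⁻¹' Iic (Real.exp 1 * R))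
  · have hM0 := hM.nonneg
    rw [powerBlock, indicator_of_mem hD]
    refine (hθ.abs_caloric_remainder_le_of_ne_zero hn hs hM hp hR0 hz hx).trans ?_
    gcongr
    exact hθ.mul_rpow_le_caloricCutoff_rpow hh hn hs (zero_le_one.trans hp) hR0 hz
  · rw [powerBlock, indicator_of_notMem hD]
    rcases not_and_or.1 hD with hD | hD
    · simp [caloricTime, hθ.mul_decay_eq_zero hh (Real.rpow_pos_of_pos hR0 s) (K + 1) hD]
    · simp [hθ.logCutoff_norm_sq_eq_zero hR le_rfl (not_le.1 hD)]

theorem mul_caloricSum_eq_zero (hθ : IsSmoothStep p C θ) (hh : IsDecayFamily p K D h) {T : ℝ}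
    (hT : 0 < T) {t : ℝ} (ht : t ∉ Icc 1 T) (n s y : ℝ) :
    θ (t - 1) * caloricSum n s h K (t / T) y = 0 := by
  rw [caloricSum, Finset.mul_sum]
  refine Finset.sum_eq_zero fun k _ => ?_
  linear_combination caloricCoeff n s k * y ^ k * hθ.mul_decay_eq_zero hh hT k ht

theorem abs_sum_mul_radialLaplacian_le (hθ : IsSmoothStep p C θ) (hh : IsDecayFamily p K D h)
    (hn : 2 ≤ n) (hs : 0 < s) (hR : 1 ≤ R) {τ y : ℝ} (hτ : 0 ≤ τ) (hy : 0 ≤ y) {x : E}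
    (hx : x ≠ 0) :
    |∑ k ∈ Finset.range (K + 1), caloricCoeff n s k * (h k τ * y ^ k)
        * radialLaplacian (n + 2 * (k * s)) (logCutoff θ R 1) (‖x‖ ^ 2)|
      ≤ caloricSum n s h K τ y * ((norm ⁻¹' Icc R (Real.exp 1 * R)).indicator
        (fun x => (4 + (n + 2 * (K * s))) * C * ‖x‖ ^ (-2 : ℝ)) x
          * logCutoff θ R 1 (‖x‖ ^ 2) ^ p⁻¹) := by
  have hC := hθ.const_nonneg
  have hχ0 := hθ.logCutoff_nonneg (R := R) (L := 1) (‖x‖ ^ 2)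
  rw [caloricSum, Finset.sum_mul]
  refine (Finset.abs_sum_le_sum_abs _ _).trans (Finset.sum_le_sum fun k hk => ?_)
  have hterm := hh.term_nonneg hn hs hτ hy hk
  have hkK : (k : ℝ) ≤ K := by exact_mod_cast Finset.mem_range_succ_iff.1 hk
  rw [abs_mul, abs_of_nonneg hterm]
  refine mul_le_mul_of_nonneg_left ?_ hterm
  refine (hθ.abs_radialLaplacian_logCutoff_le hR le_rfl (by positivity) hx).trans ?_
  rw [div_one]
  gcongr

theorem mul_caloricSum_mul_norm_rpow_le (hθ : IsSmoothStep p C θ) (hh : IsDecayFamily p K D h)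
    (hn : 2 ≤ n) (hs : 0 < s) (hM : IsCaloricBound n s p (Real.exp s) h K M) (hp : 1 ≤ p)
    (hR : 0 < R) (hz : 0 < z.1) (hx : z.2 ∈ (norm : E → ℝ) ⁻¹' Icc R (Real.exp 1 * R)) {A : ℝ}
    (hA : 0 ≤ A) :
    θ (z.1 - 1) * caloricSum n s h K (z.1 / R ^ s) (‖z.2‖ ^ s / R ^ s)
        * (A * ‖z.2‖ ^ (-2 : ℝ) * logCutoff θ R 1 (‖z.2‖ ^ 2) ^ p⁻¹)
      ≤ M * A * R ^ (-((K + 1) * s)) * ‖z.2‖ ^ ((K + 1) * s - 2)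
        * caloricCutoff E θ h n s K (R ^ s) R z ^ p⁻¹ := by
  have hM0 := hM.nonneg
  have hτ : 0 ≤ z.1 / R ^ s := by positivity
  have hsum := hM.caloricSum_le _ hτ _ (norm_rpow_div_rpow_mem_Icc hs.le hR hx.2)
  have hsum0 := (hh.nonneg 0 K.zero_le _ hτ).trans
    (hh.le_caloricSum hn hs hτ (by positivity : 0 ≤ ‖z.2‖ ^ s / R ^ s))
  have hbound0 := hsum0.trans hsum
  have hχ0 := hθ.logCutoff_nonneg (R := R) (L := 1) (‖z.2‖ ^ 2)
  have hθ0 := hθ.nonneg (z.1 - 1)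
  have hdecay := norm_rpow_neg_two_le hR (by positivity : 0 ≤ ((K : ℝ) + 1) * s) hx.1
  calc _ ≤ θ (z.1 - 1) ^ p⁻¹ * (M * h 0 (z.1 / R ^ s) ^ p⁻¹)
        * (A * (R ^ (-(((K : ℝ) + 1) * s)) * ‖z.2‖ ^ (((K : ℝ) + 1) * s - 2))
          * logCutoff θ R 1 (‖z.2‖ ^ 2) ^ p⁻¹) := by
        gcongr
        exact hθ.self_le_rpow_inv hp _
    _ = M * A * R ^ (-(((K : ℝ) + 1) * s)) * ‖z.2‖ ^ (((K : ℝ) + 1) * s - 2)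
        * (θ (z.1 - 1) ^ p⁻¹ * h 0 (z.1 / R ^ s) ^ p⁻¹
          * logCutoff θ R 1 (‖z.2‖ ^ 2) ^ p⁻¹) := by ring
    _ ≤ _ := by
        gcongr
        exact hθ.mul_rpow_le_caloricCutoff_rpow hh hn hs (zero_le_one.trans hp) hR hz

theorem abs_caloric_space_le (hθ : IsSmoothStep p C θ) (hh : IsDecayFamily p K D h)
    (hn : 2 ≤ n) (hs : 0 < s) (hM : IsCaloricBound n s p (Real.exp s) h K M) (hp : 1 ≤ p)
    (hR : 1 ≤ R) (hz : 0 < z.1) (hx : z.2 ≠ 0) :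
    |θ (z.1 - 1) * ∑ k ∈ Finset.range (K + 1), caloricCoeff n s k *
        (h k (z.1 / R ^ s) * (‖z.2‖ ^ s / R ^ s) ^ k)
          * radialLaplacian (n + 2 * (k * s)) (logCutoff θ R 1) (‖z.2‖ ^ 2)|
      ≤ powerBlock E 1 (R ^ s) (Iic (Real.exp 1 * R))
          (M * ((4 + (n + 2 * (K * s))) * C) * R ^ (-((K + 1) * s))) ((K + 1) * s - 2) z
        * caloricCutoff E θ h n s K (R ^ s) R z ^ p⁻¹ := by
  have hR0 : 0 < R := one_pos.trans_le hR
  have hC := hθ.const_nonneg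
  have hM0 := hM.nonneg
  have hθ0 := hθ.nonneg (z.1 - 1)
  have hψ := Real.rpow_nonneg (hθ.caloricCutoff_nonneg hh hn hs hR0 hz) p⁻¹
  have hblock := mul_nonneg (powerBlock_nonneg (z := z) (t₀ := 1) (t₁ := R ^ s)
    (D := Iic (Real.exp 1 * R)) (a := (K + 1) * s - 2) (by positivity :
      0 ≤ M * ((4 + (n + 2 * (K * s))) * C) * R ^ (-(((K : ℝ) + 1) * s)))) hψ
  rw [abs_mul, abs_of_nonneg hθ0]
  refine (mul_le_mul_of_nonneg_left (hθ.abs_sum_mul_radialLaplacian_le hh hn hs hR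
    (by positivity) (by positivity) hx) hθ0).trans ?_
  rw [← mul_assoc]
  by_cases ht : z.1 ∈ Icc 1 (R ^ s)
  swap
  · rwa [hθ.mul_caloricSum_eq_zero hh (by positivity) ht, zero_mul]
  by_cases hshell : z.2 ∈ (norm : E → ℝ) ⁻¹' Icc R (Real.exp 1 * R)
  swap
  · rwa [indicator_of_notMem hshell, zero_mul, mul_zero]
  have hD : z ∈ Icc 1 (R ^ s) ×ˢ ((norm : E → ℝ) ⁻¹' Iic (Real.exp 1 * R)) := ⟨ht, hshell.2⟩
  rw [powerBlock, indicator_of_mem hD, indicator_of_mem hshell]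
  exact hθ.mul_caloricSum_mul_norm_rpow_le hh hn hs hM hp hR0 hz hshell (by positivity)

theorem abs_caloric_time_le_of_norm_le (hθ : IsSmoothStep p C θ) (hh : IsDecayFamily p K D h)
    (hn : 2 ≤ n) (hs : 0 < s) (hM : IsCaloricBound n s p (Real.exp s) h K M) (hp : 1 ≤ p)
    (hR : 0 < R) (hz : 0 < z.1) (hx : ‖z.2‖ ≤ Real.exp 1 * R) :
    |‖z.2‖ ^ (s - 2) * (deriv θ (z.1 - 1) * caloricSum n s h K (z.1 / R ^ s) (‖z.2‖ ^ s / R ^ s))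
        * logCutoff θ R 1 (‖z.2‖ ^ 2)|
      ≤ M * C * ‖z.2‖ ^ (s - 2) * (θ (z.1 - 1) ^ p⁻¹ * h 0 (z.1 / R ^ s) ^ p⁻¹
          * logCutoff θ R 1 (‖z.2‖ ^ 2) ^ p⁻¹) := by
  have hτ : 0 ≤ z.1 / R ^ s := by positivity
  have hy := norm_rpow_div_rpow_mem_Icc hs.le hR hx
  have hsum := hM.caloricSum_le _ hτ _ hy
  have hsum0 := (hh.nonneg 0 K.zero_le _ hτ).trans (hh.le_caloricSum hn hs hτ hy.1)
  have hbound0 := hsum0.trans hsum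
  have hχ0 := hθ.logCutoff_nonneg (R := R) (L := 1) (‖z.2‖ ^ 2)
  have hderiv := hθ.abs_deriv_le (z.1 - 1)
  have hderiv0 := (abs_nonneg _).trans hderiv
  rw [abs_mul, abs_mul, abs_mul, abs_of_nonneg hsum0, abs_of_nonneg hχ0,
    abs_of_nonneg (by positivity)]
  calc _ ≤ ‖z.2‖ ^ (s - 2) * (C * θ (z.1 - 1) ^ p⁻¹ * (M * h 0 (z.1 / R ^ s) ^ p⁻¹))
        * logCutoff θ R 1 (‖z.2‖ ^ 2) ^ p⁻¹ := by
        gcongr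
        exact hθ.self_le_rpow_inv hp _
    _ = _ := by ring

theorem abs_caloric_time_le (hθ : IsSmoothStep p C θ) (hh : IsDecayFamily p K D h)
    (hn : 2 ≤ n) (hs : 0 < s) (hM : IsCaloricBound n s p (Real.exp s) h K M) (hp : 1 ≤ p)
    (hR : 1 ≤ R) (hz : 0 < z.1) :
    |‖z.2‖ ^ (s - 2) * (deriv θ (z.1 - 1) * caloricSum n s h K (z.1 / R ^ s) (‖z.2‖ ^ s / R ^ s))
        * logCutoff θ R 1 (‖z.2‖ ^ 2)|
      ≤ powerBlock E 1 2 (Icc 1 (Real.exp 1 * R)) (M * C) (s - 2) z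
          * caloricCutoff E θ h n s K (R ^ s) R z ^ p⁻¹
        + powerBlock E 1 2 (Iic 1) (M * C) (s - 2) z := by
  have hR0 : 0 < R := one_pos.trans_le hR
  have hMC : 0 ≤ M * C := mul_nonneg hM.nonneg hθ.const_nonneg
  have hτ : 0 ≤ z.1 / R ^ s := by positivity
  have hψ := Real.rpow_nonneg (hθ.caloricCutoff_nonneg hh hn hs hR0 hz) p⁻¹
  have hblock₁ := mul_nonneg (powerBlock_nonneg (z := z) (t₀ := 1) (t₁ := 2)
    (D := Icc 1 (Real.exp 1 * R)) (a := s - 2) hMC) hψ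
  have hblock₂ := powerBlock_nonneg (z := z) (t₀ := 1) (t₁ := 2) (D := Iic 1) (a := s - 2) hMC
  by_cases ht : z.1 ∈ Icc 1 2
  swap
  · simpa [hθ.deriv_sub_one_eq_zero ht] using add_nonneg hblock₁ hblock₂
  by_cases hx : ‖z.2‖ ≤ Real.exp 1 * R
  swap
  · simpa [hθ.logCutoff_norm_sq_eq_zero hR le_rfl (not_le.1 hx)] using add_nonneg hblock₁ hblock₂
  refine (hθ.abs_caloric_time_le_of_norm_le hh hn hs hM hp hR0 hz hx).trans ?_
  rcases le_total ‖z.2‖ 1 with hx1 | hx1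
  · refine le_add_of_nonneg_of_le hblock₁ ?_
    have hD : z ∈ Icc 1 2 ×ˢ ((norm : E → ℝ) ⁻¹' Iic 1) := ⟨ht, hx1⟩
    rw [powerBlock, indicator_of_mem hD]
    have hle (r : ℝ) (hr : 0 ≤ r) (hr1 : r ≤ 1) : r ^ p⁻¹ ≤ 1 :=
      Real.rpow_le_one hr hr1 (inv_nonneg.2 (zero_le_one.trans hp))
    have hh0 := hh.nonneg 0 K.zero_le _ hτ
    have hθ0 := hθ.nonneg (z.1 - 1)
    have hχ0 := hθ.logCutoff_nonneg (R := R) (L := 1) (‖z.2‖ ^ 2)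
    exact mul_le_of_le_one_right (by positivity) (mul_le_one₀ (mul_le_one₀
      (hle _ hθ0 (hθ.le_one _)) (by positivity) (hle _ hh0 (hh.le_one _))) (by positivity)
      (hle _ hχ0 (hθ.logCutoff_le_one _)))
  · refine le_add_of_le_of_nonneg ?_ hblock₂
    have hD : z ∈ Icc 1 2 ×ˢ ((norm : E → ℝ) ⁻¹' Icc 1 (Real.exp 1 * R)) := ⟨ht, hx1, hx⟩
    rw [powerBlock, indicator_of_mem hD]
    gcongr
    exact hθ.mul_rpow_le_caloricCutoff_rpow hh hn hs (zero_le_one.trans hp) hR0 hz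

theorem abs_caloricAdjoint_le (hθ : IsSmoothStep p C θ) (hh : IsDecayFamily p K D h)
    (hn : 2 ≤ n) (hs : 0 < s) (hM : IsCaloricBound n s p (Real.exp s) h K M) (hp : 1 ≤ p)
    (hR : 1 ≤ R) (hz : 0 < z.1) (hx : z.2 ≠ 0) :
    |caloricAdjoint E θ h n s K (R ^ s) R z|
      ≤ (powerBlock E 1 (R ^ s) (Iic (Real.exp 1 * R))
            (M * (1 + (4 + (n + 2 * (K * s))) * C) * R ^ (-((K + 1) * s))) ((K + 1) * s - 2) z
          + powerBlock E 1 2 (Icc 1 (Real.exp 1 * R)) (M * C) (s - 2) z)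
          * caloricCutoff E θ h n s K (R ^ s) R z ^ p⁻¹
        + powerBlock E 1 2 (Iic 1) (M * C) (s - 2) z := by
  rw [mul_one_add, add_mul M, ← powerBlock_add, caloricAdjoint]
  refine (abs_sub _ _).trans ((add_le_add_left (abs_sub _ _) _).trans ?_)
  linarith [hθ.abs_caloric_remainder_le hh hn hs hM hp hR hz hx,
    hθ.abs_caloric_time_le hh hn hs hM hp hR hz, hθ.abs_caloric_space_le hh hn hs hM hp hR hz hx]

end IsSmoothStep

end CaloricEstimate

section CaloricLimit

variable {E : Type*} [NormedAddCommGroup E] {σ₁ σ₂ ϱ p q d n s C D M R : ℝ} {w : E → ℝ}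
  {u : ℝ × E → ℝ} {θ : ℝ → ℝ} {h : ℕ → ℝ → ℝ} {K : ℕ}

theorem IsSmoothStep.abs_caloricCutoff_le (hθ : IsSmoothStep p C θ) (hh : IsDecayFamily p K D h)
    (hn : 2 ≤ n) (hs : 0 < s) (hM : IsCaloricBound n s p (Real.exp s) h K M) (hp : 0 ≤ p)
    (hR : 1 ≤ R) {t : ℝ} (ht : 0 < t) (x : E) :
    |caloricCutoff E θ h n s K (R ^ s) R (R ^ s * t, x)| ≤ (Iic 1).indicator (fun _ => M) t := by
  have hR0 : 0 < R := one_pos.trans_le hR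
  have hT : 0 < R ^ s := Real.rpow_pos_of_pos hR0 s
  have hM0 := hM.nonneg
  rw [abs_of_nonneg (hθ.caloricCutoff_nonneg hh hn hs hR0 (mul_pos hT ht)), caloricCutoff]
  rcases lt_or_ge 1 t with h1 | h1
  · rw [hθ.mul_caloricSum_eq_zero hh hT fun h => (lt_mul_of_one_lt_right hT h1).not_ge h.2,
      zero_mul, indicator_of_notMem (notMem_Iic.2 h1)]
  rw [indicator_of_mem (mem_Iic.2 h1), mul_div_cancel_left₀ _ hT.ne']
  rcases lt_or_ge (Real.exp 1 * R) ‖x‖ with hx | hx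
  · rwa [hθ.logCutoff_norm_sq_eq_zero hR le_rfl hx, mul_zero]
  have hy := norm_rpow_div_rpow_mem_Icc hs.le hR0 hx
  have hh0 := hh.nonneg 0 K.zero_le t ht.le
  have hsum0 := hh0.trans (hh.le_caloricSum hn hs ht.le hy.1)
  have hsum : caloricSum n s h K t (‖x‖ ^ s / R ^ s) ≤ M :=
    (hM.caloricSum_le t ht.le _ hy).trans
      (mul_le_of_le_one_right hM0 (Real.rpow_le_one hh0 (hh.le_one t) (inv_nonneg.2 hp)))
  calc _ ≤ 1 * M * 1 := by
        gcongr
        exacts [hθ.logCutoff_nonneg _, hθ.le_one _, hθ.logCutoff_le_one _]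
    _ = M := by ring

variable [MeasurableSpace E] [BorelSpace E]

theorem IsSmoothStep.hasTimeLimit_caloricCutoff (hθ : IsSmoothStep p C θ)
    (hh : IsDecayFamily p K D h) (hn : 2 ≤ n) (hs : 0 < s)
    (hM : IsCaloricBound n s p (Real.exp s) h K M) (hp : 0 ≤ p) :
    HasTimeLimit (fun R => R ^ s) (fun R => caloricCutoff E θ h n s K (R ^ s) R) (h 0) 1 M where
  scale_pos := by
    filter_upwards [eventually_gt_atTop 0] with R hR using Real.rpow_pos_of_pos hR s
  measurable R := by
    have hθm := hθ.contDiff.continuous.measurable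
    have hhm (k : ℕ) := (hh.contDiff k).continuous.measurable
    have hχm := hθ.measurable_logCutoff (R := R) (L := 1)
    unfold caloricCutoff caloricSum
    fun_prop
  abs_le := by
    filter_upwards [eventually_ge_atTop 1] with R hR t ht x
    exact hθ.abs_caloricCutoff_le hh hn hs hM hp hR ht x
  tendsto t ht x _ := by
    have hT := tendsto_rpow_atTop hs
    have hcont : Continuous (caloricSum n s h K t) := by
      unfold caloricSum
      fun_prop
    have hzero : caloricSum n s h K t 0 = h 0 t := by
      simp [caloricSum, Finset.sum_range_succ', caloricCoeff]
    have hlim := (hcont.tendsto 0).comp (hT.const_div_atTop (‖x‖ ^ s))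
    rw [hzero] at hlim
    refine hlim.congr' ?_
    filter_upwards [hT.eventually_gt_atTop 0, (hT.atTop_mul_const ht).eventually_ge_atTop 2,
      eventually_ge_atTop 1, eventually_ge_atTop ‖x‖] with R hTR hTt hR hxR
    rw [caloricCutoff, hθ.eq_one _ (by linarith), mul_div_cancel_left₀ _ hTR.ne',
      hθ.logCutoff_eq_one hR le_rfl (by positivity) (by gcongr), mul_one, one_mul,
      Function.comp_apply]

variable [InnerProductSpace ℝ E] [FiniteDimensional ℝ E]

theorem IsDistributionalSolution.integrableOn_powerBlock_mul_abs
    (hu : IsDistributionalSolution σ₁ σ₂ ϱ p w u) {t₀ : ℝ} (ht₀ : 0 < t₀) (t₁ A r : ℝ) :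
    IntegrableOn (fun z => powerBlock E t₀ t₁ (Iic r) A σ₁ z * |u z|) (positiveTimes E) volume := by
  have hblock : Icc t₀ t₁ ×ˢ ((norm : E → ℝ) ⁻¹' Iic r) = Icc t₀ t₁ ×ˢ Metric.closedBall 0 r := by
    ext z
    simp
  have hsub : Icc t₀ t₁ ×ˢ Metric.closedBall (0 : E) r ⊆ positiveTimes E :=
    prod_mono (fun t ht => ht₀.trans_le ht.1) (subset_univ _)
  have hcompact : IsCompact (Icc t₀ t₁ ×ˢ Metric.closedBall (0 : E) r) :=
    isCompact_Icc.prod (isCompact_closedBall 0 r)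
  have hint : IntegrableOn (fun z : ℝ × E => A * |‖z.2‖ ^ σ₁ * u z|)
      (Icc t₀ t₁ ×ˢ Metric.closedBall 0 r) volume :=
    (hu.locallyIntegrableOn_weighted.integrableOn_compact_subset hsub hcompact).abs.const_mul A
  refine (hint.integrable_indicator hcompact.measurableSet).integrableOn.congr_fun (fun z _ => ?_)
    (measurableSet_Ioi.prod MeasurableSet.univ)
  rw [powerBlock, hblock]
  by_cases hz : z ∈ Icc t₀ t₁ ×ˢ Metric.closedBall (0 : E) r
  · rw [indicator_of_mem hz, indicator_of_mem hz, abs_mul,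
      abs_of_nonneg (Real.rpow_nonneg (norm_nonneg z.2) σ₁)]
    ring
  · rw [indicator_of_notMem hz, indicator_of_notMem hz, zero_mul]

variable [Nontrivial E]

theorem integral_powerBlock_remainder_le {A a b m δ : ℝ} (hs : 0 ≤ s) (hR : 1 ≤ R) (hA : 0 ≤ A)
    (hq : 0 < q) (hδ : a * q + b + finrank ℝ E = δ) (hδ0 : 0 < δ) (hle : δ - m * q + s ≤ 0) :
    ∫ z in positiveTimes E,
        powerBlock E 1 (R ^ s) (Iic (Real.exp 1 * R)) (A * R ^ (-m)) a z ^ q * ‖z.2‖ ^ b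
      ≤ A ^ q * (sphereArea E / δ * Real.exp δ) := by
  have hR0 : 0 < R := one_pos.trans_le hR
  have hE := sphereArea_nonneg E
  have hpow : (R ^ (-m)) ^ q * R ^ s * R ^ δ ≤ 1 := by
    rw [← Real.rpow_mul hR0.le, ← Real.rpow_add hR0, ← Real.rpow_add hR0]
    exact Real.rpow_le_one_of_one_le_of_nonpos hR (by linarith)
  rw [integral_powerBlock_rpow_mul (by positivity) hq b measurableSet_Iic one_pos
      (Real.one_le_rpow hR hs), setIntegral_norm_rpow_Iic (hδ.symm ▸ hδ0) (by positivity), hδ,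
    Real.mul_rpow hA (by positivity), Real.mul_rpow (Real.exp_pos 1).le hR0.le, Real.exp_one_rpow]
  calc _ ≤ A ^ q * (R ^ (-m)) ^ q * R ^ s * (sphereArea E / δ * (Real.exp δ * R ^ δ)) := by
        gcongr
        linarith
    _ = A ^ q * (sphereArea E / δ * Real.exp δ) * ((R ^ (-m)) ^ q * R ^ s * R ^ δ) := by ring
    _ ≤ _ := mul_le_of_le_one_right (by positivity) hpow

theorem integral_powerBlock_initial_le {A a b : ℝ} (hR : 1 ≤ R) (hA : 0 ≤ A) (hq : 0 < q)
    (hd : a * q + b + finrank ℝ E = d) (hd0 : d ≤ 0) :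
    ∫ z in positiveTimes E, powerBlock E 1 2 (Icc 1 (Real.exp 1 * R)) A a z ^ q * ‖z.2‖ ^ b
      ≤ A ^ q * sphereArea E * (1 + Real.log R) := by
  have hL : 0 ≤ 1 + Real.log R := add_nonneg zero_le_one (Real.log_nonneg hR)
  have hexp : Real.exp 1 * R = Real.exp (1 + Real.log R) * 1 := by
    rw [Real.exp_add, Real.exp_log (one_pos.trans_le hR), mul_one]
  have hmax : max 1 (Real.exp ((1 + Real.log R) * d)) = 1 :=
    max_eq_left (Real.exp_le_one_iff.2 (mul_nonpos_of_nonneg_of_nonpos hL hd0))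
  have hshell := setIntegral_norm_rpow_Icc_le (E := E) (c := a * q + b) one_pos hL
  rw [hd, hmax, Real.one_rpow, one_mul, one_mul] at hshell
  rw [integral_powerBlock_rpow_mul hA hq b measurableSet_Icc one_pos one_le_two, hexp]
  calc _ ≤ A ^ q * (2 - 1) * (sphereArea E * (1 + Real.log R)) := by gcongr
    _ = _ := by ring

theorem IsDistributionalSolution.integral_source_caloricCutoff_le
    (hu : IsDistributionalSolution σ₁ σ₂ ϱ p w u) (hw : Integrable w volume)
    (hθ : IsSmoothStep p C θ) (hh : IsDecayFamily p K D h) (hE : 2 ≤ (finrank ℝ E : ℝ))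
    (hs : 0 < s) (hσ₁ : s - 2 = σ₁) (hpq : p.HolderConjugate q)
    (hd : σ₁ * q + σ₂ * (1 - q) + finrank ℝ E = d) (hd0 : d ≤ 0) {δ A₁ A₂ : ℝ}
    (hδ : d + K * s * q = δ) (hδ0 : 0 < δ)
    (hM : IsCaloricBound (finrank ℝ E) s p (Real.exp s) h K M)
    (hA₁ : M * (1 + (4 + (finrank ℝ E + 2 * (K * s))) * C) = A₁) (hA₂ : M * C = A₂) (hR : 1 ≤ R) :
    ∫ z in positiveTimes E, caloricCutoff E θ h (finrank ℝ E) s K (R ^ s) R z * (z.1 ^ ϱ * w z.2)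
      ≤ 2 ^ q * (A₁ ^ q * (sphereArea E / δ * Real.exp δ)
          + A₂ ^ q * sphereArea E * (1 + Real.log R))
        + ∫ z in positiveTimes E, powerBlock E 1 2 (Iic 1) A₂ (s - 2) z * |u z| := by
  have hR0 : 0 < R := one_pos.trans_le hR
  have hq := hpq.symm.pos
  have hC := hθ.const_nonneg
  have hM0 := hM.nonneg
  have hA₁0 : 0 ≤ A₁ := hA₁ ▸ by positivity
  have hA₂0 : 0 ≤ A₂ := hA₂ ▸ by positivity
  have hA₁R : 0 ≤ A₁ * R ^ (-(((K : ℝ) + 1) * s)) := by positivity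
  have hδ' : ((K + 1) * s - 2) * q + σ₂ * (1 - q) + finrank ℝ E = δ := by
    rw [← hδ, ← hd, ← hσ₁]
    ring
  have hadjoint (z : ℝ × E) (hz : 0 < z.1) (hx : z.2 ≠ 0) :=
    hθ.abs_caloricAdjoint_le hh hE hs hM hpq.lt.le hR hz hx
  rw [hA₁, hA₂] at hadjoint
  obtain ⟨Λ, htest, hΛ⟩ := hu.exists_isTestPair_caloricCutoff hw hθ hpq.nonneg hh hE hs hσ₁
    (Real.rpow_pos_of_pos hR0 s) hR
  have hsource := htest.integral_source_le hpq
    (fun z hz => hθ.caloricCutoff_nonneg hh hE hs hR0 hz)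
    (powerBlock_nonneg hA₁R) (powerBlock_nonneg hA₂0)
    (fun z hz hx => (hΛ z hx).symm ▸ hadjoint z hz hx)
    (integrableOn_powerBlock_rpow_mul hA₁R hq _ measurableSet_Iic
      (integrableOn_norm_rpow_Iic (hδ'.symm ▸ hδ0) _))
    (integrableOn_powerBlock_rpow_mul hA₂0 hq _ measurableSet_Icc
      (integrableOn_norm_rpow_Icc one_pos _))
    (hσ₁ ▸ hu.integrableOn_powerBlock_mul_abs one_pos 2 A₂ 1)
  have hremainder := integral_powerBlock_remainder_le hs.le hR hA₁0 hq hδ' hδ0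
    (m := (K + 1) * s) (by nlinarith [hpq.symm.lt])
  have hinitial := integral_powerBlock_initial_le hR hA₂0 hq (hσ₁.symm ▸ hd) hd0
  exact hsource.trans (by gcongr)

theorem IsDistributionalSolution.exists_integral_source_caloricCutoff_le
    (hu : IsDistributionalSolution σ₁ σ₂ ϱ p w u) (hw : Integrable w volume)
    (hθ : IsSmoothStep p C θ) (hh : IsDecayFamily p K D h) (hE : 2 ≤ (finrank ℝ E : ℝ))
    (hs : 0 < s) (hσ₁ : s - 2 = σ₁) (hpq : p.HolderConjugate q)
    (hd : σ₁ * q + σ₂ * (1 - q) + finrank ℝ E = d) (hd0 : d ≤ 0) (hK : 0 < d + K * s * q) :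
    ∃ B, ∀ R ≥ 1, ∫ z in positiveTimes E,
      caloricCutoff E θ h (finrank ℝ E) s K (R ^ s) R z * (z.1 ^ ϱ * w z.2)
        ≤ B * (1 + Real.log R) := by
  obtain ⟨M, hM⟩ := hh.exists_isCaloricBound hE hs (Real.exp s)
  have hC := hθ.const_nonneg
  have hM0 := hM.nonneg
  have hsphere := sphereArea_nonneg E
  obtain ⟨A₁, hA₁⟩ : ∃ A, M * (1 + (4 + (finrank ℝ E + 2 * (K * s))) * C) = A := ⟨_, rfl⟩
  obtain ⟨A₂, hA₂⟩ : ∃ A, M * C = A := ⟨_, rfl⟩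
  obtain ⟨δ, hδ⟩ : ∃ δ, d + K * s * q = δ := ⟨_, rfl⟩
  have hδ0 : 0 < δ := hδ ▸ hK
  have hA₁0 : 0 ≤ A₁ := hA₁ ▸ by positivity
  have hA₂0 : 0 ≤ A₂ := hA₂ ▸ by positivity
  have hnear : 0 ≤ ∫ z in positiveTimes E, powerBlock E 1 2 (Iic 1) A₂ (s - 2) z * |u z| :=
    integral_nonneg fun z => mul_nonneg (powerBlock_nonneg hA₂0 z) (abs_nonneg _)
  refine ⟨2 ^ q * (A₁ ^ q * (sphereArea E / δ * Real.exp δ) + A₂ ^ q * sphereArea E)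
    + ∫ z in positiveTimes E, powerBlock E 1 2 (Iic 1) A₂ (s - 2) z * |u z|, fun R hR => ?_⟩
  have hlog : 1 ≤ 1 + Real.log R := le_add_of_nonneg_right (Real.log_nonneg hR)
  have hremainder : 0 ≤ 2 ^ q * (A₁ ^ q * (sphereArea E / δ * Real.exp δ)) := by positivity
  refine (hu.integral_source_caloricCutoff_le hw hθ hh hE hs hσ₁ hpq hd hd0 hδ hδ0 hM hA₁ hA₂
    hR).trans ?_
  linarith [le_mul_of_one_le_right hremainder hlog, le_mul_of_one_le_right hnear hlog]

theorem tendsto_rpow_neg_mul_log (hs : 0 < s) (B : ℝ) :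
    Tendsto (fun R : ℝ => R ^ (-s) * (B * (1 + Real.log R))) atTop (𝓝 0) := by
  have hlog : Tendsto (fun R : ℝ => R ^ (-s) * Real.log R) atTop (𝓝 0) := by
    refine (isLittleO_log_rpow_atTop hs).tendsto_div_nhds_zero.congr' ?_
    filter_upwards [eventually_gt_atTop 0] with R hR
    rw [Real.rpow_neg hR.le, div_eq_inv_mul]
  have hlim := ((tendsto_rpow_neg_atTop hs).add hlog).const_mul B
  rw [add_zero, mul_zero] at hlim
  exact hlim.congr fun R => by ring

theorem IsDistributionalSolution.integral_le_zero_of_nonpos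
    (hu : IsDistributionalSolution σ₁ σ₂ ϱ p w u) (hw : Integrable w volume) (hϱ : -1 < ϱ)
    (hσ₁ : -2 < σ₁) (hE : 2 ≤ (finrank ℝ E : ℝ)) (hpq : p.HolderConjugate q)
    (hd : σ₁ * q + σ₂ * (1 - q) + finrank ℝ E = d) (hd0 : d ≤ 0) : ∫ x, w x ≤ 0 := by
  obtain ⟨s, hs⟩ : ∃ s, s - 2 = σ₁ := ⟨σ₁ + 2, by ring⟩
  have hs0 : 0 < s := by linarith
  have hsq : 0 < s * q := mul_pos hs0 hpq.symm.pos
  obtain ⟨K, hK⟩ := exists_nat_gt (-d / (s * q))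
  have hδ : 0 < d + K * s * q := by
    rw [div_lt_iff₀ hsq] at hK
    linarith
  obtain ⟨θ, C, hθ⟩ := exists_isSmoothStep hpq.lt
  obtain ⟨h, D, hh⟩ := exists_isDecayFamily hpq.lt K
  obtain ⟨M, hM⟩ := hh.exists_isCaloricBound hE hs0 (Real.exp s)
  obtain ⟨B, hB⟩ := hu.exists_integral_source_caloricCutoff_le hw hθ hh hE hs0 hs hpq hd hd0 hδ
  refine (hθ.hasTimeLimit_caloricCutoff (E := E) hh hE hs0 hM hpq.nonneg).integral_le_zero hϱ hw ?_
    (hh.contDiff 0).continuous (fun t ht => hh.nonneg 0 K.zero_le t ht.le) (t₀ := 1 / 2)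
    (by norm_num) (hh.pos _ (by norm_num)) (B := fun R => B * (1 + Real.log R)) ?_ ?_
  · filter_upwards [eventually_ge_atTop 1] with R hR
    obtain ⟨Λ, htest, -⟩ := hu.exists_isTestPair_caloricCutoff hw hθ hpq.nonneg hh hE hs0 hs
      (Real.rpow_pos_of_pos (one_pos.trans_le hR) s) hR
    exact htest.integrable_source
  · filter_upwards [eventually_ge_atTop 1] with R hR using hB R hR
  · refine (tendsto_rpow_neg_mul_log (mul_pos hs0 (by linarith : 0 < 1 + ϱ)) B).congr' ?_
    filter_upwards [eventually_gt_atTop 0] with R hR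
    rw [← Real.rpow_mul hR.le, mul_neg]

end CaloricLimit

section Nonexistence

variable {E : Type*} [NormedAddCommGroup E] [InnerProductSpace ℝ E] [FiniteDimensional ℝ E]
  [MeasurableSpace E] [BorelSpace E] {σ₁ σ₂ ϱ p : ℝ} {w : E → ℝ} {u : ℝ × E → ℝ}

theorem IsDistributionalSolution.integral_le_zero_of_scaling {q d e m : ℝ}
    (hu : IsDistributionalSolution σ₁ σ₂ ϱ p w u) (hw : Integrable w volume) (hϱ : -1 < ϱ)
    (hσ₁ : -2 < σ₁) (hE : 2 ≤ finrank ℝ E) (hpq : p.HolderConjugate q)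
    (hd : σ₁ * q + σ₂ * (1 - q) + finrank ℝ E = d)
    (he : -2 * q + σ₂ * (1 - q) + finrank ℝ E = e)
    (hdm : d < m * (ϱ + q)) (hem : e < m * ϱ) : ∫ x, w x ≤ 0 := by
  have : Nontrivial E := Module.nontrivial_of_finrank_pos (R := ℝ) (by lia)
  rcases le_or_gt d 0 with hd0 | hd0
  · exact hu.integral_le_zero_of_nonpos hw hϱ hσ₁ (mod_cast hE) hpq hd hd0
  · exact hu.integral_le_zero_of_tendsto hw hϱ hpq hd hd0 he
      ((eventually_gt_atTop 0).mono fun R hR => Real.rpow_pos_of_pos hR m)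
      (Eventually.of_forall fun _ => le_rfl) (tendsto_cutoffCost_rpow hdm hem)

theorem IsDistributionalSolution.integral_le_zero_of_pos
    (hu : IsDistributionalSolution σ₁ σ₂ ϱ p w u) (hw : Integrable w volume) (hϱ : 0 < ϱ)
    (hσ₁ : -2 < σ₁) (hE : 2 ≤ finrank ℝ E) (hp : 1 < p) : ∫ x, w x ≤ 0 := by
  have hpq := Real.HolderConjugate.conjExponent hp
  have hq := hpq.symm.pos
  obtain ⟨m, hdm, hem⟩ := (((tendsto_id.atTop_mul_const (add_pos hϱ hq)).eventually_gt_atTop _).and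
    ((tendsto_id.atTop_mul_const hϱ).eventually_gt_atTop _)).exists
  exact hu.integral_le_zero_of_scaling hw (by linarith) hσ₁ hE hpq rfl rfl hdm hem

theorem spatialExponent_eq {q n : ℝ} (hpq : p.HolderConjugate q) :
    -2 * q + σ₂ * (1 - q) + n = (p * (n - 2) - (n + σ₂)) / (p - 1) := by
  have := hpq.sub_one_ne_zero
  rw [hpq.conjugate_eq]
  field_simp
  ring

theorem IsDistributionalSolution.integral_le_zero_of_subcritical
    (hu : IsDistributionalSolution σ₁ σ₂ ϱ p w u) (hw : Integrable w volume) (hϱ : -1 < ϱ)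
    (hσ₁ : -2 < σ₁) (hE : 2 ≤ finrank ℝ E) (hp : 1 < p)
    (hlt : p * (finrank ℝ E - 2 - ϱ * (2 + σ₁)) < finrank ℝ E + σ₂ - ϱ * (2 + σ₁)) :
    ∫ x, w x ≤ 0 := by
  have hpq := Real.HolderConjugate.conjExponent hp
  have hem : -2 * p.conjExponent + σ₂ * (1 - p.conjExponent) + finrank ℝ E < (2 + σ₁) * ϱ := by
    rw [spatialExponent_eq hpq, div_lt_iff₀ (by linarith)]
    linarith
  exact hu.integral_le_zero_of_scaling hw hϱ hσ₁ hE hpq rfl rfl (by linarith) hem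

theorem IsDistributionalSolution.integral_le_zero_of_critical
    (hu : IsDistributionalSolution σ₁ σ₂ 0 p w u) (hw : Integrable w volume)
    (hσ₁ : -2 < σ₁) (hE : 2 ≤ finrank ℝ E) (hp : 1 < p)
    (hle : p * (finrank ℝ E - 2) ≤ finrank ℝ E + σ₂) : ∫ x, w x ≤ 0 := by
  have : Nontrivial E := Module.nontrivial_of_finrank_pos (R := ℝ) (by lia)
  have hpq := Real.HolderConjugate.conjExponent hp
  obtain ⟨d, hd⟩ : ∃ d, σ₁ * p.conjExponent + σ₂ * (1 - p.conjExponent) + finrank ℝ E = d :=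
    ⟨_, rfl⟩
  rcases le_or_gt d 0 with hd0 | hd0
  · exact hu.integral_le_zero_of_nonpos hw (by norm_num) hσ₁ (mod_cast hE) hpq hd hd0
  · have he : -2 * p.conjExponent + σ₂ * (1 - p.conjExponent) + finrank ℝ E ≤ 0 := by
      rw [spatialExponent_eq hpq]
      exact div_nonpos_of_nonpos_of_nonneg (by linarith) (by linarith)
    obtain ⟨m, hdm⟩ :=
      ((tendsto_id.atTop_mul_const hpq.symm.pos).eventually_gt_atTop (2 * d)).exists
    exact hu.integral_le_zero_of_tendsto hw (by norm_num) hpq hd hd0 rfl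
      ((eventually_gt_atTop 0).mono fun R hR => Real.rpow_pos_of_pos hR m)
      (Real.tendsto_log_atTop.eventually_ge_atTop 1) (tendsto_cutoffCost_log hpq.symm.lt he hdm)

theorem theorem1p1_general (hE : 2 ≤ finrank ℝ E) (hσ₁ : -2 < σ₁) (hσ₂ : -2 < σ₂) (hp : 1 < p)
    (hw : Integrable w volume) (hw_pos : 0 < ∫ x, w x) :
    (0 < ϱ → ¬ ∃ u, IsDistributionalSolution σ₁ σ₂ ϱ p w u) ∧
    (-1 < ϱ → ϱ < 0 →
      p < (finrank ℝ E + σ₂ - ϱ * (2 + σ₁)) / (finrank ℝ E - 2 - ϱ * (2 + σ₁)) →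
        ¬ ∃ u, IsDistributionalSolution σ₁ σ₂ ϱ p w u) ∧
    (ϱ = 0 → (finrank ℝ E = 2 ∨ p ≤ (finrank ℝ E + σ₂) / (finrank ℝ E - 2)) →
        ¬ ∃ u, IsDistributionalSolution σ₁ σ₂ ϱ p w u) := by
  have hn : (2 : ℝ) ≤ finrank ℝ E := mod_cast hE
  refine ⟨?_, ?_, ?_⟩
  · rintro hϱ ⟨u, hu⟩
    exact hw_pos.not_ge (hu.integral_le_zero_of_pos hw hϱ hσ₁ hE hp)
  · rintro hϱ hϱ0 hlt ⟨u, hu⟩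
    have hscale : ϱ * (2 + σ₁) < 0 := mul_neg_of_neg_of_pos hϱ0 (by linarith)
    rw [lt_div_iff₀ (by linarith)] at hlt
    exact hw_pos.not_ge (hu.integral_le_zero_of_subcritical hw hϱ hσ₁ hE hp hlt)
  · rintro rfl hcrit ⟨u, hu⟩
    refine hw_pos.not_ge (hu.integral_le_zero_of_critical hw hσ₁ hE hp ?_)
    rcases hE.eq_or_lt with h2 | h3
    · norm_num [← h2]
      linarith
    · exact (le_div_iff₀ (sub_pos.2 (mod_cast h3))).1 (hcrit.resolve_left h3.ne')

end Nonexistence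

theorem theorem1p1 (N : ℕ) (hN : 2 ≤ N) (σ₁ σ₂ ϱ p : ℝ) (hσ₁ : -2 < σ₁) (hσ₂ : -2 < σ₂)
    (hp : 1 < p) (u₀ w : EuclideanSpace ℝ (Fin N) → ℝ)
    (hu₀ : LocallyIntegrable u₀ volume) (hw : Integrable w volume) (hw_pos : 0 < ∫ x, w x) :
    (0 < ϱ → ¬ ∃ u, IsGlobalWeakSolution σ₁ σ₂ ϱ p w u₀ u) ∧
    (-1 < ϱ → ϱ < 0 →
      p < ((N : ℝ) + σ₂ - ϱ * (2 + σ₁)) / ((N : ℝ) - 2 - ϱ * (2 + σ₁)) →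
        ¬ ∃ u, IsGlobalWeakSolution σ₁ σ₂ ϱ p w u₀ u) ∧
    (ϱ = 0 → (N = 2 ∨ p ≤ ((N : ℝ) + σ₂) / ((N : ℝ) - 2)) →
        ¬ ∃ u, IsGlobalWeakSolution σ₁ σ₂ ϱ p w u₀ u) := by
  have hdist : (∃ u, IsGlobalWeakSolution σ₁ σ₂ ϱ p w u₀ u) →
      ∃ u, IsDistributionalSolution σ₁ σ₂ ϱ p w u :=
    fun ⟨u, hu⟩ => ⟨u, hu.isDistributionalSolution⟩
  have hE : finrank ℝ (EuclideanSpace ℝ (Fin N)) = N := finrank_euclideanSpace_fin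
  have h := theorem1p1_general (ϱ := ϱ) (hN.trans_eq hE.symm) hσ₁ hσ₂ hp hw hw_pos
  rw [hE] at h
  exact ⟨fun h₁ => mt hdist (h.1 h₁), fun h₁ h₂ h₃ => mt hdist (h.2.1 h₁ h₂ h₃),
    fun h₁ h₂ => mt hdist (h.2.2 h₁ h₂)⟩
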